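/- Let $F$ be a field of characteristic $0$, $M\neq\{0\}$ an additive subgroup of $F$, and $\alpha\in F$ with $2\alpha\in M$. The generalized super-Virasoro algebra $\mathrm{SVir}[M,\alpha]$ is the Lie superalgebra over $F$ with even basis elements $L_\mu$ $(\mu\in M)$, $c$ and odd basis elements $G_\nu$ $(\nu\in\alpha+M)$, where $c$ is central and, for $\mu,\mu'\in M$, $\nu,\eta\in\alpha+M$, $$[L_\mu,L_{\mu'}]=(\mu'-\mu)L_{\mu+\mu'}+\tfrac1{12}(\mu^3-\mu)\delta_{\mu+\mu',0}\,c,\quad [L_\mu,G_\nu]=(\nu-\tfrac12\mu)G_{\mu+\nu},$$ $$[G_\nu,G_\eta]=2L_{\nu+\eta}-\tfrac13(\nu^2-\tfrac14)\delta_{\nu+\eta,0}\,c.$$ A module of the intermediate series over $\mathrm{SVir}[M,\alpha]$ is a $\mathbb Z/2$-graded module $V=V_{\bar0}\oplus V_{\bar1}$ which is indecomposable (nonzero and not a direct sum of two nonzero graded submodules), is the direct sum of its weight spaces $V_\lambda=\{v\in V: L_0v=\lambda v\}$, $\lambda\in F$, and satisfies $\dim(V_\sigma\cap V_\lambda)\le1$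 for all $\sigma\in\mathbb Z/2$ and $\lambda\in F$. For $a,b\in F$ define the following modules, on all of which $c$ acts as $0$; throughout $\lambda,\mu\in M$ and $\nu,\eta\in\alpha+M$, and the $v$'s are even and the $w$'s odd. * $SA_{a,b}(M,\alpha)$, with basis $\{v_\mu\}_{\mu\in M}\cup\{w_\nu\}_{\nu\in\alpha+M}$: $L_\lambda v_\mu=(a+\mu+\lambda b)v_{\lambda+\mu}$, $L_\lambda w_\nu=(a+\nu+\lambda(b-\tfrac12))w_{\lambda+\nu}$, $G_\eta v_\mu=w_{\eta+\mu}$, $G_\eta w_\nu=(a+\nu+2\eta(b-\tfrac12))v_{\eta+\nu}$. * $SA_a(M,\alpha)$, with basis $\{v_\mu\}_{\mu\in M}\cup\{w_\nu\}_{\nu\in\alpha+M}$: $L_\lambda v_\mu=(\mu+\lambda)v_{\lambda+\mu}$ for $\mu\ne0$, $L_\lambda v_0=\lambda(\lambda+a)v_\lambda$, $L_\lambda w_\nu=(\nu+\tfrac\lambda2)w_{\lambda+\nu}$, $G_\eta v_\mu=w_{\eta+\mu}$ for $\mu\neq0$, $G_\eta v_0=(2\eta+a)w_\eta$, $G_\eta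 w_\nu=(\nu+\eta)v_{\eta+\nu}$. * $SB_a(M,\alpha)$, with basis $\{v_\nu\}_{\nu\in\alpha+M}\cup\{w_\mu\}_{\mu\in M}$: $L_\lambda v_\nu=(\nu+\tfrac\lambda2)v_{\lambda+\nu}$, $L_\lambda w_\mu=\mu w_{\lambda+\mu}$ for $\mu\ne-\lambda$, $L_\lambda w_{-\lambda}=-\lambda(\lambda+a)w_0$, $G_\eta v_\nu=w_{\eta+\nu}$ for $\nu\ne-\eta$, $G_\eta v_{-\eta}=(2\eta+a)w_0$, $G_\eta w_\mu=\mu v_{\eta+\mu}$. **Theorem.** Every module of the intermediate series over $\mathrm{SVir}[M,\alpha]$ is isomorphic to one of $SA_{a,b}(M,\alpha)$, $SA_a(M,\alpha)$, $SB_a(M,\alpha)$ with $a,b\in F$, or to a nonzero (graded) subquotient of one of them. Here an isomorphism is a linear bijection which commutes with the action and either preserves or interchanges the two parities. -/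

import Mathlib

/-- A Lie superalgebra structure on a vector space `L` over `F` (of characteristic zero in all
uses): a `ℤ/2`-grading together with an even bilinear bracket which is super-skew-symmetric and
satisfies the super-Jacobi identity. -/
structure LieSuperalgebra (F : Type*) [Field F] (L : Type*) [AddCommGroup L] [Module F L] where
  comp : ZMod 2 → Submodule F L
  isCompl : IsCompl (comp 0) (comp 1)
  bracket : L →ₗ[F] L →ₗ[F] L
  bracket_mem : ∀ (i j : ZMod 2) (x y : L), x ∈ comp i → y ∈ comp j → bracket x y ∈ comp (i + j)
  skew : ∀ (i j : ZMod 2) (x y : L), x ∈ comp i → y ∈ comp j →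
    bracket x y = -((-1 : F) ^ (i.val * j.val) • bracket y x)
  jacobi : ∀ (i j : ZMod 2) (x y z : L), x ∈ comp i → y ∈ comp j →
    bracket x (bracket y z) =
      bracket (bracket x y) z + (-1 : F) ^ (i.val * j.val) • bracket y (bracket x z)

/-- A `ℤ/2`-graded module `V = V₀ ⊕ V₁` over a Lie superalgebra. -/
structure SuperModule {F : Type*} [Field F] {L : Type*} [AddCommGroup L] [Module F L]
    (S : LieSuperalgebra F L) (V : Type*) [AddCommGroup V] [Module F V] where
  comp : ZMod 2 → Submodule F V
  isCompl : IsCompl (comp 0) (comp 1)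
  act : L →ₗ[F] V →ₗ[F] V
  act_mem : ∀ (i j : ZMod 2) (x : L) (v : V), x ∈ S.comp i → v ∈ comp j → act x v ∈ comp (i + j)
  act_bracket : ∀ (i j : ZMod 2) (x y : L) (v : V), x ∈ S.comp i → y ∈ S.comp j →
    act (S.bracket x y) v = act x (act y v) - (-1 : F) ^ (i.val * j.val) • act y (act x v)

namespace SuperModule

variable {F : Type*} [Field F] {L : Type*} [AddCommGroup L] [Module F L]
  {S : LieSuperalgebra F L} {V : Type*} [AddCommGroup V] [Module F V]
  {W : Type*} [AddCommGroup W] [Module F W]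

/-- A graded submodule: a subspace stable under the action which contains the homogeneous
components of each of its elements. -/
structure GradedSubmodule (A : SuperModule S V) where
  carrier : Submodule F V
  act_mem : ∀ (x : L) (v : V), v ∈ carrier → A.act x v ∈ carrier
  graded : ∀ v₀ ∈ A.comp 0, ∀ v₁ ∈ A.comp 1, v₀ + v₁ ∈ carrier → v₀ ∈ carrier ∧ v₁ ∈ carrier

/-- A graded submodule, as a module in its own right. -/
def sub (A : SuperModule S V) (K : A.GradedSubmodule) : SuperModule S K.carrier where
  comp i := (A.comp i).comap K.carrier.subtype
  isCompl := by
    refine ⟨?_, ?_⟩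
    · rw [Submodule.disjoint_def]
      intro x h0 h1
      exact Subtype.ext (Submodule.disjoint_def.1 A.isCompl.disjoint x.1 h0 h1)
    · rw [codisjoint_iff, eq_top_iff]
      rintro ⟨x, hx⟩ -
      have hx' : x ∈ A.comp 0 ⊔ A.comp 1 := by
        rw [A.isCompl.sup_eq_top]; trivial
      obtain ⟨y, hy, z, hz, rfl⟩ := Submodule.mem_sup.1 hx'
      obtain ⟨h0, h1⟩ := K.graded y hy z hz hx
      exact Submodule.mem_sup.2 ⟨⟨y, h0⟩, hy, ⟨z, h1⟩, hz, rfl⟩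
  act :=
    { toFun := fun x => (A.act x).restrict (K.act_mem x)
      map_add' := fun x y => by ext v; simp
      map_smul' := fun r x => by ext v; simp }
  act_mem i j x v hx hv := A.act_mem i j x v.1 hx hv
  act_bracket i j x y v hx hy := Subtype.ext (A.act_bracket i j x y v.1 hx hy)

/-- The quotient of a module by a graded submodule. -/
def quot (A : SuperModule S V) (N : A.GradedSubmodule) : SuperModule S (V ⧸ N.carrier) where
  comp i := (A.comp i).map N.carrier.mkQ
  isCompl := by
    refine ⟨?_, ?_⟩
    · rw [Submodule.disjoint_def]
      rintro _ ⟨y, hy, rfl⟩ ⟨z, hz, h⟩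
      have h' : y + -z ∈ N.carrier := by
        rw [← sub_eq_add_neg]
        exact (Submodule.Quotient.eq _).1 h.symm
      exact (Submodule.Quotient.mk_eq_zero _).2
        (N.graded y hy (-z) ((A.comp 1).neg_mem hz) h').1
    · rw [codisjoint_iff, ← Submodule.map_sup, A.isCompl.sup_eq_top, Submodule.map_top,
        Submodule.range_mkQ]
  act :=
    { toFun := fun x => N.carrier.mapQ N.carrier (A.act x) (fun v hv => N.act_mem x v hv)
      map_add' := fun x y => by ext v; simp
      map_smul' := fun r x => by ext v; simp }
  act_mem := by
    rintro i j x _ hx ⟨v, hv, rfl⟩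
    exact ⟨A.act x v, A.act_mem i j x v hx hv, rfl⟩
  act_bracket i j x y v hx hy := by
    obtain ⟨v, rfl⟩ := Submodule.mkQ_surjective _ v
    exact congrArg N.carrier.mkQ (A.act_bracket i j x y v hx hy)

/-- Isomorphism of modules by a homogeneous linear bijection, which either preserves the parity
(`s = 0`) or reverses it (`s = 1`). -/
def Isomorphic (A : SuperModule S V) (B : SuperModule S W) : Prop :=
  ∃ (s : ZMod 2) (f : V ≃ₗ[F] W),
    (∀ (i : ZMod 2) (v : V), v ∈ A.comp i → f v ∈ B.comp (i + s)) ∧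
      ∀ (x : L) (v : V), f (A.act x v) = B.act x (f v)

/-- `A` is isomorphic to a nonzero subquotient `K / N` of `B`. -/
def IsNonzeroSubquotient (A : SuperModule S V) (B : SuperModule S W) : Prop :=
  ∃ (K : B.GradedSubmodule) (N : (B.sub K).GradedSubmodule),
    N.carrier ≠ ⊤ ∧ A.Isomorphic ((B.sub K).quot N)

/-- A module is indecomposable if it is nonzero and is not the direct sum of two nonzero graded
submodules. -/
def Indecomposable (A : SuperModule S V) : Prop :=
  Nontrivial V ∧ ∀ K N : A.GradedSubmodule, IsCompl K.carrier N.carrier →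
    K.carrier = ⊥ ∨ N.carrier = ⊥

end SuperModule

set_option linter.unusedSimpArgs false

namespace SVir

variable {F : Type*} [Field F]

/-- The coset `α + M`. -/
abbrev Coset (M : AddSubgroup F) (α : F) : Type _ := {x : F // x - α ∈ M}

/-- `μ + ν ∈ α + M` for `μ ∈ M`, `ν ∈ α + M`. -/
def addC {M : AddSubgroup F} {α : F} (μ : M) (ν : Coset M α) : Coset M α :=
  ⟨μ + ν, by
    have h : (μ : F) + ν - α = μ + (ν - α) := by ring
    rw [h]; exact M.add_mem μ.2 ν.2⟩

/-- `η + ν ∈ M` for `η, ν ∈ α + M`, where `2 α ∈ M`. -/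
def addCC {M : AddSubgroup F} {α : F} (hα : 2 * α ∈ M) (η ν : Coset M α) : M :=
  ⟨η + ν, by
    have h : (η : F) + ν = (η - α) + (ν - α) + 2 * α := by ring
    rw [h]; exact M.add_mem (M.add_mem η.2 ν.2) hα⟩

/-- The basis `{L_μ, G_ν, c | μ ∈ M, ν ∈ α + M}`. -/
inductive Gen (M : AddSubgroup F) (α : F) : Type _
  | L (μ : M) : Gen M α
  | G (ν : Coset M α) : Gen M α
  | c : Gen M α

/-- The parity of a basis element. -/
def Gen.parity {M : AddSubgroup F} {α : F} : Gen M α → ZMod 2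
  | .L _ => 0
  | .G _ => 1
  | .c => 0

/-- The underlying vector space of the algebra. -/
abbrev Space (M : AddSubgroup F) (α : F) : Type _ := Gen M α →₀ F

open Finsupp in
open scoped Classical in
/-- The brackets of the basis elements. -/
noncomputable def genBracket {M : AddSubgroup F} {α : F} (hα : 2 * α ∈ M) :
    Gen M α → Gen M α → Space M α
  | .L μ, .L ν => single (.L (μ + ν)) ((ν : F) - μ) +
      single .c (if (μ : F) + ν = 0 then (1 / 12 : F) * ((μ : F) ^ 3 - μ) else 0)
  | .L μ, .G ν => single (.G (addC μ ν)) ((ν : F) - 1 / 2 * μ)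
  | .G ν, .L μ => -single (.G (addC μ ν)) ((ν : F) - 1 / 2 * μ)
  | .G ν, .G η => single (.L (addCC hα ν η)) 2 -
      single .c (if (ν : F) + η = 0 then (1 / 3 : F) * ((ν : F) ^ 2 - 1 / 4) else 0)
  | .c, _ => 0
  | _, .c => 0

/-- The bilinear extension of a function of two basis elements. -/
noncomputable def extend {X Y Z : Type*} (f : X → Y → (Z →₀ F)) :
    (X →₀ F) →ₗ[F] (Y →₀ F) →ₗ[F] (Z →₀ F) :=
  Finsupp.linearCombination F (fun x => Finsupp.linearCombination F (f x))

@[simp] lemma extend_single {X Y Z : Type*} (f : X → Y → (Z →₀ F)) (x : X) (y : Y) (r s : F) :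
    extend f (Finsupp.single x r) (Finsupp.single y s) = (r * s) • f x y := by
  simp [extend, Finsupp.linearCombination_single, smul_smul]

/-- The span of the basis elements of parity `i`. -/
def parityPart {X : Type*} (p : X → ZMod 2) (i : ZMod 2) : Submodule F (X →₀ F) :=
  Finsupp.supported F F {x | p x = i}

lemma parityPart_isCompl {X : Type*} (p : X → ZMod 2) :
    IsCompl (parityPart (F := F) p 0) (parityPart p 1) := by
  have hc : ({x | p x = 1} : Set X) = {x | p x = 0}ᶜ := by
    ext x
    have h : ∀ i : ZMod 2, i = 1 ↔ ¬ i = 0 := by decide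
    exact h (p x)
  rw [parityPart, parityPart, hc]
  refine ⟨Finsupp.disjoint_supported_supported disjoint_compl_right, ?_⟩
  rw [codisjoint_iff, ← Finsupp.supported_union, Set.union_compl_self, Finsupp.supported_univ]

lemma parityPart_induction {X : Type*} {p : X → ZMod 2} {i : ZMod 2} {P : (X →₀ F) → Prop}
    (h0 : P 0) (hadd : ∀ f g, P f → P g → P (f + g)) (hsmul : ∀ (r : F) f, P f → P (r • f))
    (hs : ∀ x, p x = i → P (Finsupp.single x 1)) {f : X →₀ F} (hf : f ∈ parityPart p i) : P f := by
  rw [parityPart, Finsupp.supported_eq_span_single] at hf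
  induction hf using Submodule.span_induction with
  | mem _ h => obtain ⟨x, hx, rfl⟩ := h; exact hs x hx
  | zero => exact h0
  | add f g _ _ hf hg => exact hadd f g hf hg
  | smul r f _ hf => exact hsmul r f hf

section
variable {M : AddSubgroup F} {α : F}

@[simp] lemma addC_val (μ : M) (ν : Coset M α) : ((addC μ ν : Coset M α) : F) = μ + ν := rfl

@[simp] lemma addCC_val (hα : 2 * α ∈ M) (η ν : Coset M α) :
    ((addCC hα η ν : M) : F) = η + ν := rfl

lemma genBracket_mem (hα : 2 * α ∈ M) (g h : Gen M α) :
    genBracket hα g h ∈ parityPart (F := F) Gen.parity (g.parity + h.parity) := by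
  have hs : ∀ (k : Gen M α) (r : F), Finsupp.single k r ∈ parityPart (F := F) Gen.parity k.parity :=
    fun k r => Finsupp.single_mem_supported F r rfl
  have h2 : (1 + 1 : ZMod 2) = 0 := by decide
  rcases g with μ | μ | _ <;> rcases h with ν | ν | _ <;>
    simp only [genBracket, Gen.parity, h2, add_zero, zero_add]
  · exact Submodule.add_mem _ (hs (.L _) _) (hs .c _)
  · exact hs (.G _) _
  · exact Submodule.zero_mem _
  · exact Submodule.neg_mem _ (hs (.G _) _)
  · exact Submodule.sub_mem _ (hs (.L _) _) (hs .c _)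
  all_goals exact Submodule.zero_mem _

lemma genBracket_skew (hα : 2 * α ∈ M) (g h : Gen M α) :
    genBracket hα g h =
      -((-1 : F) ^ (g.parity.val * h.parity.val) • genBracket hα h g) := by
  rcases g with μ | μ | _ <;> rcases h with ν | ν | _ <;>
    simp only [genBracket, Gen.parity, ZMod.val_one, ZMod.val_zero, mul_zero, zero_mul, mul_one,
      pow_zero, pow_one, one_smul, neg_smul, smul_zero, neg_neg, neg_zero]
  · have e : ν + μ = μ + ν := add_comm _ _
    have e' : (ν : F) + μ = μ + ν := add_comm _ _
    rw [e, e', neg_add, ← Finsupp.single_neg, ← Finsupp.single_neg]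
    congr 2
    · ring
    · split_ifs with h0
      · have : (ν : F) = -μ := by linear_combination h0
        rw [this]; ring
      · simp
  · have e : addCC hα ν μ = addCC hα μ ν := Subtype.ext (add_comm _ _)
    have e' : (ν : F) + μ = μ + ν := add_comm _ _
    rw [e, e']
    congr 2
    split_ifs with h0
    · have : (ν : F) = -μ := by linear_combination h0
      rw [this]; ring
    · rfl

lemma extend_mem {X Y Z : Type*} {p : X → ZMod 2} {q : Y → ZMod 2} {t : Z → ZMod 2}
    {f : X → Y → (Z →₀ F)} (h : ∀ x y, f x y ∈ parityPart t (p x + q y)) {i j : ZMod 2}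
    {u : X →₀ F} {v : Y →₀ F} (hu : u ∈ parityPart p i) (hv : v ∈ parityPart q j) :
    extend f u v ∈ parityPart t (i + j) := by
  refine parityPart_induction (P := fun u => extend f u v ∈ parityPart t (i + j))
    (by simp) (fun _ _ h1 h2 => by simpa using Submodule.add_mem _ h1 h2)
    (fun r _ h1 => by simpa using Submodule.smul_mem _ r h1) (fun x hx => ?_) hu
  refine parityPart_induction
    (P := fun v => extend f (Finsupp.single x 1) v ∈ parityPart t (i + j))
    (by simp) (fun _ _ h1 h2 => by simpa using Submodule.add_mem _ h1 h2)
    (fun r _ h1 => by simpa using Submodule.smul_mem _ r h1) (fun y hy => ?_) hv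
  rw [extend_single, one_mul, one_smul, ← hx, ← hy]
  exact h x y

/-- If an action `f` of the basis elements on basis vectors satisfies the (super)commutation
relations on basis elements, then so does its bilinear extension. -/
lemma extend_bracket {X Y : Type*} {p : X → ZMod 2} {b : X → X → (X →₀ F)}
    {f : X → Y → (Y →₀ F)}
    (h : ∀ x y z, extend f (b x y) (Finsupp.single z 1) =
      extend f (Finsupp.single x 1) (f y z) -
        (-1 : F) ^ ((p x).val * (p y).val) • extend f (Finsupp.single y 1) (f x z))
    {i j : ZMod 2} {u v : X →₀ F} (w : Y →₀ F)
    (hu : u ∈ parityPart p i) (hv : v ∈ parityPart p j) :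
    extend f (extend b u v) w =
      extend f u (extend f v w) - (-1 : F) ^ (i.val * j.val) • extend f v (extend f u w) := by
  refine parityPart_induction (P := fun u => extend f (extend b u v) w =
      extend f u (extend f v w) - (-1 : F) ^ (i.val * j.val) • extend f v (extend f u w))
    (by simp) (fun _ _ h1 h2 => ?_) (fun r _ h1 => ?_) (fun x hx => ?_) hu
  · simp only [map_add, LinearMap.add_apply, h1, h2, smul_add]; abel
  · simp only [map_smul, LinearMap.smul_apply, h1, smul_sub, smul_comm r]
  refine parityPart_induction (P := fun v => extend f (extend b (Finsupp.single x 1) v) w =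
      extend f (Finsupp.single x 1) (extend f v w) -
        (-1 : F) ^ (i.val * j.val) • extend f v (extend f (Finsupp.single x 1) w))
    (by simp) (fun _ _ h1 h2 => ?_) (fun r _ h1 => ?_) (fun y hy => ?_) hv
  · simp only [map_add, LinearMap.add_apply, h1, h2, smul_add]; abel
  · simp only [map_smul, LinearMap.smul_apply, h1, smul_sub, smul_comm r]
  induction w using Finsupp.induction_linear with
  | zero => simp
  | add w₁ w₂ h1 h2 => simp only [map_add, h1, h2, smul_add]; abel
  | single z r =>
    have hz : Finsupp.single z r = r • Finsupp.single z (1 : F) := by simp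
    rw [hz]
    simp only [map_smul, smul_comm _ r, ← smul_sub]
    congr 1
    subst hx hy
    simpa using h x y z

/-- `coef x k` is `1` if `x = k` and `0` otherwise. -/
noncomputable def coef {X : Type*} (F : Type*) [Field F] (x k : X) : F := Finsupp.single x (1 : F) k

lemma single_coef {X : Type*} (x k : X) (r : F) : Finsupp.single x r k = r * coef F x k := by
  have h : Finsupp.single x r = r • Finsupp.single x (1 : F) := by simp
  rw [h]; rfl

lemma genBracket_jacobi [CharZero F] (hα : 2 * α ∈ M) (x y z : Gen M α) :
    extend (genBracket hα) (genBracket hα x y) (Finsupp.single z 1) =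
      extend (genBracket hα) (Finsupp.single x 1) (genBracket hα y z) -
        (-1 : F) ^ (x.parity.val * y.parity.val) •
          extend (genBracket hα) (Finsupp.single y 1) (genBracket hα x z) := by
  rcases x with a | a | _ <;> rcases y with b | b | _ <;> rcases z with d | d | _ <;>
    simp only [genBracket, Gen.parity, ZMod.val_one, ZMod.val_zero, mul_zero, zero_mul, mul_one,
      pow_zero, pow_one, one_smul, neg_smul, smul_zero, neg_neg, neg_zero, map_add, map_sub,
      map_neg, map_zero, LinearMap.add_apply, LinearMap.sub_apply, LinearMap.neg_apply,
      LinearMap.zero_apply, extend_single, one_mul, add_zero, zero_add, sub_zero, sub_self,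
      smul_add, smul_sub, smul_neg, Finsupp.smul_single, smul_eq_mul, addC_val, addCC_val,
      AddSubgroup.coe_add, zero_sub, sub_neg_eq_add]
  · rw [show a + (b + d) = a + b + d from Subtype.ext (by push_cast [addC_val, addCC_val]; ring),
      show b + (a + d) = a + b + d from Subtype.ext (by push_cast [addC_val, addCC_val]; ring)]
    ext k
    simp only [Finsupp.add_apply, Finsupp.sub_apply, Finsupp.neg_apply, single_coef]
    grind
  · rw [show addC a (addC b d) = addC (a + b) d from Subtype.ext (by push_cast [addC_val, addCC_val]; ring),
      show addC b (addC a d) = addC (a + b) d from Subtype.ext (by push_cast [addC_val, addCC_val]; ring)]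
    ext k
    simp only [Finsupp.add_apply, Finsupp.sub_apply, Finsupp.neg_apply, single_coef]
    grind
  · rw [show addC d (addC a b) = addC (a + d) b from Subtype.ext (by push_cast [addC_val, addCC_val]; ring),
      show addC a (addC d b) = addC (a + d) b from Subtype.ext (by push_cast [addC_val, addCC_val]; ring)]
    ext k
    simp only [Finsupp.add_apply, Finsupp.sub_apply, Finsupp.neg_apply, single_coef]
    grind
  · rw [show addCC hα (addC a b) d = a + addCC hα b d from Subtype.ext (by push_cast [addC_val, addCC_val]; ring),
      show addCC hα b (addC a d) = a + addCC hα b d from Subtype.ext (by push_cast [addC_val, addCC_val]; ring)]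
    ext k
    simp only [Finsupp.add_apply, Finsupp.sub_apply, Finsupp.neg_apply, single_coef]
    grind
  · rw [show addC d (addC b a) = addC (b + d) a from Subtype.ext (by push_cast [addC_val, addCC_val]; ring),
      show addC b (addC d a) = addC (b + d) a from Subtype.ext (by push_cast [addC_val, addCC_val]; ring)]
    ext k
    simp only [Finsupp.add_apply, Finsupp.sub_apply, Finsupp.neg_apply, single_coef]
    grind
  · rw [show addCC hα (addC b a) d = b + addCC hα a d from Subtype.ext (by push_cast [addC_val, addCC_val]; ring),
      show addCC hα a (addC b d) = b + addCC hα a d from Subtype.ext (by push_cast [addC_val, addCC_val]; ring)]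
    ext k
    simp only [Finsupp.add_apply, Finsupp.sub_apply, Finsupp.neg_apply, single_coef]
    grind
  · rw [show addCC hα a b + d = addCC hα a (addC d b) from Subtype.ext (by push_cast [addC_val, addCC_val]; ring),
      show addCC hα b (addC d a) = addCC hα a (addC d b) from Subtype.ext (by push_cast [addC_val, addCC_val]; ring)]
    ext k
    simp only [Finsupp.add_apply, Finsupp.sub_apply, Finsupp.neg_apply, single_coef]
    grind
  · rw [show addC (addCC hα b d) a = addC (addCC hα a b) d from Subtype.ext (by push_cast [addC_val, addCC_val]; ring),
      show addC (addCC hα a d) b = addC (addCC hα a b) d from Subtype.ext (by push_cast [addC_val, addCC_val]; ring)]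
    ext k
    simp only [Finsupp.add_apply, Finsupp.sub_apply, Finsupp.neg_apply, single_coef]
    grind

/-- The generalized super-Virasoro algebra `SVir[M, α]`, for `2 α ∈ M`. -/
noncomputable def algebra [CharZero F] (hα : 2 * α ∈ M) : LieSuperalgebra F (Space M α) where
  comp := parityPart Gen.parity
  isCompl := parityPart_isCompl _
  bracket := extend (genBracket hα)
  bracket_mem _ _ _ _ hx hy := extend_mem (genBracket_mem hα) hx hy
  skew i j x y hx hy := by
    refine parityPart_induction (P := fun x => extend (genBracket hα) x y =
      -((-1 : F) ^ (i.val * j.val) • extend (genBracket hα) y x))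
      (by simp) (fun _ _ h1 h2 => ?_) (fun r _ h1 => ?_) (fun g hg => ?_) hx
    · simp only [map_add, LinearMap.add_apply, h1, h2, smul_add]; abel
    · simp only [map_smul, LinearMap.smul_apply, h1, smul_neg, smul_comm r]
    refine parityPart_induction (P := fun y => extend (genBracket hα) (Finsupp.single g 1) y =
      -((-1 : F) ^ (i.val * j.val) • extend (genBracket hα) y (Finsupp.single g 1)))
      (by simp) (fun _ _ h1 h2 => ?_) (fun r _ h1 => ?_) (fun h hh => ?_) hy
    · simp only [map_add, LinearMap.add_apply, h1, h2, smul_add]; abel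
    · simp only [map_smul, LinearMap.smul_apply, h1, smul_neg, smul_comm r]
    subst hg hh
    simpa using genBracket_skew hα g h
  jacobi i j x y z hx hy := by
    rw [extend_bracket (genBracket_jacobi hα) z hx hy, sub_add_cancel]

/-- The basis element `L_0`. -/
noncomputable def L0 : Space M α := Finsupp.single (.L 0) 1

/-- The module over `SVir[M, α]` with basis `X`, on which the basis elements act by `f`. -/
noncomputable def ofBasis [CharZero F] (hα : 2 * α ∈ M) {X : Type*} (p : X → ZMod 2)
    (f : Gen M α → X → (X →₀ F))
    (hp : ∀ g x, f g x ∈ parityPart p (g.parity + p x))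
    (hf : ∀ g h x, extend f (genBracket hα g h) (Finsupp.single x 1) =
      extend f (Finsupp.single g 1) (f h x) - (-1 : F) ^ (g.parity.val * h.parity.val) •
        extend f (Finsupp.single h 1) (f g x)) :
    SuperModule (algebra hα) (X →₀ F) where
  comp := parityPart p
  isCompl := parityPart_isCompl _
  act := extend f
  act_mem _ _ _ _ hx hy := extend_mem hp hx hy
  act_bracket _ _ _ _ v hx hy := extend_bracket hf v hx hy

/-- The parity of the basis of the modules below: the `v`'s are even and the `w`'s are odd. -/
def basisParity {X Y : Type*} : X ⊕ Y → ZMod 2 := Sum.elim (fun _ => 0) (fun _ => 1)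

open Finsupp in
/-- The action on the basis `v_μ` (`μ ∈ M`), `w_ν` (`ν ∈ α + M`) of `SA_{a,b}(M, α)`. -/
noncomputable def actSAab (hα : 2 * α ∈ M) (a b : F) :
    Gen M α → M ⊕ Coset M α → (M ⊕ Coset M α →₀ F)
  | .L l, .inl μ => single (.inl (l + μ)) (a + μ + l * b)
  | .L l, .inr ν => single (.inr (addC l ν)) (a + ν + l * (b - 1 / 2))
  | .G η, .inl μ => single (.inr (addC μ η)) 1
  | .G η, .inr ν => single (.inl (addCC hα η ν)) (a + ν + 2 * η * (b - 1 / 2))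
  | .c, _ => 0

open Finsupp in
open scoped Classical in
/-- The action on the basis `v_μ` (`μ ∈ M`), `w_ν` (`ν ∈ α + M`) of `SA_a(M, α)`. -/
noncomputable def actSAa (hα : 2 * α ∈ M) (a : F) :
    Gen M α → M ⊕ Coset M α → (M ⊕ Coset M α →₀ F)
  | .L l, .inl μ => single (.inl (l + μ)) (if (μ : F) = 0 then (l : F) * (l + a) else μ + l)
  | .L l, .inr ν => single (.inr (addC l ν)) (ν + l / 2)
  | .G η, .inl μ => single (.inr (addC μ η)) (if (μ : F) = 0 then 2 * (η : F) + a else 1)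
  | .G η, .inr ν => single (.inl (addCC hα η ν)) (ν + η)
  | .c, _ => 0

open Finsupp in
open scoped Classical in
/-- The action on the basis `v_ν` (`ν ∈ α + M`), `w_μ` (`μ ∈ M`) of `SB_a(M, α)`. -/
noncomputable def actSBa (hα : 2 * α ∈ M) (a : F) :
    Gen M α → Coset M α ⊕ M → (Coset M α ⊕ M →₀ F)
  | .L l, .inl ν => single (.inl (addC l ν)) (ν + l / 2)
  | .L l, .inr μ => single (.inr (l + μ)) (if (l : F) + μ = 0 then -(l : F) * (l + a) else μ)
  | .G η, .inl ν => single (.inr (addCC hα η ν))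
      (if (η : F) + ν = 0 then 2 * (η : F) + a else 1)
  | .G η, .inr μ => single (.inl (addC μ η)) μ
  | .c, _ => 0

lemma actSAab_mem (hα : 2 * α ∈ M) (a b : F) (g : Gen M α) (x : M ⊕ Coset M α) :
    actSAab hα a b g x ∈ parityPart basisParity (g.parity + basisParity x) := by
  have h2 : (1 + 1 : ZMod 2) = 0 := by decide
  rcases g with l | l | _ <;> rcases x with x | x <;>
    simp only [actSAab, Gen.parity, basisParity, Sum.elim_inl, Sum.elim_inr, h2, add_zero, zero_add]
  all_goals first
    | exact Submodule.zero_mem _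
    | exact Finsupp.single_mem_supported F _ rfl

lemma actSAa_mem (hα : 2 * α ∈ M) (a : F) (g : Gen M α) (x : M ⊕ Coset M α) :
    actSAa hα a g x ∈ parityPart basisParity (g.parity + basisParity x) := by
  have h2 : (1 + 1 : ZMod 2) = 0 := by decide
  rcases g with l | l | _ <;> rcases x with x | x <;>
    simp only [actSAa, Gen.parity, basisParity, Sum.elim_inl, Sum.elim_inr, h2, add_zero, zero_add]
  all_goals first
    | exact Submodule.zero_mem _
    | exact Finsupp.single_mem_supported F _ rfl

lemma actSBa_mem (hα : 2 * α ∈ M) (a : F) (g : Gen M α) (x : Coset M α ⊕ M) :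
    actSBa hα a g x ∈ parityPart basisParity (g.parity + basisParity x) := by
  have h2 : (1 + 1 : ZMod 2) = 0 := by decide
  rcases g with l | l | _ <;> rcases x with x | x <;>
    simp only [actSBa, Gen.parity, basisParity, Sum.elim_inl, Sum.elim_inr, h2, add_zero, zero_add]
  all_goals first
    | exact Submodule.zero_mem _
    | exact Finsupp.single_mem_supported F _ rfl

lemma actSAab_rel [CharZero F] (hα : 2 * α ∈ M) (a b : F) (g h : Gen M α)
    (x : M ⊕ Coset M α) :
    extend (actSAab hα a b) (genBracket hα g h) (Finsupp.single x 1) =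
      extend (actSAab hα a b) (Finsupp.single g 1) (actSAab hα a b h x) -
        (-1 : F) ^ (g.parity.val * h.parity.val) •
          extend (actSAab hα a b) (Finsupp.single h 1) (actSAab hα a b g x) := by
  rcases g with l | l | _ <;> rcases h with m | m | _ <;> rcases x with x | x <;>
    simp only [actSAab, genBracket, Gen.parity, ZMod.val_one, ZMod.val_zero, mul_zero, mul_one,
      pow_zero, pow_one, one_smul, neg_smul, smul_zero, neg_neg, neg_zero, map_add, map_sub,
      map_neg, map_zero, LinearMap.add_apply, LinearMap.sub_apply, LinearMap.neg_apply,
      LinearMap.zero_apply, extend_single, one_mul, add_zero, zero_add, sub_zero, sub_self,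
      Finsupp.smul_single, smul_eq_mul, addC_val, addCC_val, AddSubgroup.coe_add, sub_neg_eq_add]
  · rw [show l + (m + x) = l + m + x from Subtype.ext (by push_cast [addC_val, addCC_val]; ring),
      show m + (l + x) = l + m + x from Subtype.ext (by push_cast [addC_val, addCC_val]; ring)]
    ext k
    simp only [Finsupp.add_apply, Finsupp.sub_apply, Finsupp.neg_apply, single_coef]
    grind
  · rw [show addC l (addC m x) = addC (l + m) x from Subtype.ext (by push_cast [addC_val, addCC_val]; ring),
      show addC m (addC l x) = addC (l + m) x from Subtype.ext (by push_cast [addC_val, addCC_val]; ring)]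
    ext k
    simp only [Finsupp.add_apply, Finsupp.sub_apply, Finsupp.neg_apply, single_coef]
    grind
  · rw [show addC x (addC l m) = addC (l + x) m from Subtype.ext (by push_cast [addC_val, addCC_val]; ring),
      show addC l (addC x m) = addC (l + x) m from Subtype.ext (by push_cast [addC_val, addCC_val]; ring)]
    ext k
    simp only [Finsupp.add_apply, Finsupp.sub_apply, Finsupp.neg_apply, single_coef]
    grind
  · rw [show addCC hα (addC l m) x = l + addCC hα m x from Subtype.ext (by push_cast [addC_val, addCC_val]; ring),
      show addCC hα m (addC l x) = l + addCC hα m x from Subtype.ext (by push_cast [addC_val, addCC_val]; ring)]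
    ext k
    simp only [Finsupp.add_apply, Finsupp.sub_apply, Finsupp.neg_apply, single_coef]
    grind
  · rw [show addC x (addC m l) = addC (m + x) l from Subtype.ext (by push_cast [addC_val, addCC_val]; ring),
      show addC m (addC x l) = addC (m + x) l from Subtype.ext (by push_cast [addC_val, addCC_val]; ring)]
    ext k
    simp only [Finsupp.add_apply, Finsupp.sub_apply, Finsupp.neg_apply, single_coef]
    grind
  · rw [show addCC hα (addC m l) x = m + addCC hα l x from Subtype.ext (by push_cast [addC_val, addCC_val]; ring),
      show addCC hα l (addC m x) = m + addCC hα l x from Subtype.ext (by push_cast [addC_val, addCC_val]; ring)]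
    ext k
    simp only [Finsupp.add_apply, Finsupp.sub_apply, Finsupp.neg_apply, single_coef]
    grind
  · rw [show addCC hα l (addC x m) = addCC hα l m + x from Subtype.ext (by push_cast [addC_val, addCC_val]; ring),
      show addCC hα m (addC x l) = addCC hα l m + x from Subtype.ext (by push_cast [addC_val, addCC_val]; ring)]
    ext k
    simp only [Finsupp.add_apply, Finsupp.sub_apply, Finsupp.neg_apply, single_coef]
    grind
  · rw [show addC (addCC hα m x) l = addC (addCC hα l m) x from Subtype.ext (by push_cast [addC_val, addCC_val]; ring),
      show addC (addCC hα l x) m = addC (addCC hα l m) x from Subtype.ext (by push_cast [addC_val, addCC_val]; ring)]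
    ext k
    simp only [Finsupp.add_apply, Finsupp.sub_apply, Finsupp.neg_apply, single_coef]
    grind

lemma actSAa_rel [CharZero F] (hα : 2 * α ∈ M) (a : F) (g h : Gen M α)
    (x : M ⊕ Coset M α) :
    extend (actSAa hα a) (genBracket hα g h) (Finsupp.single x 1) =
      extend (actSAa hα a) (Finsupp.single g 1) (actSAa hα a h x) -
        (-1 : F) ^ (g.parity.val * h.parity.val) •
          extend (actSAa hα a) (Finsupp.single h 1) (actSAa hα a g x) := by
  rcases g with l | l | _ <;> rcases h with m | m | _ <;> rcases x with x | x <;>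
    simp only [actSAa, genBracket, Gen.parity, ZMod.val_one, ZMod.val_zero, mul_zero, mul_one,
      pow_zero, pow_one, one_smul, neg_smul, smul_zero, neg_neg, neg_zero, map_add, map_sub,
      map_neg, map_zero, LinearMap.add_apply, LinearMap.sub_apply, LinearMap.neg_apply,
      LinearMap.zero_apply, extend_single, one_mul, add_zero, zero_add, sub_zero, sub_self,
      Finsupp.smul_single, smul_eq_mul, addC_val, addCC_val, AddSubgroup.coe_add, sub_neg_eq_add]
  · rw [show l + (m + x) = l + m + x from Subtype.ext (by push_cast [addC_val, addCC_val]; ring),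
      show m + (l + x) = l + m + x from Subtype.ext (by push_cast [addC_val, addCC_val]; ring)]
    ext k
    simp only [Finsupp.add_apply, Finsupp.sub_apply, Finsupp.neg_apply, single_coef]
    generalize coef F _ k = e
    by_cases h : (x : F) = 0
    · by_cases h1 : (m : F) = 0 <;> by_cases h2 : (l : F) = 0 <;>
        simp only [h, h1, h2, add_zero, if_true, if_false] <;> ring
    · by_cases h1 : (m : F) + x = 0 <;> by_cases h2 : (l : F) + x = 0 <;>
        simp only [h, h1, h2, if_true, if_false] <;> grind
  · rw [show addC l (addC m x) = addC (l + m) x from Subtype.ext (by push_cast [addC_val, addCC_val]; ring),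
      show addC m (addC l x) = addC (l + m) x from Subtype.ext (by push_cast [addC_val, addCC_val]; ring)]
    ext k
    simp only [Finsupp.add_apply, Finsupp.sub_apply, Finsupp.neg_apply, single_coef]
    grind
  · rw [show addC x (addC l m) = addC (l + x) m from Subtype.ext (by push_cast [addC_val, addCC_val]; ring),
      show addC l (addC x m) = addC (l + x) m from Subtype.ext (by push_cast [addC_val, addCC_val]; ring)]
    ext k
    simp only [Finsupp.add_apply, Finsupp.sub_apply, Finsupp.neg_apply, single_coef]
    grind
  · rw [show addCC hα (addC l m) x = l + addCC hα m x from Subtype.ext (by push_cast [addC_val, addCC_val]; ring),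
      show addCC hα m (addC l x) = l + addCC hα m x from Subtype.ext (by push_cast [addC_val, addCC_val]; ring)]
    ext k
    simp only [Finsupp.add_apply, Finsupp.sub_apply, Finsupp.neg_apply, single_coef]
    grind
  · rw [show addC x (addC m l) = addC (m + x) l from Subtype.ext (by push_cast [addC_val, addCC_val]; ring),
      show addC m (addC x l) = addC (m + x) l from Subtype.ext (by push_cast [addC_val, addCC_val]; ring)]
    ext k
    simp only [Finsupp.add_apply, Finsupp.sub_apply, Finsupp.neg_apply, single_coef]
    grind
  · rw [show addCC hα (addC m l) x = m + addCC hα l x from Subtype.ext (by push_cast [addC_val, addCC_val]; ring),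
      show addCC hα l (addC m x) = m + addCC hα l x from Subtype.ext (by push_cast [addC_val, addCC_val]; ring)]
    ext k
    simp only [Finsupp.add_apply, Finsupp.sub_apply, Finsupp.neg_apply, single_coef]
    grind
  · rw [show addCC hα l (addC x m) = addCC hα l m + x from Subtype.ext (by push_cast [addC_val, addCC_val]; ring),
      show addCC hα m (addC x l) = addCC hα l m + x from Subtype.ext (by push_cast [addC_val, addCC_val]; ring)]
    ext k
    simp only [Finsupp.add_apply, Finsupp.sub_apply, Finsupp.neg_apply, single_coef]
    grind
  · rw [show addC (addCC hα m x) l = addC (addCC hα l m) x from Subtype.ext (by push_cast [addC_val, addCC_val]; ring),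
      show addC (addCC hα l x) m = addC (addCC hα l m) x from Subtype.ext (by push_cast [addC_val, addCC_val]; ring)]
    ext k
    simp only [Finsupp.add_apply, Finsupp.sub_apply, Finsupp.neg_apply, single_coef]
    grind

lemma actSBa_rel [CharZero F] (hα : 2 * α ∈ M) (a : F) (g h : Gen M α)
    (x : Coset M α ⊕ M) :
    extend (actSBa hα a) (genBracket hα g h) (Finsupp.single x 1) =
      extend (actSBa hα a) (Finsupp.single g 1) (actSBa hα a h x) -
        (-1 : F) ^ (g.parity.val * h.parity.val) •
          extend (actSBa hα a) (Finsupp.single h 1) (actSBa hα a g x) := by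
  rcases g with l | l | _ <;> rcases h with m | m | _ <;> rcases x with x | x <;>
    simp only [actSBa, genBracket, Gen.parity, ZMod.val_one, ZMod.val_zero, mul_zero, mul_one,
      pow_zero, pow_one, one_smul, neg_smul, smul_zero, neg_neg, neg_zero, map_add, map_sub,
      map_neg, map_zero, LinearMap.add_apply, LinearMap.sub_apply, LinearMap.neg_apply,
      LinearMap.zero_apply, extend_single, one_mul, add_zero, zero_add, sub_zero, sub_self,
      Finsupp.smul_single, smul_eq_mul, addC_val, addCC_val, AddSubgroup.coe_add, sub_neg_eq_add]
  · rw [show addC l (addC m x) = addC (l + m) x from Subtype.ext (by push_cast [addC_val, addCC_val]; ring),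
      show addC m (addC l x) = addC (l + m) x from Subtype.ext (by push_cast [addC_val, addCC_val]; ring)]
    ext k
    simp only [Finsupp.add_apply, Finsupp.sub_apply, Finsupp.neg_apply, single_coef]
    grind
  · rw [show l + (m + x) = l + m + x from Subtype.ext (by push_cast [addC_val, addCC_val]; ring),
      show m + (l + x) = l + m + x from Subtype.ext (by push_cast [addC_val, addCC_val]; ring)]
    ext k
    simp only [Finsupp.add_apply, Finsupp.sub_apply, Finsupp.neg_apply, single_coef]
    grind
  · rw [show addCC hα (addC l m) x = l + addCC hα m x from Subtype.ext (by push_cast [addC_val, addCC_val]; ring),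
      show addCC hα m (addC l x) = l + addCC hα m x from Subtype.ext (by push_cast [addC_val, addCC_val]; ring)]
    ext k
    simp only [Finsupp.add_apply, Finsupp.sub_apply, Finsupp.neg_apply, single_coef]
    grind
  · rw [show addC x (addC l m) = addC (l + x) m from Subtype.ext (by push_cast [addC_val, addCC_val]; ring),
      show addC l (addC x m) = addC (l + x) m from Subtype.ext (by push_cast [addC_val, addCC_val]; ring)]
    ext k
    simp only [Finsupp.add_apply, Finsupp.sub_apply, Finsupp.neg_apply, single_coef]
    grind
  · rw [show addCC hα (addC m l) x = m + addCC hα l x from Subtype.ext (by push_cast [addC_val, addCC_val]; ring),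
      show addCC hα l (addC m x) = m + addCC hα l x from Subtype.ext (by push_cast [addC_val, addCC_val]; ring)]
    ext k
    simp only [Finsupp.add_apply, Finsupp.sub_apply, Finsupp.neg_apply, single_coef]
    grind
  · rw [show addC x (addC m l) = addC (m + x) l from Subtype.ext (by push_cast [addC_val, addCC_val]; ring),
      show addC m (addC x l) = addC (m + x) l from Subtype.ext (by push_cast [addC_val, addCC_val]; ring)]
    ext k
    simp only [Finsupp.add_apply, Finsupp.sub_apply, Finsupp.neg_apply, single_coef]
    grind
  · rw [show addC (addCC hα m x) l = addC (addCC hα l m) x from Subtype.ext (by push_cast [addC_val, addCC_val]; ring),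
      show addC (addCC hα l x) m = addC (addCC hα l m) x from Subtype.ext (by push_cast [addC_val, addCC_val]; ring)]
    ext k
    simp only [Finsupp.add_apply, Finsupp.sub_apply, Finsupp.neg_apply, single_coef]
    grind
  · rw [show addCC hα l (addC x m) = addCC hα l m + x from Subtype.ext (by push_cast [addC_val, addCC_val]; ring),
      show addCC hα m (addC x l) = addCC hα l m + x from Subtype.ext (by push_cast [addC_val, addCC_val]; ring)]
    ext k
    simp only [Finsupp.add_apply, Finsupp.sub_apply, Finsupp.neg_apply, single_coef]
    grind

/-- The module `SA_{a,b}(M, α)`. -/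
noncomputable def SAab [CharZero F] (hα : 2 * α ∈ M) (a b : F) :
    SuperModule (algebra hα) (M ⊕ Coset M α →₀ F) :=
  ofBasis hα basisParity (actSAab hα a b) (actSAab_mem hα a b) (actSAab_rel hα a b)

/-- The module `SA_a(M, α)`. -/
noncomputable def SAa [CharZero F] (hα : 2 * α ∈ M) (a : F) :
    SuperModule (algebra hα) (M ⊕ Coset M α →₀ F) :=
  ofBasis hα basisParity (actSAa hα a) (actSAa_mem hα a) (actSAa_rel hα a)

/-- The module `SB_a(M, α)`. -/
noncomputable def SBa [CharZero F] (hα : 2 * α ∈ M) (a : F) :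
    SuperModule (algebra hα) (Coset M α ⊕ M →₀ F) :=
  ofBasis hα basisParity (actSBa hα a) (actSBa_mem hα a) (actSBa_rel hα a)

/-- A module of the intermediate series over `SVir[M, α]`: an indecomposable `ℤ/2`-graded module
`V = V₀ ⊕ V₁` which is the direct sum of its weight spaces `V_λ = {v | L_0 v = λ v}` (eigenspaces
for distinct `λ` being independent, it is enough that they span `V`), and which satisfies
`dim (V_σ)_λ ≤ 1` for all `σ ∈ ℤ/2` and `λ ∈ F`. -/
structure IsIntermediateSeries [CharZero F] {hα : 2 * α ∈ M} {V : Type*} [AddCommGroup V]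
    [Module F V] (A : SuperModule (algebra hα) V) : Prop where
  indecomposable : A.Indecomposable
  iSup_weight_eq_top : ⨆ r : F, Module.End.eigenspace (A.act L0) r = ⊤
  rank_weight_le_one : ∀ (σ : ZMod 2) (r : F),
    Module.rank F ↥(A.comp σ ⊓ Module.End.eigenspace (A.act L0) r) ≤ 1

end
end SVir

/-! Indecomposability enters through one principle, `partition`: a set of graded weights across
whose boundary all odd generators vanish contains every weight or none. It makes the central element
a scalar and puts all weights into one coset. After choosing a spanning vector in each graded weight
space (`Frame`), the module becomes a table of structure constants of the odd generators. The even
generators need no separate bookkeeping, because `2 L_{p+q}` is the anticommutator of `G_p` and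
`G_q` up to the centre.

Along a string of weights `x + nη` the relations constrain the products of structure constants
around closed paths made of steps `±η` and `±3η` (`Strand`). If two weights joined by a nonzero odd
degree both occur, the central charge vanishes (`central_charge_eq_zero`). With central charge zero,
one nonzero weight forces all nonzero weights of the coset to occur (`supp_of_ne_zero`), and the
operator relation `[G_{-3η}, G_{3η}]₋ = 3 [G_{-η}, G_η]₋` holds for ordinary commutators
(`omega_of_supp`).

That single relation is not a consequence of the algebra, and it is what makes the problem rigid.
Bracketing it repeatedly with `G` and `L` kills the higher differences of the antisymmetric products
and gives `G_p G_q = L_{p+q} + ¼ Γ(p+q, q-p)` with `Γ` additive in its second argument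
(`mul_eq_Gam`). Since `M` is an arbitrary subgroup of a field, additive does not yet mean linear.
Linearity on weight vectors comes from computing a product around four edges in two ways
(`transition_dichotomy`, `delta_linear`). Hence going from weight `x` to weight `y` by an odd
generator and back multiplies by `x + ε(y - x)`, where `ε` depends only on the parity and the two
slopes sum to one (`exists_parity_slope`). Between two distinct weights of equal parity, the product
of two odd steps is affine in the intermediate weight (`exists_affine`).

If neither slope vanishes, unique factorisation of products of affine functions shows that for any
two weights either the outgoing or the incoming constants are proportional. Two equivalence
relations covering all pairs cannot both be proper, so one kind of proportionality is global, and
rescaling gives `SA_{a,b}`. If some slope is zero, rescaling normalises all nonzero weights of that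
parity. The only freedom left is at weight zero, where the steps out or the steps in vanish and the
others are affine; this produces `SA_a`, `SB_a` and the remaining `SA_{a,b}`. If no two distinct
weights are joined, the module is trivial of dimension one. In every case a surjection from the
standard module is built, so missing weights cause no trouble. -/

namespace SVir

set_option linter.unusedSectionVars false

/-! ### Degrees: the group `M` and its coset `α + M`. -/

section Lattice

variable {F : Type*} [Field F] {M : AddSubgroup F} {α : F}

/-- Membership in `M` (for `false`) or in the coset `α + M` (for `true`). -/
def Lat (M : AddSubgroup F) (α : F) : Bool → F → Prop
  | false, x => x ∈ M
  | true, x => x - α ∈ M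

namespace Lat

variable [hα : Fact (2 * α ∈ M)] {i j : Bool} {x y : F}

lemma neg (hx : Lat M α i x) : Lat M α i (-x) := by
  cases i
  · exact M.neg_mem hx
  · have := M.neg_mem (M.add_mem hx hα.out)
    change -x - α ∈ M
    convert this using 1
    ring

/-- Parities of degrees add as booleans under `xor`; the odd-odd case is where `2α ∈ M` is needed.
-/
lemma add (hx : Lat M α i x) (hy : Lat M α j y) : Lat M α (i ^^ j) (x + y) := by
  cases i <;> cases j
  · exact M.add_mem hx hy
  · change x + y - α ∈ M
    rw [add_sub_assoc]
    exact M.add_mem hx hy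
  · change x + y - α ∈ M
    rw [add_sub_right_comm]
    exact M.add_mem hx hy
  · have := M.add_mem (M.add_mem hx hy) hα.out
    change x + y ∈ M
    convert this using 1
    ring

lemma sub (hx : Lat M α i x) (hy : Lat M α j y) : Lat M α (i ^^ j) (x - y) := by
  rw [sub_eq_add_neg]
  exact hx.add hy.neg

lemma two_mul (hx : Lat M α i x) : Lat M α false (2 * x) := by
  have := hx.add hx
  rw [Bool.xor_self] at this
  rwa [_root_.two_mul]

lemma three_mul (hx : Lat M α i x) : Lat M α i (3 * x) := by
  have h := hx.two_mul.add hx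
  rw [Bool.false_xor] at h
  convert h using 1
  ring

lemma base : Lat M α true α := by
  change α - α ∈ M
  rw [sub_self]
  exact M.zero_mem

end Lat
end Lattice

/-! ### Brackets of generators with symmetrised quadratic products. -/

section Linear

variable {F R : Type*} [Field F] [CharZero F] [Ring R] [Algebra F R]

/-- Elements `G k` (`k ∈ α + M`) and `L l` (`l ∈ M`) of an associative algebra which satisfy the
relations of the centreless super-Virasoro algebra. -/
structure Rep (M : AddSubgroup F) (α : F) (G L : F → R) : Prop where
  gg : ∀ {p q : F}, Lat M α true p → Lat M α true q → G p * G q + G q * G p = (2 : F) • L (p + q)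
  lg : ∀ {l k : F}, Lat M α false l → Lat M α true k →
    L l * G k - G k * L l = (k - l / 2) • G (k + l)
  ll : ∀ {l m : F}, Lat M α false l → Lat M α false m →
    L l * L m - L m * L l = (m - l) • L (l + m)

/-- The antisymmetric product of two odd elements. -/
def comK (G : F → R) (p q : F) : R := G p * G q - G q * G p

/-- The symmetric product of an even and an odd element. -/
def symH (G L : F → R) (l k : F) : R := L l * G k + G k * L l

/-- The symmetric product of two even elements. -/
def symM (L : F → R) (l m : F) : R := L l * L m + L m * L l

namespace Rep

variable {M : AddSubgroup F} {α : F} [hα : Fact (2 * α ∈ M)] {G L : F → R}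


lemma comK_swap (p q : F) : comK G p q = -comK G q p := by
  simp [comK]

lemma symM_swap (p q : F) : symM L p q = symM L q p := by
  simp [symM, add_comm]

/-- This and the next four identities are the Leibniz rule applied to a quadratic product. Target
degrees are separate variables tied by equations, so that each use can fix its own normal form of
the index. -/
lemma lie_L_comK (h : Rep M α G L) {l p q p' q' : F} (hl : Lat M α false l)
    (hp : Lat M α true p) (hq : Lat M α true q) (h1 : p + l = p') (h2 : q + l = q') :
    L l * comK G p q - comK G p q * L l =
      (p - l / 2) • comK G p' q + (q - l / 2) • comK G p q' := by
  subst h1 h2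
  have a1 := congrArg (· * G q) (h.lg hl hp)
  have a2 := congrArg (G p * ·) (h.lg hl hq)
  have a3 := congrArg (· * G p) (h.lg hl hq)
  have a4 := congrArg (G q * ·) (h.lg hl hp)
  simp only [comK, sub_mul, mul_sub, smul_mul_assoc, mul_smul_comm, mul_assoc] at *
  linear_combination (norm := module) a1 + a2 - a3 - a4

lemma lie_G_comK (h : Rep M α G L) {z p q a b : F} (hz : Lat M α true z)
    (hp : Lat M α true p) (hq : Lat M α true q) (h1 : z + p = a) (h2 : z + q = b) :
    G z * comK G p q - comK G p q * G z = (2 : F) • symH G L a q - (2 : F) • symH G L b p := by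
  subst h1 h2
  have a1 := congrArg (· * G q) (h.gg hz hp)
  have a2 := congrArg (G q * ·) (h.gg hz hp)
  have a3 := congrArg (· * G p) (h.gg hz hq)
  have a4 := congrArg (G p * ·) (h.gg hz hq)
  simp only [comK, symH, add_mul, mul_add, sub_mul, mul_sub, smul_mul_assoc, mul_smul_comm,
    mul_assoc] at *
  linear_combination (norm := module) a1 + a2 - a3 - a4

lemma anti_G_symH (h : Rep M α G L) {z l k a b : F} (hz : Lat M α true z)
    (hl : Lat M α false l) (hk : Lat M α true k) (h1 : z + k = a) (h2 : z + l = b) :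
    G z * symH G L l k + symH G L l k * G z =
      (2 : F) • symM L l a - (z - l / 2) • comK G b k := by
  subst h1 h2
  have a1 := congrArg (· * G k) (h.lg hl hz)
  have a2 := congrArg (G k * ·) (h.lg hl hz)
  have a3 := congrArg (L l * ·) (h.gg hz hk)
  have a4 := congrArg (· * L l) (h.gg hz hk)
  simp only [comK, symH, symM, add_mul, mul_add, sub_mul, mul_sub, smul_mul_assoc,
    mul_smul_comm, mul_assoc] at *
  linear_combination (norm := module) a3 + a4 - a1 + a2

lemma lie_G_symM (h : Rep M α G L) {z l m a b : F} (hz : Lat M α true z)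
    (hl : Lat M α false l) (hm : Lat M α false m) (h1 : z + l = a) (h2 : z + m = b) :
    G z * symM L l m - symM L l m * G z =
      -(z - l / 2) • symH G L m a - (z - m / 2) • symH G L l b := by
  subst h1 h2
  have a1 := congrArg (· * L m) (h.lg hl hz)
  have a2 := congrArg (L m * ·) (h.lg hl hz)
  have a3 := congrArg (L l * ·) (h.lg hm hz)
  have a4 := congrArg (· * L l) (h.lg hm hz)
  simp only [symH, symM, add_mul, mul_add, sub_mul, mul_sub, smul_mul_assoc,
    mul_smul_comm, mul_assoc] at *
  linear_combination (norm := module) -a1 - a2 - a3 - a4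

lemma lie_L_symM (h : Rep M α G L) {t l m a b : F} (ht : Lat M α false t)
    (hl : Lat M α false l) (hm : Lat M α false m) (h1 : l + t = a) (h2 : m + t = b) :
    L t * symM L l m - symM L l m * L t = (l - t) • symM L a m + (m - t) • symM L l b := by
  subst h1 h2
  have a1 := congrArg (· * L m) (h.ll ht hl)
  have a2 := congrArg (L m * ·) (h.ll ht hl)
  have a3 := congrArg (L l * ·) (h.ll ht hm)
  have a4 := congrArg (· * L l) (h.ll ht hm)
  rw [add_comm l t, add_comm m t]
  simp only [symM, add_mul, mul_add, sub_mul, mul_sub, smul_mul_assoc,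
    mul_smul_comm, mul_assoc] at *
  linear_combination (norm := module) a1 + a2 + a3 + a4

end Rep
end Linear

/-! ### Consequences of the relation between degrees `η` and `3η`: differences of quadratic
products. -/

section Differences

variable {F R : Type*} [Field F] [CharZero F] [Ring R] [Algebra F R]

/-- The third difference of `f` along the direction `(-η, η)`. -/
def D3 (f : F → F → R) (η a b : F) : R :=
  f (a - 3 * η) (b + 3 * η) - (3 : F) • f (a - η) (b + η) + (3 : F) • f (a + η) (b - η) -
    f (a + 3 * η) (b - 3 * η)

/-- The first moment of the third difference of `f` along the direction `(-η, η)`. -/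
def D2 (f : F → F → R) (η a b : F) : R :=
  (3 : F) • f (a - 3 * η) (b + 3 * η) - (3 : F) • f (a - η) (b + η) -
    (3 : F) • f (a + η) (b - η) + (3 : F) • f (a + 3 * η) (b - 3 * η)

/-- A formal identity for any `f`: once third differences are known, `D2` can be transported along
steps of `2η`. -/
lemma D2_step (f : F → F → R) (η a b : F) :
    D2 f η (a - 2 * η) (b + 2 * η) - D2 f η a b =
      (3 : F) • (D3 f η (a - 2 * η) (b + 2 * η) + D3 f η a b) := by
  simp only [D2, D3]
  rw [show a - 2 * η - η = a - 3 * η by ring, show b + 2 * η + η = b + 3 * η by ring,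
    show a - 2 * η + η = a - η by ring, show b + 2 * η - η = b + η by ring,
    show a - 2 * η + 3 * η = a + η by ring, show b + 2 * η - 3 * η = b - η by ring]
  module

namespace Rep

variable {M : AddSubgroup F} {α : F} [hα : Fact (2 * α ∈ M)] {G L : F → R}

/-- The bracket of `hΩ` with `G z` turns the antisymmetric products `(-k, k)`, `k = η, 3η`, into the
four terms of this third difference. -/
lemma D3_symH_eq_zero (h : Rep M α G L) {η z : F} (hη : Lat M α true η) (hz : Lat M α true z)
    (hΩ : comK G (-(3 * η)) (3 * η) = (3 : F) • comK G (-η) η) : D3 (symH G L) η z 0 = 0 := by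
  have hη3 := hη.three_mul
  have e := congrArg (fun x => G z * x - x * G z) hΩ
  have a1 := h.lie_G_comK hz hη3.neg hη3 (a := z - 3 * η) (b := z + 3 * η) (by ring) (by ring)
  have a2 := h.lie_G_comK hz hη.neg hη (a := z - η) (b := z + η) (by ring) (by ring)
  simp only [mul_smul_comm, smul_mul_assoc] at e
  rw [D3, zero_add, zero_add, zero_sub, zero_sub]
  have e2 : (2 : F) • (symH G L (z - 3 * η) (3 * η) - (3 : F) • symH G L (z - η) η +
      (3 : F) • symH G L (z + η) (-η) - symH G L (z + 3 * η) (-(3 * η))) = 0 := by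
    linear_combination (norm := module) e - a1 + (3 : F) • a2
  exact (smul_eq_zero.1 e2).resolve_left two_ne_zero

/-- Comes from the anticommutator of `G q` with `D3_symH_eq_zero` at `p`. -/
lemma D3_symM_aux (h : Rep M α G L) {η p q : F} (hη : Lat M α true η) (hp : Lat M α true p)
    (hq : Lat M α true q) (hΩ : comK G (-(3 * η)) (3 * η) = (3 : F) • comK G (-η) η) :
    (2 : F) • D3 (symM L) η p q = (q - p / 2) • D3 (comK G) η (p + q) 0 +
      (η / 2) • D2 (comK G) η (p + q) 0 := by
  have hη3 := hη.three_mul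
  have e := congrArg (fun x => G q * x + x * G q) (h.D3_symH_eq_zero hη hp hΩ)
  have a1 := h.anti_G_symH hq (hp.sub hη3) hη3 (a := q + 3 * η) (b := p + q - 3 * η)
    (by ring) (by ring)
  have a2 := h.anti_G_symH hq (hp.sub hη) hη (a := q + η) (b := p + q - η) (by ring) (by ring)
  have a3 := h.anti_G_symH hq (hp.add hη) hη.neg (a := q - η) (b := p + q + η)
    (by ring) (by ring)
  have a4 := h.anti_G_symH hq (hp.add hη3) hη3.neg (a := q - 3 * η) (b := p + q + 3 * η)
    (by ring) (by ring)
  simp only [D3, zero_add, zero_sub, mul_add, mul_sub, add_mul, sub_mul, mul_smul_comm,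
    smul_mul_assoc, mul_zero, zero_mul, add_zero] at e
  simp only [D3, D2, zero_add, zero_sub]
  linear_combination (norm := module) e - a1 + (3 : F) • a2 - (3 : F) • a3 + a4

lemma D3_symM_swap (η p q : F) : D3 (symM L) η q p = -D3 (symM L) η p q := by
  simp only [D3]
  rw [symM_swap (q - 3 * η), symM_swap (q - η), symM_swap (q + η), symM_swap (q + 3 * η)]
  module

/-- The `D2` term in `D3_symM_aux` is symmetric in `p` and `q`, whereas the left side is
antisymmetric; subtracting the two versions removes it. -/
lemma D3_symM (h : Rep M α G L) {η p q : F} (hη : Lat M α true η) (hp : Lat M α true p)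
    (hq : Lat M α true q) (hΩ : comK G (-(3 * η)) (3 * η) = (3 : F) • comK G (-η) η) :
    D3 (symM L) η p q = (3 / 8 * (q - p)) • D3 (comK G) η (p + q) 0 := by
  have a1 := h.D3_symM_aux hη hp hq hΩ
  have a2 := h.D3_symM_aux hη hq hp hΩ
  rw [D3_symM_swap, add_comm q p] at a2
  linear_combination (norm := module) (1 / 4 : F) • a1 - (1 / 4 : F) • a2

/-- In total degree zero `hΩ` says `D3 (comK G) η 0 0 = 0`, so `D3 (symM L) η p (-p)` vanishes. Its
bracket with `L t` gives the relation. -/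
lemma D2_symM_moment (h : Rep M α G L) {η p t : F} (hη : Lat M α true η)
    (hp : Lat M α true p) (ht : Lat M α false t)
    (hΩ : comK G (-(3 * η)) (3 * η) = (3 : F) • comK G (-η) η) :
    η • (D2 (symM L) η (p + t) (-p) - D2 (symM L) η p (t - p)) =
      (3 / 4 * p * t) • D3 (comK G) η t 0 := by
  have hη3 := hη.three_mul
  have b0 := h.D3_symM hη hp hp.neg hΩ
  have k0 : D3 (comK G) η (p + -p) 0 = 0 := by
    simp only [D3, add_neg_cancel, zero_add, zero_sub]
    rw [comK_swap (3 * η), comK_swap η, hΩ]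
    module
  rw [k0, smul_zero] at b0
  have b1 := h.D3_symM hη (hp.add ht) hp.neg hΩ
  have b2 := h.D3_symM hη hp (ht.sub hp) hΩ
  rw [show p + t + -p = t by ring] at b1
  rw [show p + (t - p) = t by ring] at b2
  have e := congrArg (fun x => L t * x - x * L t) b0
  have a1 := h.lie_L_symM ht (hp.sub hη3) (hp.neg.add hη3) (a := p + t - 3 * η)
    (b := t - p + 3 * η) (by ring) (by ring)
  have a2 := h.lie_L_symM ht (hp.sub hη) (hp.neg.add hη) (a := p + t - η)
    (b := t - p + η) (by ring) (by ring)
  have a3 := h.lie_L_symM ht (hp.add hη) (hp.neg.sub hη) (a := p + t + η)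
    (b := t - p - η) (by ring) (by ring)
  have a4 := h.lie_L_symM ht (hp.add hη3) (hp.neg.sub hη3) (a := p + t + 3 * η)
    (b := t - p - 3 * η) (by ring) (by ring)
  simp only [D3, mul_add, mul_sub, add_mul, sub_mul, mul_smul_comm,
    smul_mul_assoc, mul_zero, zero_mul, sub_zero] at e
  simp only [D3] at b1 b2
  simp only [D3, D2]
  linear_combination (norm := module) -e + a1 - (3 : F) • a2 + (3 : F) • a3 - a4 +
    (p - t) • b1 - (p + t) • b2

/-- The moment relation at `p = η` and at `p = -η` differs by values of `D2_step`, which `D3_symM`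
computes independently. The two computations disagree by `3ηt` times the third difference. -/
lemma D3_comK_zero (h : Rep M α G L) {η t : F} (hη : Lat M α true η) (hη0 : η ≠ 0)
    (ht : Lat M α false t) (hΩ : comK G (-(3 * η)) (3 * η) = (3 : F) • comK G (-η) η) :
    D3 (comK G) η t 0 = 0 := by
  rcases eq_or_ne t 0 with rfl | ht0
  · simp only [D3, zero_add, zero_sub]
    rw [comK_swap (3 * η), comK_swap η, hΩ]
    module
  have hη2 := hη.two_mul
  have c1 := h.D2_symM_moment hη hη ht hΩ
  have c2 := h.D2_symM_moment hη (hη.sub hη2) ht hΩ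
  have s1 := D2_step (symM L) η (η + t) (-η)
  have s2 := D2_step (symM L) η η (t - η)
  rw [h.D3_symM hη (hη.add ht) hη.neg hΩ,
    h.D3_symM hη ((hη.add ht).sub hη2) (hη.neg.add hη2) hΩ] at s1
  rw [h.D3_symM hη hη (ht.sub hη) hΩ, h.D3_symM hη (hη.sub hη2) ((ht.sub hη).add hη2) hΩ] at s2
  rw [show η + t - 2 * η + (-η + 2 * η) = t by ring, show η + t + -η = t by ring] at s1
  rw [show η - 2 * η + (t - η + 2 * η) = t by ring, show η + (t - η) = t by ring] at s2
  rw [show η - 2 * η + t = η + t - 2 * η by ring, show -(η - 2 * η) = -η + 2 * η by ring,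
    show t - (η - 2 * η) = t - η + 2 * η by ring] at c2
  have : (3 * η * t) • D3 (comK G) η t 0 = 0 := by
    linear_combination (norm := module) c1 - c2 + η • s1 - η • s2
  refine (smul_eq_zero.1 this).resolve_left ?_
  exact mul_ne_zero (mul_ne_zero three_ne_zero hη0) ht0


lemma D3_symM_eq_zero (h : Rep M α G L) {η p q : F} (hη : Lat M α true η) (hη0 : η ≠ 0)
    (hp : Lat M α true p) (hq : Lat M α true q)
    (hΩ : comK G (-(3 * η)) (3 * η) = (3 : F) • comK G (-η) η) : D3 (symM L) η p q = 0 := by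
  rw [h.D3_symM hη hp hq hΩ, h.D3_comK_zero hη hη0 (hp.add hq) hΩ, smul_zero]

lemma D2_symM_shift (h : Rep M α G L) {η p q p' q' : F} (hη : Lat M α true η) (hη0 : η ≠ 0)
    (hp : Lat M α true p) (hq : Lat M α true q) (h1 : p - 2 * η = p') (h2 : q + 2 * η = q')
    (hΩ : comK G (-(3 * η)) (3 * η) = (3 : F) • comK G (-η) η) :
    D2 (symM L) η p' q' = D2 (symM L) η p q := by
  subst h1 h2
  have := D2_step (symM L) η p q
  rw [h.D3_symM_eq_zero hη hη0 hp hq hΩ, h.D3_symM_eq_zero hη hη0 (hp.sub hη.two_mul)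
    (hq.add hη.two_mul) hΩ, add_zero, smul_zero] at this
  exact sub_eq_zero.1 this

/-- The bracket of the vanishing `D3 (symM L) η p q` with `G x`; a further anticommutator with `G z`
then leads back to `comK`. -/
lemma D3_symH_moment (h : Rep M α G L) {η p q x a' b : F} (hη : Lat M α true η)
    (hη0 : η ≠ 0) (hp : Lat M α true p) (hq : Lat M α true q) (hx : Lat M α true x)
    (hb : x + p = b) (ha' : x + q = a')
    (hΩ : comK G (-(3 * η)) (3 * η) = (3 : F) • comK G (-η) η) :
    ((x - (p - 3 * η) / 2) • symH G L (q + 3 * η) (b - 3 * η) +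
        (x - (q + 3 * η) / 2) • symH G L (p - 3 * η) (a' + 3 * η)) -
      (3 : F) • ((x - (p - η) / 2) • symH G L (q + η) (b - η) +
        (x - (q + η) / 2) • symH G L (p - η) (a' + η)) +
      (3 : F) • ((x - (p + η) / 2) • symH G L (q - η) (b + η) +
        (x - (q - η) / 2) • symH G L (p + η) (a' - η)) -
      ((x - (p + 3 * η) / 2) • symH G L (q - 3 * η) (b + 3 * η) +
        (x - (q - 3 * η) / 2) • symH G L (p + 3 * η) (a' - 3 * η)) = 0 := by
  subst hb ha'
  have hη3 := hη.three_mul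
  have e := congrArg (fun y => G x * y - y * G x) (h.D3_symM_eq_zero hη hη0 hp hq hΩ)
  have a1 := h.lie_G_symM hx (hp.sub hη3) (hq.add hη3) (a := x + p - 3 * η)
    (b := x + q + 3 * η) (by ring) (by ring)
  have a2 := h.lie_G_symM hx (hp.sub hη) (hq.add hη) (a := x + p - η)
    (b := x + q + η) (by ring) (by ring)
  have a3 := h.lie_G_symM hx (hp.add hη) (hq.sub hη) (a := x + p + η)
    (b := x + q - η) (by ring) (by ring)
  have a4 := h.lie_G_symM hx (hp.add hη3) (hq.sub hη3) (a := x + p + 3 * η)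
    (b := x + q - 3 * η) (by ring) (by ring)
  simp only [D3, mul_add, mul_sub, add_mul, sub_mul, mul_smul_comm,
    smul_mul_assoc, mul_zero, zero_mul, sub_zero] at e
  linear_combination (norm := module) a1 - (3 : F) • a2 + (3 : F) • a3 - a4 - e

/-- The coefficient expression produced by two odd elements acting on a third difference. -/
lemma D3_comK_moment (h : Rep M α G L) {η p q x z a b a' b' m n : F} (hη : Lat M α true η)
    (hη0 : η ≠ 0) (hp : Lat M α true p) (hq : Lat M α true q) (hx : Lat M α true x)
    (hz : Lat M α true z) (ha : z + q = a) (hb : x + p = b) (ha' : z + p = a') (hb' : x + q = b')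
    (hm : z + x + p = m) (hn : z + x + q = n)
    (hΩ : comK G (-(3 * η)) (3 * η) = (3 : F) • comK G (-η) η) :
    ((x - (p - 3 * η) / 2) * (z - (q + 3 * η) / 2)) • comK G (a + 3 * η) (b - 3 * η) +
      ((x - (q + 3 * η) / 2) * (z - (p - 3 * η) / 2)) • comK G (a' - 3 * η) (b' + 3 * η) -
      (3 : F) • (((x - (p - η) / 2) * (z - (q + η) / 2)) • comK G (a + η) (b - η) +
        ((x - (q + η) / 2) * (z - (p - η) / 2)) • comK G (a' - η) (b' + η)) +
      (3 : F) • (((x - (p + η) / 2) * (z - (q - η) / 2)) • comK G (a - η) (b + η) +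
        ((x - (q - η) / 2) * (z - (p + η) / 2)) • comK G (a' + η) (b' - η)) -
      (((x - (p + 3 * η) / 2) * (z - (q - 3 * η) / 2)) • comK G (a - 3 * η) (b + 3 * η) +
        ((x - (q - 3 * η) / 2) * (z - (p + 3 * η) / 2)) • comK G (a' + 3 * η) (b' - 3 * η)) =
      η • (D2 (symM L) η m q - D2 (symM L) η p n) := by
  have hη3 := hη.three_mul
  have e := congrArg (fun y => G z * y + y * G z)
    (h.D3_symH_moment hη hη0 hp hq hx (b := b) (a' := b') hb hb' hΩ)
  have hbl : Lat M α false b := hb ▸ hx.add hp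
  have hbl' : Lat M α false b' := hb' ▸ hx.add hq
  have hml : Lat M α true m := hm ▸ (hz.add hx).add hp
  have hnl : Lat M α true n := hn ▸ (hz.add hx).add hq
  have d1 := h.D3_symM_eq_zero hη hη0 hml hq hΩ
  have d2 := h.D3_symM_eq_zero hη hη0 hp hnl hΩ
  have a1 := h.anti_G_symH hz (hq.add hη3) (hbl.sub hη3) (a := m - 3 * η) (b := a + 3 * η)
    (by rw [← hm, ← hb]; ring) (by rw [← ha]; ring)
  have a2 := h.anti_G_symH hz (hq.add hη) (hbl.sub hη) (a := m - η) (b := a + η)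
    (by rw [← hm, ← hb]; ring) (by rw [← ha]; ring)
  have a3 := h.anti_G_symH hz (hq.sub hη) (hbl.add hη) (a := m + η) (b := a - η)
    (by rw [← hm, ← hb]; ring) (by rw [← ha]; ring)
  have a4 := h.anti_G_symH hz (hq.sub hη3) (hbl.add hη3) (a := m + 3 * η) (b := a - 3 * η)
    (by rw [← hm, ← hb]; ring) (by rw [← ha]; ring)
  have b1 := h.anti_G_symH hz (hp.sub hη3) (hbl'.add hη3) (a := n + 3 * η) (b := a' - 3 * η)
    (by rw [← hn, ← hb']; ring) (by rw [← ha']; ring)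
  have b2 := h.anti_G_symH hz (hp.sub hη) (hbl'.add hη) (a := n + η) (b := a' - η)
    (by rw [← hn, ← hb']; ring) (by rw [← ha']; ring)
  have b3 := h.anti_G_symH hz (hp.add hη) (hbl'.sub hη) (a := n - η) (b := a' + η)
    (by rw [← hn, ← hb']; ring) (by rw [← ha']; ring)
  have b4 := h.anti_G_symH hz (hp.add hη3) (hbl'.sub hη3) (a := n - 3 * η) (b := a' + 3 * η)
    (by rw [← hn, ← hb']; ring) (by rw [← ha']; ring)
  simp only [mul_add, mul_sub, add_mul, sub_mul, mul_smul_comm, smul_mul_assoc, mul_zero,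
    zero_mul, add_zero] at e
  rw [symM_swap (q + 3 * η)] at a1
  rw [symM_swap (q + η)] at a2
  rw [symM_swap (q - η)] at a3
  rw [symM_swap (q - 3 * η)] at a4
  simp only [D3] at d1 d2
  simp only [D2]
  linear_combination (norm := module) -e + (x - (p - 3 * η) / 2) • a1
    - (3 * (x - (p - η) / 2)) • a2 + (3 * (x - (p + η) / 2)) • a3 - (x - (p + 3 * η) / 2) • a4
    + (x - (q + 3 * η) / 2) • b1
    - (3 * (x - (q + η) / 2)) • b2 + (3 * (x - (q - η) / 2)) • b3 - (x - (q - 3 * η) / 2) • b4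
    + (2 * (x - p / 2)) • d1 + (2 * (x - q / 2)) • d2

/-- Moving `p, q` by `±2η` and `x, z` by `∓2η` fixes `a, b, a', b'` and, by `D2_symM_shift`, the
right side of `D3_comK_moment`. The coefficients on the left are quadratic in the move, so a second
difference leaves `18η²` times the difference of the two sides. -/
lemma D3_comK_eq (h : Rep M α G L) {η p q x z a b a' b' : F} (hη : Lat M α true η)
    (hη0 : η ≠ 0) (hp : Lat M α true p) (hq : Lat M α true q) (hx : Lat M α true x)
    (hz : Lat M α true z) (ha : z + q = a) (hb : x + p = b) (ha' : z + p = a') (hb' : x + q = b')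
    (hΩ : comK G (-(3 * η)) (3 * η) = (3 : F) • comK G (-η) η) :
    D3 (comK G) η a b = D3 (comK G) η a' b' := by
  have hη2 := hη.two_mul
  have m0 := h.D3_comK_moment hη hη0 hp hq hx hz ha hb ha' hb' rfl rfl hΩ
  have m1 := h.D3_comK_moment hη hη0 (hp.add hη2) (hq.add hη2) (hx.sub hη2) (hz.sub hη2)
    (a := a) (b := b) (a' := a') (b' := b') (m := z + x + p - 2 * η) (n := z + x + q - 2 * η)
    (by rw [← ha]; ring) (by rw [← hb]; ring) (by rw [← ha']; ring) (by rw [← hb']; ring)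
    (by ring) (by ring) hΩ
  have m2 := h.D3_comK_moment hη hη0 (hp.sub hη2) (hq.sub hη2) (hx.add hη2) (hz.add hη2)
    (a := a) (b := b) (a' := a') (b' := b') (m := z + x + p + 2 * η) (n := z + x + q + 2 * η)
    (by rw [← ha]; ring) (by rw [← hb]; ring) (by rw [← ha']; ring) (by rw [← hb']; ring)
    (by ring) (by ring) hΩ
  have hzx : Lat M α false (z + x) := hz.add hx
  rw [h.D2_symM_shift hη hη0 (hzx.add hp) hq (p' := z + x + p - 2 * η) (q' := q + 2 * η) rfl rfl
    hΩ, ← h.D2_symM_shift hη hη0 (hp.add hη2) ((hzx.add hq).sub hη2) (p' := p)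
    (q' := z + x + q) (by ring) (by ring) hΩ] at m1
  rw [← h.D2_symM_shift hη hη0 ((hzx.add hp).add hη2) (hq.sub hη2) (p' := z + x + p) (q' := q)
    (by ring) (by ring) hΩ, h.D2_symM_shift hη hη0 hp (hzx.add hq) (p' := p - 2 * η)
    (q' := z + x + q + 2 * η) rfl rfl hΩ] at m2
  have : (18 * η ^ 2) • (D3 (comK G) η a b - D3 (comK G) η a' b') = 0 := by
    simp only [D3]
    linear_combination (norm := module) (2 : F) • m0 - m1 - m2
  exact sub_eq_zero.1 ((smul_eq_zero.1 this).resolve_left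
    (mul_ne_zero (by norm_num) (pow_ne_zero 2 hη0)))

/-- By `D3_comK_eq` the value depends only on `a + b`, so it may be computed at `(a + b, 0)`. -/
lemma D3_comK_eq_zero (h : Rep M α G L) {η a b : F} (hη : Lat M α true η)
    (hη0 : η ≠ 0) (ha : Lat M α false a) (hb : Lat M α false b)
    (hΩ : comK G (-(3 * η)) (3 * η) = (3 : F) • comK G (-η) η) :
    D3 (comK G) η a b = 0 := by
  rw [h.D3_comK_eq hη hη0 (p := b + η) (q := η) (x := -η) (z := a - η) (a' := a + b) (b' := 0)
    (hb.add hη) hη hη.neg (ha.sub hη) (by ring) (by ring) (by ring) (by ring) hΩ]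
  exact h.D3_comK_zero hη hη0 (ha.add hb) hΩ

/-- The bracket with `L m` weights each term of the vanishing third difference by its degree; what
survives is the first moment `D2`. -/
lemma D2_comK_shift (h : Rep M α G L) {η m a b a' b' : F} (hη : Lat M α true η)
    (hη0 : η ≠ 0) (hm : Lat M α false m) (ha : Lat M α false a) (hb : Lat M α false b)
    (ha' : a + m = a') (hb' : b + m = b')
    (hΩ : comK G (-(3 * η)) (3 * η) = (3 : F) • comK G (-η) η) :
    D2 (comK G) η a' b = D2 (comK G) η a b' := by
  have hη3 := hη.three_mul
  have e := congrArg (fun y => L m * y - y * L m) (h.D3_comK_eq_zero hη hη0 ha hb hΩ)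
  have d1 := h.D3_comK_eq_zero hη hη0 (a := a') (ha' ▸ ha.add hm) hb hΩ
  have d2 := h.D3_comK_eq_zero hη hη0 (b := b') ha (hb' ▸ hb.add hm) hΩ
  have a1 := h.lie_L_comK hm (ha.sub hη3) (hb.add hη3) (p' := a' - 3 * η) (q' := b' + 3 * η)
    (by rw [← ha']; ring) (by rw [← hb']; ring)
  have a2 := h.lie_L_comK hm (ha.sub hη) (hb.add hη) (p' := a' - η) (q' := b' + η)
    (by rw [← ha']; ring) (by rw [← hb']; ring)
  have a3 := h.lie_L_comK hm (ha.add hη) (hb.sub hη) (p' := a' + η) (q' := b' - η)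
    (by rw [← ha']; ring) (by rw [← hb']; ring)
  have a4 := h.lie_L_comK hm (ha.add hη3) (hb.sub hη3) (p' := a' + 3 * η) (q' := b' - 3 * η)
    (by rw [← ha']; ring) (by rw [← hb']; ring)
  simp only [D3, mul_add, mul_sub, add_mul, sub_mul, mul_smul_comm,
    smul_mul_assoc, mul_zero, zero_mul, sub_zero] at e
  simp only [D3] at d1 d2
  have : η • (D2 (comK G) η a' b - D2 (comK G) η a b') = 0 := by
    simp only [D2]
    linear_combination (norm := module) -e + a1 - (3 : F) • a2 + (3 : F) • a3 - a4
      + (a - m / 2) • d1 + (b - m / 2) • d2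
  exact sub_eq_zero.1 ((smul_eq_zero.1 this).resolve_left hη0)

/-- The shift rule makes `D2` symmetric in `a, b`, while `comK` makes it antisymmetric. -/
lemma D2_comK_eq_zero (h : Rep M α G L) {η a b : F} (hη : Lat M α true η)
    (hη0 : η ≠ 0) (ha : Lat M α false a) (hb : Lat M α false b)
    (hΩ : comK G (-(3 * η)) (3 * η) = (3 : F) • comK G (-η) η) :
    D2 (comK G) η a b = 0 := by
  have e1 := h.D2_comK_shift hη hη0 (hb.sub ha) ha ha (a' := b) (b' := b) (by ring) (by ring) hΩ
  have e2 : D2 (comK G) η b a = -D2 (comK G) η a b := by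
    simp only [D2]
    rw [comK_swap (b - 3 * η), comK_swap (b - η), comK_swap (b + η), comK_swap (b + 3 * η)]
    module
  rw [e2] at e1
  have : (2 : F) • D2 (comK G) η a b = 0 := by linear_combination (norm := module) -e1
  exact (smul_eq_zero.1 this).resolve_left two_ne_zero

/-- `D3` and `D2` combine the same four values; the chosen combination cancels the outermost one. -/
lemma comK_second_difference (h : Rep M α G L) {η p q : F} (hη : Lat M α true η)
    (hη0 : η ≠ 0) (hp : Lat M α true p) (hq : Lat M α true q)
    (hΩ : comK G (-(3 * η)) (3 * η) = (3 : F) • comK G (-η) η) :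
    comK G (p + 2 * η) (q - 2 * η) - (2 : F) • comK G p q + comK G (p - 2 * η) (q + 2 * η) = 0 := by
  have e1 := h.D3_comK_eq_zero hη hη0 (hp.add hη) (hq.sub hη) hΩ
  have e2 := h.D2_comK_eq_zero hη hη0 (hp.add hη) (hq.sub hη) hΩ
  simp only [D2, D3] at e1 e2
  rw [show p + η - 3 * η = p - 2 * η by ring, show q - η + 3 * η = q + 2 * η by ring,
    show p + η - η = p by ring, show q - η + η = q by ring,
    show p + η + η = p + 2 * η by ring, show q - η - η = q - 2 * η by ring] at e1 e2
  linear_combination (norm := module) (1 / 2 : F) • e1 + (1 / 6 : F) • e2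

/-- The same mechanism one order lower: bracketing the vanishing second difference with `L m` leaves
its first moment, the central difference. -/
lemma comK_central_difference (h : Rep M α G L) {η m p q p' q' : F} (hη : Lat M α true η)
    (hη0 : η ≠ 0) (hm : Lat M α false m) (hp : Lat M α true p) (hq : Lat M α true q)
    (hp' : p + m = p') (hq' : q + m = q')
    (hΩ : comK G (-(3 * η)) (3 * η) = (3 : F) • comK G (-η) η) :
    comK G (p' + 2 * η) (q - 2 * η) - comK G (p' - 2 * η) (q + 2 * η) =
      comK G (p + 2 * η) (q' - 2 * η) - comK G (p - 2 * η) (q' + 2 * η) := by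
  have hη2 := hη.two_mul
  have e := congrArg (fun y => L m * y - y * L m) (h.comK_second_difference hη hη0 hp hq hΩ)
  have d1 := h.comK_second_difference hη hη0 (p := p') (hp' ▸ hp.add hm) hq hΩ
  have d2 := h.comK_second_difference hη hη0 (q := q') hp (hq' ▸ hq.add hm) hΩ
  have a1 := h.lie_L_comK hm (hp.sub hη2) (hq.add hη2) (p' := p' - 2 * η) (q' := q' + 2 * η)
    (by rw [← hp']; ring) (by rw [← hq']; ring)
  have a2 := h.lie_L_comK hm hp hq hp' hq'
  have a3 := h.lie_L_comK hm (hp.add hη2) (hq.sub hη2) (p' := p' + 2 * η) (q' := q' - 2 * η)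
    (by rw [← hp']; ring) (by rw [← hq']; ring)
  simp only [mul_add, mul_sub, add_mul, sub_mul, mul_smul_comm,
    smul_mul_assoc, mul_zero, zero_mul, sub_zero] at e
  have : (2 * η) • ((comK G (p' + 2 * η) (q - 2 * η) - comK G (p' - 2 * η) (q + 2 * η)) -
      (comK G (p + 2 * η) (q' - 2 * η) - comK G (p - 2 * η) (q' + 2 * η))) = 0 := by
    linear_combination (norm := module) e - a1 + (2 : F) • a2 - a3
      - (p - m / 2) • d1 - (q - m / 2) • d2
  exact sub_eq_zero.1 ((smul_eq_zero.1 this).resolve_left (mul_ne_zero two_ne_zero hη0))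

lemma comK_central_difference_eq (h : Rep M α G L) {η p q p' q' : F} (hη : Lat M α true η)
    (hη0 : η ≠ 0) (hp : Lat M α true p) (hq' : Lat M α true q') (hp' : Lat M α true p')
    (hs : p + q = p' + q')
    (hΩ : comK G (-(3 * η)) (3 * η) = (3 : F) • comK G (-η) η) :
    comK G (p + 2 * η) (q - 2 * η) - comK G (p - 2 * η) (q + 2 * η) =
      comK G (p' + 2 * η) (q' - 2 * η) - comK G (p' - 2 * η) (q' + 2 * η) :=
  (h.comK_central_difference hη hη0 (hp'.sub hp) hp hq' (p' := p') (q' := q) (by ring)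
    (by linear_combination -hs) hΩ).symm

lemma comK_forward_difference (h : Rep M α G L) {η p q : F} (hη : Lat M α true η)
    (hη0 : η ≠ 0) (hp : Lat M α true p) (hq : Lat M α true q)
    (hΩ : comK G (-(3 * η)) (3 * η) = (3 : F) • comK G (-η) η) :
    comK G (p + 2 * η) (q - 2 * η) = comK G p q +
      (1 / 2 : F) • (comK G (p + 2 * η) (q - 2 * η) - comK G (p - 2 * η) (q + 2 * η)) := by
  linear_combination (norm := module) (1 / 2 : F) • h.comK_second_difference hη hη0 hp hq hΩ

/-- `G_{p+m} G_q - …` minus the same with `m` moved to the other factor depends only on `p + q`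
and `m`. -/
lemma comK_shift_difference (h : Rep M α G L) {η m p q p₁ q₁ p' q' p₁' q₁' : F}
    (hη : Lat M α true η) (hη0 : η ≠ 0) (hm : Lat M α false m) (hp : Lat M α true p)
    (hq : Lat M α true q) (hp' : Lat M α true p') (hq' : Lat M α true q')
    (hs : p + q = p' + q') (h1 : p + m = p₁) (h2 : q + m = q₁) (h1' : p' + m = p₁')
    (h2' : q' + m = q₁')
    (hΩ : comK G (-(3 * η)) (3 * η) = (3 : F) • comK G (-η) η) :
    comK G p₁ q - comK G p q₁ = comK G p₁' q' - comK G p' q₁' := by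
  have hη2 := hη.two_mul
  -- The bracket of `L m` with a central difference contains the wanted shift difference with
  -- coefficient `4η`. All other terms are central differences, which depend only on the total
  -- degree and cancel between `(p, q)` and `(p', q')`.
  have key : ∀ {p q p₁ q₁ : F}, Lat M α true p → Lat M α true q → p + m = p₁ → q + m = q₁ →
      L m * (comK G (p + 2 * η) (q - 2 * η) - comK G (p - 2 * η) (q + 2 * η)) -
        (comK G (p + 2 * η) (q - 2 * η) - comK G (p - 2 * η) (q + 2 * η)) * L m =
      (4 * η) • (comK G p₁ q - comK G p q₁) +
        (p + q - m) • (comK G (p₁ + 2 * η) (q - 2 * η) - comK G (p₁ - 2 * η) (q + 2 * η)) := by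
    intro p q p₁ q₁ hp hq h1 h2
    have f0 := congrArg (fun y => L m * y - y * L m) (h.comK_forward_difference hη hη0 hp hq hΩ)
    have f1 := h.comK_forward_difference hη hη0 (p := p₁) (h1 ▸ hp.add hm) hq hΩ
    have f2 := h.comK_forward_difference hη hη0 (q := q₁) hp (h2 ▸ hq.add hm) hΩ
    have f3 := h.comK_central_difference hη hη0 hm hp hq h1 h2 hΩ
    have a2 := h.lie_L_comK hm hp hq h1 h2
    have a3 := h.lie_L_comK hm (hp.add hη2) (hq.sub hη2) (p' := p₁ + 2 * η) (q' := q₁ - 2 * η)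
      (by rw [← h1]; ring) (by rw [← h2]; ring)
    simp only [mul_add, mul_sub, add_mul, sub_mul, mul_smul_comm,
      smul_mul_assoc] at f0 ⊢
    linear_combination (norm := module) (-2 : F) • f0 + (2 : F) • a3 - (2 : F) • a2 +
      (2 * p + 4 * η - m) • f1 + (2 * q - 4 * η - m) • f2 - (q - 2 * η - m / 2) • f3
  have k1 := key hp hq h1 h2
  have k2 := key hp' hq' h1' h2'
  rw [h.comK_central_difference_eq hη hη0 hp hq' hp' hs hΩ,
    h.comK_central_difference_eq hη hη0 (p := p₁) (q := q) (p' := p₁') (q' := q')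
    (h1 ▸ hp.add hm) hq' (h1' ▸ hp'.add hm) (by rw [← h1, ← h1']; linear_combination hs) hΩ,
    k2, hs] at k1
  have : (4 * η) • ((comK G p₁ q - comK G p q₁) - (comK G p₁' q' - comK G p' q₁')) = 0 := by
    linear_combination (norm := module) -k1
  exact sub_eq_zero.1 ((smul_eq_zero.1 this).resolve_left (mul_ne_zero (by norm_num) hη0))


/-! ### Products of two odd elements through an additive function of the degree difference. -/

/-- The odd-odd commutators in total degree `t`, as a function of the difference of the degrees
(up to normalisation). -/
def Gam (G : F → R) (α t m : F) : R := comK G α (t - α) - comK G (α + m) (t - α - m)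

/-- Written with `q = q' + m`, the left side is a shift difference at total degree `t - m`, and can
therefore be evaluated at the base point `(α, t - α - m)`. -/
lemma comK_sub (h : Rep M α G L) {η m p q p' q' t : F} (hη : Lat M α true η) (hη0 : η ≠ 0)
    (hm : Lat M α false m) (hp : Lat M α true p) (hq : Lat M α true q) (ht : p + q = t)
    (hp' : p + m = p') (hq' : q - m = q')
    (hΩ : comK G (-(3 * η)) (3 * η) = (3 : F) • comK G (-η) η) :
    comK G p q - comK G p' q' = Gam G α t m := by
  have hb : Lat M α true α := Lat.base
  have htl : Lat M α false t := ht ▸ hp.add hq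
  have := h.comK_shift_difference hη hη0 hm (p := p) (q := q') (p₁ := p') (q₁ := q)
    (p' := α) (q' := t - α - m) (p₁' := α + m) (q₁' := t - α) hp (hq' ▸ hq.sub hm) hb
    ((htl.sub hb).sub hm) (by linear_combination ht - hq') hp' (by linear_combination -hq') rfl
    (by ring) hΩ
  rw [Gam]
  linear_combination (norm := module) -this

lemma Gam_add (h : Rep M α G L) {η t m n : F} (hη : Lat M α true η) (hη0 : η ≠ 0)
    (ht : Lat M α false t) (hm : Lat M α false m) (hn : Lat M α false n)
    (hΩ : comK G (-(3 * η)) (3 * η) = (3 : F) • comK G (-η) η) :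
    Gam G α t (m + n) = Gam G α t m + Gam G α t n := by
  have hb : Lat M α true α := Lat.base
  have := h.comK_sub hη hη0 hn (p := α + m) (q := t - α - m) (p' := α + (m + n))
    (q' := t - α - (m + n)) (t := t) (hb.add hm) ((ht.sub hb).sub hm) (by ring) (by ring)
    (by ring) hΩ
  rw [← this, Gam, Gam]
  abel

/-- The shift by `q - p` interchanges `p` and `q`, and `comK` is antisymmetric; hence the factor
two. -/
lemma comK_eq_Gam (h : Rep M α G L) {η p q : F} (hη : Lat M α true η) (hη0 : η ≠ 0)
    (hp : Lat M α true p) (hq : Lat M α true q)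
    (hΩ : comK G (-(3 * η)) (3 * η) = (3 : F) • comK G (-η) η) :
    (2 : F) • comK G p q = Gam G α (p + q) (q - p) := by
  rw [← h.comK_sub hη hη0 (hq.sub hp) hp hq rfl (p' := q) (q' := p) (by ring) (by ring) hΩ,
    comK_swap q p]
  module

/-- The symmetric part of the product is given by the algebra and the antisymmetric part by
`comK_eq_Gam`. This is the form in which the relation `hΩ` is used later. -/
lemma mul_eq_Gam (h : Rep M α G L) {η p q t m : F} (hη : Lat M α true η) (hη0 : η ≠ 0)
    (hp : Lat M α true p) (hq : Lat M α true q) (ht : p + q = t) (hm : q - p = m)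
    (hΩ : comK G (-(3 * η)) (3 * η) = (3 : F) • comK G (-η) η) :
    G p * G q = L t + (1 / 4 : F) • Gam G α t m := by
  subst ht hm
  have e1 := h.gg hp hq
  have e2 := h.comK_eq_Gam hη hη0 hp hq hΩ
  rw [comK] at e2
  linear_combination (norm := module) (1 / 2 : F) • e1 + (1 / 4 : F) • e2

lemma Gam_neg (h : Rep M α G L) {η t m : F} (hη : Lat M α true η) (hη0 : η ≠ 0)
    (ht : Lat M α false t) (hm : Lat M α false m)
    (hΩ : comK G (-(3 * η)) (3 * η) = (3 : F) • comK G (-η) η) :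
    Gam G α t (-m) = -Gam G α t m := by
  have := h.Gam_add hη hη0 ht hm hm.neg hΩ
  rw [add_neg_cancel, Gam, add_zero, sub_zero, sub_self] at this
  exact (neg_eq_of_add_eq_zero_right this.symm).symm

lemma lie_L_Gam (h : Rep M α G L) {η t m : F} (hη : Lat M α true η) (hη0 : η ≠ 0)
    (ht : Lat M α false t) (hm : Lat M α false m)
    (hΩ : comK G (-(3 * η)) (3 * η) = (3 : F) • comK G (-η) η) :
    L t * Gam G α 0 m - Gam G α 0 m * L t = m • Gam G α t t - t • Gam G α t m := by
  have h0 : Lat M α false (0 : F) := M.zero_mem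
  -- For `m = 2z` with `z` odd, `Gam` in degree zero is a multiple of `comK (-z) z`. General `m`
  -- follows by subtracting the cases `z = α + m` and `z = α` and halving.
  have key : ∀ {z : F}, Lat M α true z → L t * Gam G α 0 (2 * z) - Gam G α 0 (2 * z) * L t =
      (2 * z) • Gam G α t t - t • Gam G α t (2 * z) := by
    intro z hz
    have e1 := h.comK_eq_Gam hη hη0 hz.neg hz hΩ
    have e2 := h.comK_eq_Gam hη hη0 (ht.sub hz) hz hΩ
    have e3 := h.comK_eq_Gam hη hη0 hz.neg (hz.add ht) hΩ
    have e4 := h.lie_L_comK ht hz.neg hz (p' := t - z) (q' := z + t) (by ring) (by ring)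
    rw [show -z + z = 0 by ring, show z - -z = 2 * z by ring] at e1
    rw [show t - z + z = t by ring, show z - (t - z) = 2 * z + -t by ring,
      h.Gam_add hη hη0 ht hz.two_mul ht.neg hΩ, h.Gam_neg hη hη0 ht ht hΩ] at e2
    rw [show -z + (z + t) = t by ring, show z + t - -z = 2 * z + t by ring,
      h.Gam_add hη hη0 ht hz.two_mul ht hΩ] at e3
    rw [← e1, mul_smul_comm, smul_mul_assoc]
    linear_combination (norm := module) (2 : F) • e4 + (-z - t / 2) • e2 + (z - t / 2) • e3
  have hb : Lat M α true α := Lat.base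
  have k1 := key (hb.add hm)
  have k2 := key hb
  rw [show 2 * (α + m) = 2 * α + (m + m) by ring, h.Gam_add hη hη0 h0 hb.two_mul (hm.add hm) hΩ,
    h.Gam_add hη hη0 h0 hm hm hΩ, h.Gam_add hη hη0 ht hb.two_mul (hm.add hm) hΩ,
    h.Gam_add hη hη0 ht hm hm hΩ] at k1
  simp only [mul_add, add_mul] at k1 ⊢
  linear_combination (norm := module) (1 / 2 : F) • k1 - (1 / 2 : F) • k2

end Rep
end Differences

/-! ### Combinatorics of structure constants along a string of weights. -/

section Strings

variable {F : Type*} [Field F] [CharZero F]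

/-- The products of structure constants along a string of weights `X + n η`, with support `S`:
`P n` and `E n` come from going up and down by one and by three steps, `K n` and `Y n` from three
single steps one way and a triple step the other way. -/
structure Strand (S : ℤ → Prop) (P E K Y : ℤ → F) (X η C₁ C₃ : F) : Prop where
  p : ∀ {n}, S n → P n + P (n - 1) = 2 * (X + n * η) + C₁
  e : ∀ {n}, S n → E n + E (n - 3) = 2 * (X + n * η) + C₃
  k : ∀ n, K n + K (n - 1) = 2 * P n * P (n + 1)
  y : ∀ n, Y n + Y (n - 1) = 2 * P n * P (n + 1)
  ky : ∀ n, K n * Y n = E n * P n * P (n + 1) * P (n + 2)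
  supp_p : ∀ {n}, P n ≠ 0 → S n ∧ S (n + 1)
  supp_e : ∀ {n}, E n ≠ 0 → S n ∧ S (n + 3)
  supp_k : ∀ {n}, K n ≠ 0 → S n ∧ S (n + 1) ∧ S (n + 2) ∧ S (n + 3)
  supp_y : ∀ {n}, Y n ≠ 0 → S n ∧ S (n + 1) ∧ S (n + 2) ∧ S (n + 3)

namespace Strand

variable {S : ℤ → Prop} {P E K Y : ℤ → F} {X η C₁ C₃ : F}

lemma shift (h : Strand S P E K Y X η C₁ C₃) (m : ℤ) :
    Strand (fun n => S (n + m)) (fun n => P (n + m)) (fun n => E (n + m)) (fun n => K (n + m))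
      (fun n => Y (n + m)) (X + m * η) η C₁ C₃ where
  p {n} hn := by
    have := h.p hn
    rw [show n + m - 1 = n - 1 + m by ring] at this
    push_cast at this
    linear_combination this
  e {n} hn := by
    have := h.e hn
    rw [show n + m - 3 = n - 3 + m by ring] at this
    push_cast at this
    linear_combination this
  k n := by
    have := h.k (n + m)
    rwa [show n + m - 1 = n - 1 + m by ring, show n + m + 1 = n + 1 + m by ring] at this
  y n := by
    have := h.y (n + m)
    rwa [show n + m - 1 = n - 1 + m by ring, show n + m + 1 = n + 1 + m by ring] at this
  ky n := by
    have := h.ky (n + m)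
    rwa [show n + m + 1 = n + 1 + m by ring, show n + m + 2 = n + 2 + m by ring] at this
  supp_p {n} hn := by
    have := h.supp_p hn
    rwa [show n + m + 1 = n + 1 + m by ring] at this
  supp_e {n} hn := by
    have := h.supp_e hn
    rwa [show n + m + 3 = n + 3 + m by ring] at this
  supp_k {n} hn := by
    have := h.supp_k hn
    rwa [show n + m + 1 = n + 1 + m by ring, show n + m + 2 = n + 2 + m by ring,
      show n + m + 3 = n + 3 + m by ring] at this
  supp_y {n} hn := by
    have := h.supp_y hn
    rwa [show n + m + 1 = n + 1 + m by ring, show n + m + 2 = n + 2 + m by ring,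
      show n + m + 3 = n + 3 + m by ring] at this

/-- Reversing the string exchanges `K` and `Y`. The indices move by one or three because the
products are labelled by the lower end of the interval they span. -/
lemma reflect (h : Strand S P E K Y X η C₁ C₃) :
    Strand (fun n => S (-n)) (fun n => P (-n - 1)) (fun n => E (-n - 3)) (fun n => Y (-n - 3))
      (fun n => K (-n - 3)) X (-η) C₁ C₃ where
  p {n} hn := by
    have := h.p hn
    rw [show -(n - 1) - 1 = -n by ring]
    push_cast at this
    linear_combination this
  e {n} hn := by
    have := h.e hn
    rw [show -(n - 3) - 3 = -n by ring]
    push_cast at this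
    linear_combination this
  k n := by
    have := h.y (-n - 2)
    rw [show -(n - 1) - 3 = -n - 2 by ring, show -(n + 1) - 1 = -n - 2 by ring]
    rw [show -n - 2 - 1 = -n - 3 by ring, show -n - 2 + 1 = -n - 1 by ring] at this
    linear_combination this
  y n := by
    have := h.k (-n - 2)
    rw [show -(n - 1) - 3 = -n - 2 by ring, show -(n + 1) - 1 = -n - 2 by ring]
    rw [show -n - 2 - 1 = -n - 3 by ring, show -n - 2 + 1 = -n - 1 by ring] at this
    linear_combination this
  ky n := by
    have := h.ky (-n - 3)
    rw [show -n - 3 + 1 = -n - 2 by ring, show -n - 3 + 2 = -n - 1 by ring] at this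
    rw [show -(n + 1) - 1 = -n - 2 by ring, show -(n + 2) - 1 = -n - 3 by ring]
    linear_combination this
  supp_p {n} hn := by
    have := h.supp_p hn
    rw [show -n - 1 + 1 = -n by ring] at this
    rw [show -(n + 1) = -n - 1 by ring]
    exact this.symm
  supp_e {n} hn := by
    have := h.supp_e hn
    rw [show -n - 3 + 3 = -n by ring] at this
    rw [show -(n + 3) = -n - 3 by ring]
    exact this.symm
  supp_k {n} hn := by
    have := h.supp_y hn
    rw [show -n - 3 + 3 = -n by ring, show -n - 3 + 2 = -n - 1 by ring,
      show -n - 3 + 1 = -n - 2 by ring] at this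
    rw [show -(n + 3) = -n - 3 by ring, show -(n + 2) = -n - 2 by ring,
      show -(n + 1) = -n - 1 by ring]
    tauto
  supp_y {n} hn := by
    have := h.supp_k hn
    rw [show -n - 3 + 3 = -n by ring, show -n - 3 + 2 = -n - 1 by ring,
      show -n - 3 + 1 = -n - 2 by ring] at this
    rw [show -(n + 3) = -n - 3 by ring, show -(n + 2) = -n - 2 by ring,
      show -(n + 1) = -n - 1 by ring]
    tauto

/-- The hole gives `P (-1) = K (-1) = 0`, and the recursions then yield `P (2i+1) = 2(i+1)η` and `K
(2i+1) = 4(i+1)(i+2)η²`, both nonzero. The first puts `2i+2` in the support. At even places `P` may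
vanish, so `2i+3` has to come from `K`. -/
lemma up_of_hole_zero (h : Strand S P E K Y X η C₁ C₃) (hη : η ≠ 0) (hm : ¬ S (-1)) (h0 : S 0)
    (h1 : S 1) {n : ℤ} (hn : 0 ≤ n) : S n := by
  have hP : P (-1) = 0 := by
    by_contra hP
    exact hm (h.supp_p hP).1
  have hK : K (-1) = 0 := by
    by_contra hK
    exact hm (h.supp_k hK).1
  have p0 := h.p h0
  rw [zero_sub, hP] at p0
  have key : ∀ i : ℕ, S (2 * i) ∧ S (2 * i + 1) ∧ P (2 * i) = P 0 + 2 * i * η ∧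
      K (2 * i - 1) = 4 * i * (i + 1) * η ^ 2 := by
    intro i
    induction i with
    | zero =>
      refine ⟨by simpa using h0, by simpa using h1, by simp, by simpa using hK⟩
    | succ i ih =>
      obtain ⟨ha, hb, hp, hk⟩ := ih
      have hi : (i : F) + 1 ≠ 0 := by exact_mod_cast i.succ_ne_zero
      have hi2 : (i : F) + 2 ≠ 0 := by exact_mod_cast (i + 1).succ_ne_zero
      have q1 := h.p hb
      rw [show 2 * (i : ℤ) + 1 - 1 = 2 * i by ring, hp] at q1
      push_cast at q1 p0
      have hp1 : P (2 * i + 1) = 2 * (i + 1) * η := by linear_combination q1 - p0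
      have hc : S (2 * i + 1 + 1) := (h.supp_p (n := 2 * i + 1) (by
        rw [hp1]; exact mul_ne_zero (mul_ne_zero two_ne_zero hi) hη)).2
      rw [show 2 * (i : ℤ) + 1 + 1 = 2 * i + 2 by ring] at hc
      have q2 := h.p hc
      rw [show 2 * (i : ℤ) + 2 - 1 = 2 * i + 1 by ring, hp1] at q2
      push_cast at q2
      have hp2 : P (2 * i + 2) = P 0 + 2 * (i + 1) * η := by linear_combination q2 - p0
      have k0 := h.k (2 * i)
      have k1 := h.k (2 * i + 1)
      rw [hk, hp, hp1] at k0
      rw [show 2 * (i : ℤ) + 1 - 1 = 2 * i by ring, show 2 * (i : ℤ) + 1 + 1 = 2 * i + 2 by ring,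
        hp1, hp2] at k1
      have hk1 : K (2 * i + 1) = 4 * (i + 1) * (i + 2) * η ^ 2 := by
        linear_combination k1 - k0
      have hd := (h.supp_k (n := 2 * i + 1) (by
        rw [hk1]
        exact mul_ne_zero (mul_ne_zero (mul_ne_zero (by norm_num) hi) hi2) (pow_ne_zero 2 hη)))
      have hd2 := hd.2.2.1
      push_cast
      rw [show 2 * ((i : ℤ) + 1) = 2 * i + 2 by ring, show 2 * (i : ℤ) + 2 - 1 = 2 * i + 1 by ring,
        hp2, hk1]
      refine ⟨hc, by convert hd2 using 1; ring, by ring, by ring⟩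
  obtain ⟨m, rfl⟩ := Int.eq_ofNat_of_zero_le hn
  obtain ⟨i, hi⟩ := Nat.even_or_odd' m
  rcases hi with rfl | rfl
  · exact_mod_cast (key i).1
  · exact_mod_cast (key i).2.1

lemma p_step (h : Strand S P E K Y X η C₁ C₃) {n : ℤ} (h1 : S (n + 1)) (h2 : S (n + 2)) :
    P (n + 2) = P n + 2 * η := by
  have a1 := h.p h1
  have a2 := h.p h2
  rw [show n + 1 - 1 = n by ring] at a1
  rw [show n + 2 - 1 = n + 1 by ring] at a2
  push_cast at a1 a2
  linear_combination a2 - a1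

/-- Six steps are compatible with both recursion lengths: they shift `P` and `E` by `6η` and change
`K` and `Y` quadratically. Thus `ky` at `n + 6i` is a polynomial identity in `i` of degree four with
equal leading terms, and its cubic terms give `E n = 2 P n + 2η - P (n+1)`. -/
lemma e_eq (h : Strand S P E K Y X η C₁ C₃) (hη : η ≠ 0) (hS : ∀ n, 0 ≤ n → S n) {n : ℤ}
    (hn : 0 ≤ n) : E n = 3 * P n - 2 * (X + n * η) - C₁ := by
  have step : ∀ {m : ℤ}, 0 ≤ m → P (m + 2) = P m + 2 * η ∧
      K (m + 2) = K m + 4 * η * (P m + 2 * η) ∧ Y (m + 2) = Y m + 4 * η * (P m + 2 * η) := by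
    intro m hm
    have p0 := h.p_step (n := m) (hS _ (by omega)) (hS _ (by omega))
    have p1 := h.p_step (n := m + 1) (hS _ (by omega)) (hS _ (by omega))
    rw [show m + 1 + 2 = m + 3 by ring] at p1
    have k1 := h.k (m + 1)
    have k2 := h.k (m + 2)
    have y1 := h.y (m + 1)
    have y2 := h.y (m + 2)
    rw [show m + 1 - 1 = m by ring, show m + 1 + 1 = m + 2 by ring] at k1 y1
    rw [show m + 2 - 1 = m + 1 by ring, show m + 2 + 1 = m + 3 by ring] at k2 y2
    rw [p1, p0] at k2 y2
    rw [p0] at k1 y1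
    exact ⟨p0, by linear_combination k2 - k1, by linear_combination y2 - y1⟩
  have step6 : ∀ {m : ℤ}, 0 ≤ m → P (m + 6) = P m + 6 * η ∧
      K (m + 6) = K m + 6 * η * (2 * P m + 2 * η) + (6 * η) ^ 2 ∧
      Y (m + 6) = Y m + 6 * η * (2 * P m + 2 * η) + (6 * η) ^ 2 ∧ E (m + 6) = E m + 6 * η := by
    intro m hm
    obtain ⟨a1, a2, a3⟩ := step hm
    obtain ⟨b1, b2, b3⟩ := step (m := m + 2) (by omega)
    obtain ⟨c1, c2, c3⟩ := step (m := m + 4) (by omega)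
    rw [show m + 2 + 2 = m + 4 by ring] at b1 b2 b3
    rw [show m + 4 + 2 = m + 6 by ring] at c1 c2 c3
    have e1 := h.e (hS (m + 3) (by omega))
    have e2 := h.e (hS (m + 6) (by omega))
    rw [show m + 3 - 3 = m by ring] at e1
    rw [show m + 6 - 3 = m + 3 by ring] at e2
    push_cast at e1 e2
    refine ⟨by linear_combination a1 + b1 + c1, ?_, ?_, by linear_combination e2 - e1⟩
    · rw [c2, b2, a2, b1, a1]; ring
    · rw [c3, b3, a3, b1, a1]; ring
  have prod : ∀ i : ℕ,
      (K n + 6 * i * η * (2 * P n + 2 * η) + (6 * i * η) ^ 2) *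
        (Y n + 6 * i * η * (2 * P n + 2 * η) + (6 * i * η) ^ 2) =
      (E n + 6 * i * η) * (P n + 6 * i * η) * (P (n + 1) + 6 * i * η) *
        (P n + 2 * η + 6 * i * η) := by
    intro i
    have aux : P (n + 6 * i) = P n + 6 * i * η ∧ P (n + 6 * i + 1) = P (n + 1) + 6 * i * η ∧
        K (n + 6 * i) = K n + 6 * i * η * (2 * P n + 2 * η) + (6 * i * η) ^ 2 ∧
        Y (n + 6 * i) = Y n + 6 * i * η * (2 * P n + 2 * η) + (6 * i * η) ^ 2 ∧
        E (n + 6 * i) = E n + 6 * i * η := by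
      induction i with
      | zero => simp
      | succ i ih =>
        obtain ⟨i1, i2, i3, i4, i5⟩ := ih
        obtain ⟨s1, s2, s3, s4⟩ := step6 (m := n + 6 * i) (by omega)
        obtain ⟨s5, -, -, -⟩ := step6 (m := n + 6 * i + 1) (by omega)
        push_cast
        rw [show n + 6 * ((i : ℤ) + 1) = n + 6 * i + 6 by ring,
          show n + 6 * (i : ℤ) + 6 + 1 = n + 6 * i + 1 + 6 by ring, s1, s2, s3, s4, s5, i1, i2, i3,
          i4, i5]
        refine ⟨?_, ?_, ?_, ?_, ?_⟩ <;> ring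
    obtain ⟨i1, i2, i3, i4, i5⟩ := aux
    have := h.ky (n + 6 * i)
    rw [(step (m := n + 6 * i) (by omega)).1, i1, i2, i3, i4, i5] at this
    linear_combination this
  have q0 := prod 0
  have q1 := prod 1
  have q2 := prod 2
  have q3 := prod 3
  push_cast at q0 q1 q2 q3
  -- The third finite difference in `i` isolates the cubic coefficient; the quartic terms have
  -- already cancelled.
  have key : (6 * 6 ^ 3 * η ^ 3) * (2 * P n + 2 * η - P (n + 1) - E n) = 0 := by
    linear_combination q3 - 3 * q2 + 3 * q1 - q0
  have key2 := (mul_eq_zero.1 key).resolve_left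
    (mul_ne_zero (by norm_num) (pow_ne_zero 3 hη))
  have p1 := h.p (hS (n + 1) (by omega))
  rw [show n + 1 - 1 = n by ring] at p1
  push_cast at p1
  linear_combination -key2 - p1

/-- Inserting `e_eq` at `0` and `3` into the relation for `E` leaves only the constants. They encode
the central charge with different weights for `η` and `3η`. -/
lemma const_eq (h : Strand S P E K Y X η C₁ C₃) (hη : η ≠ 0) (hS : ∀ n, 0 ≤ n → S n) :
    C₃ = C₁ := by
  have e0 := h.e_eq hη hS (n := 0) le_rfl
  have e3 := h.e_eq hη hS (n := 3) (by norm_num)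
  have p2 := h.p_step (n := 0) (hS _ (by norm_num)) (hS _ (by norm_num))
  have p3 := h.p (hS 3 (by norm_num))
  have e := h.e (hS 3 (by norm_num))
  norm_num at e0 e3 p2 p3 e
  linear_combination -e + e0 + e3 - 3 * p2 + 3 * p3

lemma up_of_hole (h : Strand S P E K Y X η C₁ C₃) (hη : η ≠ 0) {m : ℤ} (hm : ¬ S m)
    (h0 : S (m + 1)) (h1 : S (m + 2)) {n : ℤ} (hn : m < n) : S n := by
  have := (h.shift (m + 1)).up_of_hole_zero hη (by beta_reduce; rwa [show (-1 : ℤ) + (m + 1) = m by ring])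
    (by beta_reduce; rwa [show (0 : ℤ) + (m + 1) = m + 1 by ring]) (by beta_reduce; rwa [show (1 : ℤ) + (m + 1) = m + 2 by ring]) (n := n - (m + 1)) (by omega)
  simpa using this

/-- Below an element of the support, either there is no hole or a largest one. -/
lemma exists_largest_hole {m n : ℤ} (hm : ¬ S m) (hmn : m < n) (hn : S n) :
    ∃ k, m ≤ k ∧ k < n ∧ ¬ S k ∧ ∀ j, k < j → j ≤ n → S j := by
  classical
  obtain ⟨k, hk, hmax⟩ := Int.exists_greatest_of_bdd (P := fun k => k < n ∧ ¬ S k)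
    ⟨n, fun z hz => hz.1.le⟩ ⟨m, hmn, hm⟩
  refine ⟨k, hmax m ⟨hmn, hm⟩, hk.1, hk.2, fun j hj hjn => ?_⟩
  by_contra hS
  rcases hjn.lt_or_eq with h | rfl
  · exact absurd (hmax j ⟨h, hS⟩) (not_le.2 hj)
  · exact hS hn

/-- If there is a hole below the pair, the largest one is followed by two support points, and
`up_of_hole` fills everything above it. -/
lemma half_of_pair (h : Strand S P E K Y X η C₁ C₃) (hη : η ≠ 0) {n : ℤ} (h0 : S n)
    (h1 : S (n + 1)) : (∀ m, n ≤ m → S m) ∨ ∀ m, m ≤ n + 1 → S m := by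
  by_cases hd : ∀ m, m ≤ n + 1 → S m
  · exact Or.inr hd
  push Not at hd
  obtain ⟨m, hm, hmS⟩ := hd
  have hmn : m < n + 1 := lt_of_le_of_ne hm (by rintro rfl; exact hmS h1)
  have hmn' : m < n := lt_of_le_of_ne (by omega) (by rintro rfl; exact hmS h0)
  obtain ⟨k, -, hkn, hk, hj⟩ := exists_largest_hole hmS hmn' h0
  refine Or.inl fun j hjn => h.up_of_hole hη hk (hj _ (by omega) (by omega)) ?_ (by omega)
  rcases (show k + 2 ≤ n ∨ k + 2 = n + 1 by omega) with h2 | h2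
  · exact hj _ (by omega) h2
  · rwa [h2]

/-- At a nonzero weight `P n` and `P (n-1)` have nonzero sum, so a neighbour lies in the support. -/
lemma half_of_ne (h : Strand S P E K Y X η 0 0) (hη : η ≠ 0) {n : ℤ} (h0 : S n)
    (hX : X + n * η ≠ 0) : (∀ m, n ≤ m → S m) ∨ ∀ m, m ≤ n → S m := by
  have p := h.p h0
  by_cases hP : P n = 0
  · have hP' : P (n - 1) ≠ 0 := by
      intro hP'
      rw [hP, hP'] at p
      exact hX (by linear_combination -p / 2)
    rcases h.half_of_pair hη (h.supp_p hP').1 (by simpa using h0) with h | h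
    · exact Or.inl fun m hm => h m (by omega)
    · exact Or.inr fun m hm => h m (by omega)
  · rcases h.half_of_pair hη h0 (h.supp_p hP).2 with h | h
    · exact Or.inl h
    · exact Or.inr fun m hm => h m (by omega)

/-- Since `P (-1) = E (-1) = 0`, the formula `e_eq` at `2` forces `X = η`, so the hole has weight
zero. At `0` it gives `E (-3) = -2η ≠ 0`, so the string continues beyond the hole. -/
lemma hole_below_zero (h : Strand S P E K Y X η 0 0) (hη : η ≠ 0) (hm : ¬ S (-1))
    (hS : ∀ n, 0 ≤ n → S n) : X = η ∧ S (-3) := by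
  have hP : P (-1) = 0 := by
    by_contra hP
    exact hm (h.supp_p hP).1
  have hE : E (-1) = 0 := by
    by_contra hE
    exact hm (h.supp_e hE).1
  have p0 := h.p (hS 0 le_rfl)
  have p2 := h.p_step (n := 0) (hS _ (by norm_num)) (hS _ (by norm_num))
  have e0 := h.e_eq hη hS (n := 0) le_rfl
  have e2 := h.e_eq hη hS (n := 2) (by norm_num)
  have f0 := h.e (hS 0 le_rfl)
  have f2 := h.e (hS 2 (by norm_num))
  norm_num [hP, hE] at p0 p2 e0 e2 f0 f2
  have hX : X = η := by
    linear_combination (1 / 2 : F) * (f2 - e2 - 3 * p2 - 3 * p0)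
  refine ⟨hX, ?_⟩
  have h3 : E (-3) ≠ 0 := by
    intro h3
    rw [h3] at f0
    exact hη (by linear_combination (1 / 2 : F) * (f0 - e0 - 3 * p0) - hX)
  exact (h.supp_e h3).1

lemma hole_below (h : Strand S P E K Y X η 0 0) (hη : η ≠ 0) {m : ℤ} (hm : ¬ S m)
    (hS : ∀ n, m < n → S n) : X + m * η = 0 ∧ S (m - 2) := by
  have := (h.shift (m + 1)).hole_below_zero hη (by beta_reduce; rwa [show (-1 : ℤ) + (m + 1) = m by ring])
    (fun n hn => hS _ (by omega))
  rw [show -3 + (m + 1) = m - 2 by ring] at this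
  refine ⟨?_, this.2⟩
  have h1 := this.1
  push_cast at h1
  linear_combination h1

lemma hole_above (h : Strand S P E K Y X η 0 0) (hη : η ≠ 0) {m : ℤ} (hm : ¬ S m)
    (hS : ∀ n, n < m → S n) : X + m * η = 0 := by
  have := (h.reflect.hole_below (m := -m) (neg_ne_zero.2 hη) (by simpa using hm)
    (fun n hn => hS _ (by omega))).1
  push_cast at this
  linear_combination this

/-- Below a full upper half the largest hole `k` has weight zero and `k - 2` is in the support, at
nonzero weight. The half string from `k - 2` must go down, which leaves only `k - 1` as a further
hole; `hole_above` would give it weight zero as well. -/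
lemma full_of_up (h : Strand S P E K Y X η 0 0) (hη : η ≠ 0) {n₀ : ℤ} (hS : ∀ n, n₀ ≤ n → S n)
    (n : ℤ) : S n ∨ X + n * η = 0 := by
  by_contra! hn
  have hnn : n < n₀ := by
    by_contra! hc
    exact hn.1 (hS n hc)
  obtain ⟨k, hnk, hkn, hk, hj⟩ := exists_largest_hole hn.1 hnn (hS _ le_rfl)
  have hup : ∀ j, k < j → S j := fun j hj' => by
    rcases le_total j n₀ with h | h
    · exact hj j hj' h
    · exact hS j h
  obtain ⟨hX, hk2⟩ := h.hole_below hη hk hup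
  have hX2 : X + ((k - 2 : ℤ) : F) * η ≠ 0 := by
    push_cast
    intro h'
    exact hη (by linear_combination (1 / 2 : F) * hX - (1 / 2 : F) * h')
  rcases h.half_of_ne hη hk2 hX2 with h' | h'
  · exact hk (h' k (by omega))
  · have hnk1 : n = k - 1 := by
      have : n ≠ k := by rintro rfl; exact hn.2 hX
      have : ¬ n ≤ k - 2 := fun hc => hn.1 (h' n hc)
      omega
    subst hnk1
    exact hn.2 (h.hole_above hη hn.1 fun j hj => h' j (by omega))

lemma full (h : Strand S P E K Y X η 0 0) (hη : η ≠ 0) {n₀ : ℤ} (h0 : S n₀)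
    (hX : X + n₀ * η ≠ 0) (n : ℤ) : S n ∨ X + n * η = 0 := by
  rcases h.half_of_ne hη h0 hX with h' | h'
  · exact h.full_of_up hη h' n
  · have := h.reflect.full_of_up (neg_ne_zero.2 hη) (n₀ := -n₀)
      (fun m hm => h' _ (by omega)) (-n)
    simpa using this

/-- On a full string, going up and down by three steps is determined by going up and down by
one. -/
lemma triple (h : Strand S P E K Y X η 0 0) (hη : η ≠ 0) (h0 : S 0)
    (hS : ∀ n, S n ∨ X + n * η = 0) : E 0 = 3 * P 0 - 2 * X := by
  by_cases hup : ∀ n, 0 ≤ n → S n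
  · simpa using h.e_eq hη hup (n := 0) le_rfl
  · push Not at hup
    obtain ⟨m, hm, hmS⟩ := hup
    have hXm := (hS m).resolve_left hmS
    have hdown : ∀ n, 0 ≤ n → S (-n) := by
      intro n hn
      refine (hS (-n)).resolve_right fun hXn => ?_
      have h2 : ((m + n : ℤ) : F) * η = 0 := by
        push_cast at hXn ⊢
        linear_combination hXm - hXn
      have h3 : m + n = 0 := by exact_mod_cast (mul_eq_zero.1 h2).resolve_right hη
      obtain rfl : m = 0 := by omega
      exact hmS h0
    have e := h.reflect.e_eq (neg_ne_zero.2 hη) hdown (n := 0) le_rfl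
    have p0 := h.p h0
    have f0 := h.e h0
    norm_num at e p0 f0
    linear_combination f0 - e - 3 * p0

end Strand
end Strings

/-! ### The operators of the generators and the graded weight spaces. -/

section Operators

variable {F : Type*} [Field F] [CharZero F] {M : AddSubgroup F} {α : F}
  [hα : Fact (2 * α ∈ M)] {V : Type*} [AddCommGroup V] [Module F V]

open scoped Classical in
/-- The operator of `G_k`, and `0` if `k ∉ α + M`. -/
noncomputable def opG (A : SuperModule (algebra hα.out) V) (k : F) : Module.End F V :=
  if h : Lat M α true k then A.act (Finsupp.single (.G ⟨k, h⟩) 1) else 0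

open scoped Classical in
/-- The operator of `L_l`, and `0` if `l ∉ M`. -/
noncomputable def opL (A : SuperModule (algebra hα.out) V) (l : F) : Module.End F V :=
  if h : Lat M α false l then A.act (Finsupp.single (.L ⟨l, h⟩) 1) else 0

/-- The operator of the central element. -/
noncomputable def opC (A : SuperModule (algebra hα.out) V) : Module.End F V :=
  A.act (Finsupp.single .c 1)

variable {A : SuperModule (algebra hα.out) V}

lemma opG_of_mem {k : F} (h : Lat M α true k) :
    opG A k = A.act (Finsupp.single (.G ⟨k, h⟩) 1) := dif_pos h

lemma opL_of_mem {l : F} (h : Lat M α false l) :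
    opL A l = A.act (Finsupp.single (.L ⟨l, h⟩) 1) := dif_pos h

lemma opL_zero : opL A 0 = A.act L0 := opL_of_mem M.zero_mem

lemma act_single (g : Gen M α) (r : F) (v : V) :
    A.act (Finsupp.single g r) v = r • A.act (Finsupp.single g 1) v := by
  have : Finsupp.single g r = r • Finsupp.single g (1 : F) := by simp
  rw [this, map_smul, LinearMap.smul_apply]

lemma single_mem (g : Gen M α) : Finsupp.single g (1 : F) ∈ (algebra hα.out).comp g.parity :=
  Finsupp.single_mem_supported F _ rfl

lemma act_gens (g h : Gen M α) (v : V) :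
    A.act (genBracket hα.out g h) v =
      A.act (Finsupp.single g 1) (A.act (Finsupp.single h 1) v) -
        (-1 : F) ^ (g.parity.val * h.parity.val) •
          A.act (Finsupp.single h 1) (A.act (Finsupp.single g 1) v) := by
  rw [← A.act_bracket _ _ _ _ v (single_mem g) (single_mem h)]
  change _ = A.act (extend _ _ _) v
  rw [extend_single, one_mul, one_smul]

open scoped Classical in
lemma opG_mul_opG {p q : F} (hp : Lat M α true p) (hq : Lat M α true q) :
    opG A p * opG A q + opG A q * opG A p =
      (2 : F) • opL A (p + q) -
        (if p + q = 0 then (1 / 3 : F) * (p ^ 2 - 1 / 4) else 0) • opC A := by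
  ext v
  have := act_gens (A := A) (.G ⟨p, hp⟩) (.G ⟨q, hq⟩) v
  simp only [genBracket, map_sub, LinearMap.sub_apply, Gen.parity, ZMod.val_one, mul_one, pow_one,
    neg_smul, one_smul, sub_neg_eq_add] at this
  rw [act_single, act_single .c] at this
  rw [opG_of_mem hp, opG_of_mem hq, opL_of_mem (hp.add hq), opC]
  exact this.symm

lemma opL_mul_opG {l k : F} (hl : Lat M α false l) (hk : Lat M α true k) :
    opL A l * opG A k - opG A k * opL A l = (k - l / 2) • opG A (k + l) := by
  ext v
  have := act_gens (A := A) (.L ⟨l, hl⟩) (.G ⟨k, hk⟩) v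
  simp only [genBracket, Gen.parity, ZMod.val_zero, zero_mul, pow_zero, one_smul] at this
  rw [act_single] at this
  rw [add_comm k l, opG_of_mem hk, opL_of_mem hl, opG_of_mem (hl.add hk)]
  refine this.symm.trans ?_
  congr 1
  ring

lemma opL_mul_opL {l m : F} (hl : Lat M α false l) (hm : Lat M α false m) (hC : opC A = 0) :
    opL A l * opL A m - opL A m * opL A l = (m - l) • opL A (l + m) := by
  ext v
  have := act_gens (A := A) (.L ⟨l, hl⟩) (.L ⟨m, hm⟩) v
  simp only [genBracket, Gen.parity, ZMod.val_zero, zero_mul, pow_zero, one_smul, map_add,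
    LinearMap.add_apply] at this
  rw [act_single, act_single .c] at this
  rw [opL_of_mem hl, opL_of_mem hm, opL_of_mem (hl.add hm)]
  rw [opC] at hC
  rw [hC, LinearMap.zero_apply, smul_zero, add_zero] at this
  exact this.symm

lemma opC_comm_opG (k : F) : opC A * opG A k = opG A k * opC A := by
  by_cases hk : Lat M α true k
  · ext v
    have := act_gens (A := A) .c (.G ⟨k, hk⟩) v
    simp only [genBracket, Gen.parity, ZMod.val_zero, zero_mul, pow_zero, one_smul, map_zero,
      LinearMap.zero_apply] at this
    rw [opG_of_mem hk, opC]
    exact (sub_eq_zero.1 this.symm)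
  · rw [opG, dif_neg hk, mul_zero, zero_mul]

lemma opC_comm_opL (l : F) : opC A * opL A l = opL A l * opC A := by
  by_cases hl : Lat M α false l
  · ext v
    have := act_gens (A := A) .c (.L ⟨l, hl⟩) v
    simp only [genBracket, Gen.parity, ZMod.val_zero, zero_mul, pow_zero, one_smul, map_zero,
      LinearMap.zero_apply] at this
    rw [opL_of_mem hl, opC]
    exact (sub_eq_zero.1 this.symm)
  · rw [opL, dif_neg hl, mul_zero, zero_mul]

lemma rep_of_opC_eq_zero (hC : opC A = 0) : Rep M α (opG A) (opL A) where
  gg hp hq := by rw [opG_mul_opG hp hq, hC, smul_zero, sub_zero]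
  lg := opL_mul_opG
  ll hl hm := opL_mul_opL hl hm hC

/-- The even or odd part of a weight space. -/
noncomputable def wt (A : SuperModule (algebra hα.out) V) (s : ZMod 2) (r : F) : Submodule F V :=
  A.comp s ⊓ Module.End.eigenspace (A.act L0) r

lemma mem_wt {s : ZMod 2} {r : F} {v : V} :
    v ∈ wt A s r ↔ v ∈ A.comp s ∧ opL A 0 v = r • v := by
  rw [wt, Submodule.mem_inf, Module.End.mem_eigenspace_iff, opL_zero]

lemma opG_mem_wt {s : ZMod 2} {r k r' : F} {v : V} (hv : v ∈ wt A s r) (hr : r + k = r') :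
    opG A k v ∈ wt A (s + 1) r' := by
  subst hr
  by_cases hk : Lat M α true k
  · rw [mem_wt] at hv ⊢
    constructor
    · rw [opG_of_mem hk, add_comm s]
      exact A.act_mem 1 s _ v (single_mem (.G ⟨k, hk⟩)) hv.1
    · have := LinearMap.congr_fun (opL_mul_opG (A := A) (l := 0) M.zero_mem hk) v
      simp only [LinearMap.sub_apply, Module.End.mul_apply, LinearMap.smul_apply, hv.2,
        map_smul, add_zero, zero_div, sub_zero] at this
      rw [add_smul]
      rw [sub_eq_iff_eq_add.1 this, add_comm]
  · rw [opG, dif_neg hk]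
    exact Submodule.zero_mem _

lemma opC_mem_wt {s : ZMod 2} {r : F} {v : V} (hv : v ∈ wt A s r) : opC A v ∈ wt A s r := by
  rw [mem_wt] at hv ⊢
  constructor
  · have := A.act_mem 0 s _ v (single_mem .c) hv.1
    rwa [zero_add] at this
  · have := LinearMap.congr_fun (opC_comm_opL (A := A) 0) v
    simp only [Module.End.mul_apply, hv.2, map_smul] at this
    exact this.symm

lemma opL_mem_wt {s : ZMod 2} {r l r' : F} {v : V} (hv : v ∈ wt A s r) (hr : r + l = r') :
    opL A l v ∈ wt A s r' := by
  subst hr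
  by_cases hl : Lat M α false l
  · rw [mem_wt] at hv ⊢
    constructor
    · have := A.act_mem 0 s _ v (single_mem (.L ⟨l, hl⟩)) hv.1
      rwa [zero_add, ← opL_of_mem hl] at this
    · have := act_gens (A := A) (.L 0) (.L ⟨l, hl⟩) v
      simp only [genBracket, Gen.parity, ZMod.val_zero, zero_mul, pow_zero, one_smul, map_add,
        LinearMap.add_apply] at this
      rw [act_single, act_single .c] at this
      change _ = A.act L0 _ - A.act _ (A.act L0 v) at this
      rw [← opL_zero, ← opL_of_mem hl, hv.2, map_smul] at this
      simp only [zero_add, AddSubgroup.coe_zero, ne_eq, OfNat.ofNat_ne_zero, not_false_eq_true,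
        zero_pow, sub_self, mul_zero, ite_self, zero_smul, add_zero, sub_zero] at this
      rw [← opL_of_mem hl] at this
      rw [add_smul, sub_eq_iff_eq_add.1 this.symm, add_comm]
  · rw [opL, dif_neg hl]
    exact Submodule.zero_mem _

/-- A subspace stable under the odd generators and the central element is stable under the
algebra. -/
lemma act_mem_of_stable {U : Submodule F V} (hG : ∀ k, Lat M α true k → ∀ v ∈ U, opG A k v ∈ U)
    (hC : ∀ v ∈ U, opC A v ∈ U) (x : Space M α) {v : V} (hv : v ∈ U) : A.act x v ∈ U := by
  induction x using Finsupp.induction_linear with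
  | zero => simp
  | add x y hx hy =>
    rw [map_add]
    exact U.add_mem hx hy
  | single g r =>
    rw [act_single]
    refine U.smul_mem r ?_
    rcases g with ⟨l, hl⟩ | ⟨k, hk⟩ | _
    -- `L_l` is half the anticommutator of `G_α` and `G_{l-α}` up to a multiple of the centre.
    · have hb : Lat M α true α := Lat.base
      have hl' : Lat M α true (l - α) := Lat.sub (i := false) hl hb
      have := LinearMap.congr_fun (opG_mul_opG (A := A) hb hl') v
      rw [add_sub_cancel] at this
      rw [← opL_of_mem (A := A) hl]
      have h2 : (2 : F) • opL A l v ∈ U := by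
        simp only [LinearMap.add_apply, LinearMap.sub_apply, LinearMap.smul_apply,
          Module.End.mul_apply] at this
        rw [eq_sub_iff_add_eq] at this
        rw [← this]
        exact U.add_mem (U.add_mem (hG _ hb _ (hG _ hl' _ hv)) (hG _ hl' _ (hG _ hb _ hv)))
          (U.smul_mem _ (hC _ hv))
      have := U.smul_mem (2⁻¹ : F) h2
      rwa [smul_smul, inv_mul_cancel₀ two_ne_zero, one_smul] at this
    · exact (opG_of_mem (A := A) hk) ▸ hG k hk v hv
    · exact hC v hv


lemma zmod_two_cases (i j : ZMod 2) : j = i ∨ j = i + 1 := by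
  revert i j
  decide

lemma add_one_add_one (s : ZMod 2) : s + 1 + 1 = s := by
  revert s
  decide

lemma disjoint_comp (s : ZMod 2) : Disjoint (A.comp s) (A.comp (s + 1)) := by
  have h : ∀ s : ZMod 2, s = 0 ∨ s = 1 := by decide
  rcases h s with rfl | rfl
  · exact A.isCompl.disjoint
  · exact A.isCompl.disjoint.symm

lemma iSupIndep_wt : iSupIndep fun i : ZMod 2 × F => wt A i.1 i.2 := by
  rintro ⟨s, r⟩
  rw [Submodule.disjoint_def]
  intro x hx hx'
  have hle : ⨆ j, ⨆ (_ : j ≠ (s, r)), wt A j.1 j.2 ≤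
      A.comp (s + 1) ⊔ (A.comp s ⊓ ⨆ r', ⨆ (_ : r' ≠ r), Module.End.eigenspace (A.act L0) r') := by
    refine iSup₂_le fun j hj => ?_
    rcases zmod_two_cases s j.1 with h | h
    · refine le_trans (le_inf (h ▸ inf_le_left) ?_) le_sup_right
      refine le_trans inf_le_right (le_iSup₂_of_le j.2 ?_ le_rfl)
      rintro h2
      exact hj (Prod.ext h h2)
    · exact le_trans (h ▸ inf_le_left) le_sup_left
  obtain ⟨y, hy, z, hz, rfl⟩ := Submodule.mem_sup.1 (hle hx')
  have hy0 : y = 0 := by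
    refine Submodule.disjoint_def.1 (disjoint_comp (A := A) s) y ?_ hy
    have := (A.comp s).sub_mem hx.1 hz.1
    rwa [add_sub_cancel_right] at this
  subst hy0
  rw [zero_add] at hx ⊢
  exact Submodule.disjoint_def.1 (Module.End.eigenspaces_iSupIndep (A.act L0) r) z hx.2 hz.2

lemma exists_add_mem_comp (s : ZMod 2) (v : V) :
    ∃ x ∈ A.comp s, ∃ y ∈ A.comp (s + 1), x + y = v := by
  have hv : v ∈ A.comp 0 ⊔ A.comp 1 := by
    rw [A.isCompl.sup_eq_top]
    trivial
  obtain ⟨x, hx, y, hy, rfl⟩ := Submodule.mem_sup.1 hv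
  have h : ∀ s : ZMod 2, s = 0 ∨ s = 1 := by decide
  rcases h s with rfl | rfl
  · exact ⟨x, hx, y, hy, rfl⟩
  · exact ⟨y, hy, x, hx, add_comm _ _⟩

/-- `L_0` is even, so the homogeneous components of a weight vector are weight vectors of the same
weight. -/
lemma iSup_wt_eq_top (hA : IsIntermediateSeries A) :
    ⨆ i : ZMod 2 × F, wt A i.1 i.2 = ⊤ := by
  rw [eq_top_iff, ← hA.iSup_weight_eq_top]
  refine iSup_le fun r v hv => ?_
  rw [Module.End.mem_eigenspace_iff, ← opL_zero] at hv
  obtain ⟨x, hx, y, hy, rfl⟩ := exists_add_mem_comp (A := A) 0 v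
  rw [map_add, smul_add] at hv
  have hz : Lat M α false (0 : F) := M.zero_mem
  have hx' : opL A 0 x ∈ A.comp 0 := by
    rw [opL_of_mem hz]
    exact A.act_mem 0 0 _ _ (single_mem (.L ⟨0, hz⟩)) hx
  have hy' : opL A 0 y ∈ A.comp (0 + 1) := by
    rw [opL_of_mem hz]
    exact A.act_mem 0 1 _ _ (single_mem (.L ⟨0, hz⟩)) hy
  have e : opL A 0 x - r • x = -(opL A 0 y - r • y) := by
    linear_combination (norm := module) hv
  have h0 : opL A 0 x - r • x = 0 := by
    refine Submodule.disjoint_def.1 (disjoint_comp (A := A) 0) _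
      (Submodule.sub_mem _ hx' (Submodule.smul_mem _ _ hx)) ?_
    rw [e]
    exact Submodule.neg_mem _ (Submodule.sub_mem _ hy' (Submodule.smul_mem _ _ hy))
  have h1 : opL A 0 y - r • y = 0 := by rwa [h0, zero_eq_neg] at e
  refine Submodule.add_mem _ ?_ ?_
  · exact Submodule.mem_iSup_of_mem (0, r) (mem_wt.2 ⟨hx, sub_eq_zero.1 h0⟩)
  · exact Submodule.mem_iSup_of_mem (0 + 1, r) (mem_wt.2 ⟨hy, sub_eq_zero.1 h1⟩)

/-- The span of the weight vectors with index in a set which is separated from its complement by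
the odd generators, as a graded submodule. -/
noncomputable def blockSubmodule (A : SuperModule (algebra hα.out) V) (T : Set (ZMod 2 × F))
    (hT : ∀ s r k, Lat M α true k → (s, r) ∈ T → (s + 1, r + k) ∉ T →
      ∀ x ∈ wt A s r, opG A k x = 0) : A.GradedSubmodule where
  carrier := ⨆ i ∈ T, wt A i.1 i.2
  act_mem x v hv := by
    refine act_mem_of_stable (fun k hk v hv => ?_) (fun v hv => ?_) x hv
    · rw [← Submodule.mem_comap]
      revert hv v
      change _ ≤ Submodule.comap (opG A k) _
      refine iSup₂_le fun i hi v hv => ?_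
      rw [Submodule.mem_comap]
      by_cases h : (i.1 + 1, i.2 + k) ∈ T
      · exact Submodule.mem_iSup_of_mem _ (Submodule.mem_iSup_of_mem h (opG_mem_wt hv rfl))
      · rw [hT i.1 i.2 k hk hi h v hv]
        exact Submodule.zero_mem _
    · rw [← Submodule.mem_comap]
      revert hv v
      change _ ≤ Submodule.comap (opC A) _
      exact iSup₂_le fun i hi v hv =>
        Submodule.mem_iSup_of_mem _ (Submodule.mem_iSup_of_mem hi (opC_mem_wt hv))
  graded x hx y hy hxy := by
    have hle : ⨆ i ∈ T, wt A i.1 i.2 ≤ (A.comp 0 ⊓ ⨆ i ∈ T, wt A i.1 i.2) ⊔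
        (A.comp (0 + 1) ⊓ ⨆ i ∈ T, wt A i.1 i.2) := by
      refine iSup₂_le fun i hi => ?_
      have h2 : wt A i.1 i.2 ≤ ⨆ i ∈ T, wt A i.1 i.2 := le_iSup₂_of_le i hi le_rfl
      rcases zmod_two_cases 0 i.1 with h | h
      · exact le_trans (le_inf (h ▸ inf_le_left) h2) le_sup_left
      · exact le_trans (le_inf (h ▸ inf_le_left) h2) le_sup_right
    obtain ⟨x', hx', y', hy', e⟩ := Submodule.mem_sup.1 (hle hxy)
    have e' : x - x' = y' - y := by linear_combination (norm := module) -e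
    have h0 : x - x' = 0 := by
      refine Submodule.disjoint_def.1 (disjoint_comp (A := A) 0) _
        (Submodule.sub_mem _ hx hx'.1) ?_
      rw [e']
      exact Submodule.sub_mem _ hy'.1 hy
    have h1 : y' - y = 0 := by rwa [h0, eq_comm] at e'
    rw [sub_eq_zero.1 h0, ← sub_eq_zero.1 h1]
    exact ⟨hx'.2, hy'.2⟩

/-- In an indecomposable module, a set of weights which is separated from its complement by the
odd generators contains all weights or none. -/
lemma partition (hA : IsIntermediateSeries A) (T : Set (ZMod 2 × F))
    (hT : ∀ s r k, Lat M α true k → ¬((s, r) ∈ T ↔ (s + 1, r + k) ∈ T) →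
      ∀ x ∈ wt A s r, opG A k x = 0) :
    (∀ i ∈ T, wt A i.1 i.2 = ⊥) ∨ ∀ i ∉ T, wt A i.1 i.2 = ⊥ := by
  have h := hA.indecomposable.2
    (blockSubmodule A T fun s r k hk h1 h2 => hT s r k hk (by tauto))
    (blockSubmodule A Tᶜ fun s r k hk h1 h2 => hT s r k hk (by
      simp only [Set.mem_compl_iff, not_not] at h1 h2
      tauto)) ⟨iSupIndep_wt.disjoint_biSup_biSup disjoint_compl_right, ?_⟩
  · refine h.imp (fun h i hi => ?_) (fun h i hi => ?_)
    · exact eq_bot_iff.2 (h ▸ le_iSup₂_of_le i hi le_rfl)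
    · exact eq_bot_iff.2 (h ▸ le_iSup₂_of_le (f := fun i (_ : i ∈ Tᶜ) => wt A i.1 i.2) i hi le_rfl)
  · rw [codisjoint_iff, eq_top_iff, ← iSup_wt_eq_top hA]
    refine iSup_le fun i => ?_
    by_cases hi : i ∈ T
    · exact le_sup_of_le_left (le_iSup₂_of_le i hi le_rfl)
    · exact le_sup_of_le_right
        (le_iSup₂_of_le (f := fun i (_ : i ∈ Tᶜ) => wt A i.1 i.2) i hi le_rfl)

end Operators

/-! ### Structure constants: central charge, support and the relation between `η` and `3η`. -/

section Frames

variable {F : Type*} [Field F] [CharZero F] {M : AddSubgroup F} {α : F}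
  [hα : Fact (2 * α ∈ M)] {V : Type*} [AddCommGroup V] [Module F V]

/-- A choice of spanning vectors `v s r` of the spaces `wt A s r` (zero if the space is zero),
together with the structure constants of the odd generators: `e s x y` is the coefficient of the
operator of degree `y - x`. -/
structure Frame (A : SuperModule (algebra hα.out) V) where
  v : ZMod 2 → F → V
  e : ZMod 2 → F → F → F
  mem : ∀ s r, v s r ∈ wt A s r
  span : ∀ {s r x}, x ∈ wt A s r → ∃ c : F, x = c • v s r
  act : ∀ {s x y k}, x + k = y → opG A k (v s x) = e s x y • v (s + 1) y
  e_src : ∀ {s x} (y), v s x = 0 → e s x y = 0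
  e_tgt : ∀ {s y} (x), v (s + 1) y = 0 → e s x y = 0

variable {A : SuperModule (algebra hα.out) V}

lemma exists_frame (hA : IsIntermediateSeries A) : Nonempty (Frame A) := by
  classical
  have h : ∀ s r, ∃ v₀ ∈ wt A s r, wt A s r ≤ Submodule.span F {v₀} := fun s r =>
    (rank_submodule_le_one_iff _).1 (hA.rank_weight_le_one s r)
  choose v hv hspan using h
  have hspan' : ∀ {s r x}, x ∈ wt A s r → ∃ c : F, x = c • v s r := fun hx =>
    (Submodule.mem_span_singleton.1 (hspan _ _ hx)).imp fun _ h => h.symm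
  have h2 : ∀ s x y, ∃ c : F, opG A (y - x) (v s x) = c • v (s + 1) y := fun s x y =>
    hspan' (opG_mem_wt (hv s x) (by ring))
  choose e he using h2
  -- Coefficients from or to a zero vector are set to zero, so that a nonzero coefficient certifies
  -- that both weights occur.
  refine ⟨⟨v, fun s x y => if v s x = 0 ∨ v (s + 1) y = 0 then 0 else e s x y, hv, hspan', ?_,
    fun y h => if_pos (Or.inl h), fun x h => if_pos (Or.inr h)⟩⟩
  rintro s x y k rfl
  have := he s x (x + k)
  rw [add_sub_cancel_left] at this
  rw [this]
  split_ifs with h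
  · rcases h with h | h
    · rw [zero_smul, ← this, h, map_zero]
    · rw [h, smul_zero, smul_zero]
  · rfl

lemma exists_smul_of_mem_wt (hA : IsIntermediateSeries A) {s : ZMod 2} {r : F} {x y : V}
    (hx : x ∈ wt A s r) (hy : y ∈ wt A s r) (hx0 : x ≠ 0) : ∃ c : F, y = c • x := by
  obtain ⟨f⟩ := exists_frame hA
  obtain ⟨a, ha⟩ := f.span hx
  obtain ⟨b, rfl⟩ := f.span hy
  have ha0 : a ≠ 0 := by
    rintro rfl
    exact hx0 (by rw [ha, zero_smul])
  exact ⟨b * a⁻¹, by rw [ha, smul_smul, inv_mul_cancel_right₀ ha0]⟩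

lemma exists_wt_ne_zero (hA : IsIntermediateSeries A) : ∃ s r, ∃ x ∈ wt A s r, x ≠ 0 := by
  by_contra! h
  have htop := iSup_wt_eq_top hA
  have : ⨆ i : ZMod 2 × F, wt A i.1 i.2 = ⊥ := by
    rw [iSup_eq_bot]
    exact fun i => (Submodule.eq_bot_iff _).2 (h i.1 i.2)
  have hV := hA.indecomposable.1
  exact bot_ne_top (this.symm.trans htop)

lemma linearMap_eq_of_wt (hA : IsIntermediateSeries A) {f g : Module.End F V}
    (h : ∀ s r, ∀ x ∈ wt A s r, f x = g x) : f = g := by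
  have : (⊤ : Submodule F V) ≤ LinearMap.eqLocus f g := by
    rw [← iSup_wt_eq_top hA]
    exact iSup_le fun i x hx => h i.1 i.2 x hx
  ext x
  exact this (x := x) trivial

/-- The centre acts by a scalar on each graded weight space, and a nonzero odd step forces equal
scalars at its ends. `partition` then makes the scalar global. -/
lemma exists_central_charge (hA : IsIntermediateSeries A) : ∃ z : F, opC A = z • 1 := by
  obtain ⟨s₀, r₀, x₀, hx₀, hne⟩ := exists_wt_ne_zero hA
  obtain ⟨z, hz⟩ := exists_smul_of_mem_wt hA hx₀ (opC_mem_wt hx₀) hne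
  have hcomm : ∀ k x, opC A (opG A k x) = opG A k (opC A x) := fun k x =>
    LinearMap.congr_fun (opC_comm_opG k) x
  have hone : ∀ {s r y}, y ∈ wt A s r → y ≠ 0 → opC A y = z • y →
      ∀ x ∈ wt A s r, opC A x = z • x := by
    intro s r y hy hy0 hyz x hx
    obtain ⟨c, rfl⟩ := exists_smul_of_mem_wt hA hy hx hy0
    rw [map_smul, hyz, smul_comm]
  have := partition hA {i | ∀ x ∈ wt A i.1 i.2, opC A x = z • x} (by
    intro s r k hk hd x hx
    by_contra hG
    refine hd ⟨fun h => ?_, fun h => ?_⟩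
    · refine hone (opG_mem_wt hx rfl) hG ?_
      rw [hcomm, h x hx, map_smul]
    · obtain ⟨c, hc⟩ := exists_smul_of_mem_wt hA hx (opC_mem_wt hx)
        (by rintro rfl; exact hG (map_zero _))
      refine hone hx (by rintro rfl; exact hG (map_zero _)) ?_
      have h1 := h _ (opG_mem_wt hx rfl)
      rw [hcomm, hc, map_smul, ← sub_eq_zero, ← sub_smul, smul_eq_zero] at h1
      rw [hc, sub_eq_zero.1 (h1.resolve_right hG)])
  have hT : ∀ s r, ∀ x ∈ wt A s r, opC A x = z • x := by
    rcases this with h | h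
    · have h0 := h (s₀, r₀) (hone hx₀ hne hz)
      exact absurd ((Submodule.eq_bot_iff _).1 h0 x₀ hx₀) hne
    · intro s r
      by_contra hc
      have h0 := h (s, r) hc
      refine hc fun x hx => ?_
      rw [(Submodule.eq_bot_iff _).1 h0 x hx, map_zero, smul_zero]
  exact ⟨z, linearMap_eq_of_wt hA fun s r x hx => by rw [hT s r x hx]; simp⟩

/-- The index `(s, r)` lies in the same coset as `(s₀, r₀)`. -/
def On (M : AddSubgroup F) (α : F) (s₀ : ZMod 2) (r₀ : F) (s : ZMod 2) (r : F) : Prop :=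
  (s = s₀ ∧ Lat M α false (r - r₀)) ∨ (s = s₀ + 1 ∧ Lat M α true (r - r₀))

lemma On.step {s₀ s : ZMod 2} {r₀ r k : F} (h : On M α s₀ r₀ s r) (hk : Lat M α true k) :
    On M α s₀ r₀ (s + 1) (r + k) := by
  rcases h with ⟨rfl, h⟩ | ⟨rfl, h⟩
  · refine Or.inr ⟨rfl, ?_⟩
    rw [add_sub_right_comm]
    exact h.add hk
  · refine Or.inl ⟨add_one_add_one _, ?_⟩
    rw [add_sub_right_comm]
    exact h.add hk

lemma On.back {s₀ s : ZMod 2} {r₀ r k : F} (h : On M α s₀ r₀ (s + 1) (r + k))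
    (hk : Lat M α true k) : On M α s₀ r₀ s r := by
  have := h.step hk.neg
  rwa [add_one_add_one, add_neg_cancel_right] at this

/-- Odd steps stay inside the graded coset of the starting weight, so `partition` applies to that
coset. -/
lemma on_of_wt_ne_zero (hA : IsIntermediateSeries A) {s₀ s : ZMod 2} {r₀ r : F} {x₀ x : V}
    (hx₀ : x₀ ∈ wt A s₀ r₀) (h0 : x₀ ≠ 0) (hx : x ∈ wt A s r) (hne : x ≠ 0) :
    On M α s₀ r₀ s r := by
  rcases partition hA {i | On M α s₀ r₀ i.1 i.2} (fun s r k hk hd => absurd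
    ⟨fun h => On.step h hk, fun h => On.back h hk⟩ hd) with h | h
  · have hmem : On M α s₀ r₀ s₀ r₀ := Or.inl ⟨rfl, by rw [sub_self]; exact M.zero_mem⟩
    exact absurd ((Submodule.eq_bot_iff _).1 (h (s₀, r₀) hmem) x₀ hx₀) h0
  · by_contra hc
    exact hne ((Submodule.eq_bot_iff _).1 (h (s, r) hc) x hx)

/-- In characteristic zero the multiples of a nonzero `m` are distinct, so finitely many exceptional
degrees can always be avoided. -/
lemma exists_lat_notMem (hM : M ≠ ⊥) (i : Bool) (S : Finset F) : ∃ x, Lat M α i x ∧ x ∉ S := by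
  obtain ⟨m, hm, hm0⟩ := (Submodule.ne_bot_iff (AddSubgroup.toIntSubmodule M)).1 (by simpa using hM)
  obtain ⟨b, hb⟩ : ∃ b, Lat M α i b := by
    cases i
    · exact ⟨0, M.zero_mem⟩
    · exact ⟨α, Lat.base⟩
  have hinj : Function.Injective fun n : ℕ => b + n * m := by
    intro a c h
    have h1 : ((a : F) - c) * m = 0 := by linear_combination h
    exact_mod_cast sub_eq_zero.1 ((mul_eq_zero.1 h1).resolve_right hm0)
  obtain ⟨n, hn⟩ := (Set.infinite_range_of_injective hinj).exists_notMem_finset S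
  obtain ⟨⟨k, rfl⟩, hk⟩ := hn
  refine ⟨_, ?_, hk⟩
  have h1 : Lat M α false (k * m) := by
    have := M.nsmul_mem hm k
    rwa [nsmul_eq_mul] at this
  have := hb.add h1
  rwa [Bool.xor_false] at this

namespace Frame

variable (f : Frame A)

lemma act_act {s : ZMod 2} {x y w p q : F} (hp : x + p = y) (hq : y + q = w) :
    opG A q (opG A p (f.v s x)) = (f.e (s + 1) y w * f.e s x y) • f.v s w := by
  rw [f.act hp, map_smul, f.act hq, smul_smul, mul_comm, add_one_add_one]

variable {f} {z : F}

/-- The anticommutator of `G_k` and `G_{-k}` on one weight vector, `k = y - x`. The parities are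
variables tied by equations so that the lemma also applies when they are spelled differently. -/
lemma anti_self (hz : opC A = z • 1) {s t t' : ZMod 2} {x y y' : F} (hx : f.v s x ≠ 0)
    (hy : Lat M α true (y - x)) (hyy : y + y' = 2 * x) (ht : s + 1 = t) (ht' : s + 1 = t') :
    f.e t y x * f.e s x y + f.e t' y' x * f.e s x y' =
      2 * x - 1 / 3 * ((y - x) ^ 2 - 1 / 4) * z := by
  subst ht ht'
  have hy' : Lat M α true (y' - x) := by
    have := hy.neg
    rwa [show -(y - x) = y' - x by linear_combination -hyy] at this
  have := LinearMap.congr_fun (opG_mul_opG (A := A) hy hy') (f.v s x)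
  have h0 : y - x + (y' - x) = 0 := by linear_combination hyy
  simp only [h0, if_true, LinearMap.add_apply, LinearMap.sub_apply, LinearMap.smul_apply,
    Module.End.mul_apply, hz, Module.End.one_apply, (mem_wt.1 (f.mem s x)).2] at this
  rw [f.act_act (y := y') (w := x) (by ring) (by linear_combination hyy),
    f.act_act (y := y) (w := x) (by ring) (by linear_combination hyy)] at this
  apply smul_left_injective F hx
  linear_combination (norm := module) this

/-- Both sides are twice the coefficient of the same `L_{w-x}`; comparing them avoids introducing
structure constants for even generators. -/
lemma anti_eq {s t t' t₂ t₂' : ZMod 2} {x y y' y₂ y₂' w : F} (hw : w ≠ x)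
    (hy : Lat M α true (y - x)) (hy' : Lat M α true (y' - x))
    (hy₂ : Lat M α true (y₂ - x)) (hy₂' : Lat M α true (y₂' - x)) (h : y + y' = x + w)
    (h₂ : y₂ + y₂' = x + w) (ht : s + 1 = t) (ht' : s + 1 = t') (ht₂ : s + 1 = t₂)
    (ht₂' : s + 1 = t₂') :
    f.e t y w * f.e s x y + f.e t' y' w * f.e s x y' =
      f.e t₂ y₂ w * f.e s x y₂ + f.e t₂' y₂' w * f.e s x y₂' := by
  subst ht ht' ht₂ ht₂'
  have e1 := LinearMap.congr_fun (opG_mul_opG (A := A) hy hy') (f.v s x)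
  have e2 := LinearMap.congr_fun (opG_mul_opG (A := A) hy₂ hy₂') (f.v s x)
  have h0 : y - x + (y' - x) = w - x := by linear_combination h
  have h0' : y₂ - x + (y₂' - x) = w - x := by linear_combination h₂
  simp only [h0, h0', sub_ne_zero.2 hw, if_false, LinearMap.add_apply, LinearMap.sub_apply,
    LinearMap.smul_apply, Module.End.mul_apply] at e1 e2
  rw [f.act_act (y := y') (w := w) (by ring) (by linear_combination h),
    f.act_act (y := y) (w := w) (by ring) (by linear_combination h)] at e1
  rw [f.act_act (y := y₂') (w := w) (by ring) (by linear_combination h₂),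
    f.act_act (y := y₂) (w := w) (by ring) (by linear_combination h₂)] at e2
  by_cases hv : f.v s w = 0
  · simp only [f.e_tgt (s := s + 1) _ (by rwa [add_one_add_one]), zero_mul]
  · apply smul_left_injective F hv
    linear_combination (norm := module) e1 - e2


lemma e_ne_zero {s t : ZMod 2} {x y : F} (h : f.e s x y ≠ 0) (ht : s + 1 = t) :
    f.v s x ≠ 0 ∧ f.v t y ≠ 0 := by
  subst ht
  exact ⟨fun h0 => h (f.e_src y h0), fun h0 => h (f.e_tgt x h0)⟩

lemma add_cast_of_odd (s : ZMod 2) {n m : ℤ} (h : Odd (m - n)) :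
    s + (n : ZMod 2) + 1 = s + (m : ZMod 2) := by
  obtain ⟨k, hk⟩ := h
  obtain rfl : m = n + (2 * k + 1) := by omega
  have h2 : (2 : ZMod 2) = 0 := by decide
  push_cast
  rw [h2]
  ring

lemma _root_.SVir.Lat.odd_mul {η : F} (h : Lat M α true η) {k : ℤ} (hk : Odd k) :
    Lat M α true (k * η) := by
  obtain ⟨j, rfl⟩ := hk
  have h2 := M.zsmul_mem h.two_mul j
  rw [zsmul_eq_mul] at h2
  have := Lat.add (i := false) h2 h
  rw [Bool.false_xor] at this
  convert this using 1
  push_cast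
  ring

/-- The structure constants along the string through `(s, x)` in the direction `η`. -/
def stringCoeff (f : Frame A) (s : ZMod 2) (x η : F) (m n : ℤ) : F :=
  f.e (s + m) (x + m * η) (x + n * η)

lemma stringCoeff_ne_zero {s : ZMod 2} {x η : F} {m n : ℤ} (h : f.stringCoeff s x η m n ≠ 0)
    (ho : Odd (n - m)) : f.v (s + m) (x + m * η) ≠ 0 ∧ f.v (s + n) (x + n * η) ≠ 0 :=
  e_ne_zero h (add_cast_of_odd s ho)

lemma stringCoeff_self (hz : opC A = z • 1) {s : ZMod 2} {x η : F} (hη : Lat M α true η)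
    {n m m' : ℤ} (hn : f.v (s + n) (x + n * η) ≠ 0) (hm : Odd (m - n)) (h : m + m' = 2 * n) :
    f.stringCoeff s x η m n * f.stringCoeff s x η n m +
      f.stringCoeff s x η m' n * f.stringCoeff s x η n m' =
      2 * (x + n * η) + -(1 / 3 * ((((m - n : ℤ) : F) * η) ^ 2 - 1 / 4) * z) := by
  have hm' : Odd (m' - n) := by
    have : m' - n = -(m - n) := by omega
    rw [this]
    exact hm.neg
  have hF : (m : F) + m' = 2 * n := by exact_mod_cast h
  have hd : x + m * η - (x + n * η) = ((m - n : ℤ) : F) * η := by push_cast; ring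
  rw [← sub_eq_add_neg, ← hd]
  refine anti_self hz hn ?_ ?_ (add_cast_of_odd s hm) (add_cast_of_odd s hm')
  · rw [hd]
    exact hη.odd_mul hm
  · linear_combination η * hF

lemma stringCoeff_eq {s : ZMod 2} {x η : F} (hη : Lat M α true η) (hη0 : η ≠ 0)
    {n w m m' k k' : ℤ} (hw : w ≠ n) (hm : Odd (m - n)) (hm' : Odd (m' - n)) (hk : Odd (k - n))
    (hk' : Odd (k' - n)) (h : m + m' = n + w) (h' : k + k' = n + w) :
    f.stringCoeff s x η m w * f.stringCoeff s x η n m +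
      f.stringCoeff s x η m' w * f.stringCoeff s x η n m' =
    f.stringCoeff s x η k w * f.stringCoeff s x η n k +
      f.stringCoeff s x η k' w * f.stringCoeff s x η n k' := by
  have hd : ∀ m : ℤ, x + m * η - (x + n * η) = ((m - n : ℤ) : F) * η := fun m => by
    push_cast; ring
  have hF : (m : F) + m' = n + w := by exact_mod_cast h
  have hF' : (k : F) + k' = n + w := by exact_mod_cast h'
  refine anti_eq ?_ ?_ ?_ ?_ ?_ ?_ ?_ (add_cast_of_odd s hm) (add_cast_of_odd s hm')
    (add_cast_of_odd s hk) (add_cast_of_odd s hk')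
  · rw [← sub_ne_zero, hd]
    exact mul_ne_zero (by exact_mod_cast sub_ne_zero.2 hw) hη0
  · rw [hd]; exact hη.odd_mul hm
  · rw [hd]; exact hη.odd_mul hm'
  · rw [hd]; exact hη.odd_mul hk
  · rw [hd]; exact hη.odd_mul hk'
  · linear_combination η * hF
  · linear_combination η * hF'

/-- `p` and `e` are the anticommutators in degrees `±η` and `±3η`. `k` holds because the
anticommutator of `G_{-3η}` and `G_η` equals `2 G_{-η}²`, and `y` is the same with signs reversed.
-/
lemma strand (hz : opC A = z • 1) (f : Frame A) (s : ZMod 2) (x : F) {η : F}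
    (hη : Lat M α true η) (hη0 : η ≠ 0) :
    Strand (fun n => f.v (s + n) (x + n * η) ≠ 0)
      (fun n => f.stringCoeff s x η (n + 1) n * f.stringCoeff s x η n (n + 1))
      (fun n => f.stringCoeff s x η (n + 3) n * f.stringCoeff s x η n (n + 3))
      (fun n => f.stringCoeff s x η (n + 3) n * f.stringCoeff s x η (n + 2) (n + 3) *
        f.stringCoeff s x η (n + 1) (n + 2) * f.stringCoeff s x η n (n + 1))
      (fun n => f.stringCoeff s x η (n + 1) n * f.stringCoeff s x η (n + 2) (n + 1) *
        f.stringCoeff s x η (n + 3) (n + 2) * f.stringCoeff s x η n (n + 3))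
      x η (-(1 / 3 * (η ^ 2 - 1 / 4) * z)) (-(1 / 3 * ((3 * η) ^ 2 - 1 / 4) * z)) where
  p {n} hn := by
    have := stringCoeff_self hz hη hn (m := n + 1) (m' := n - 1) (by ring_nf; decide) (by ring)
    rw [show n + 1 - n = 1 by ring, Int.cast_one, one_mul] at this
    rw [← this, show n - 1 + 1 = n by ring]
    ring
  e {n} hn := by
    have := stringCoeff_self hz hη hn (m := n + 3) (m' := n - 3) (by ring_nf; decide) (by ring)
    rw [show n + 3 - n = 3 by ring] at this
    push_cast at this
    rw [← this, show n - 3 + 3 = n by ring]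
    ring
  k n := by
    have := stringCoeff_eq (f := f) (s := s) (x := x) hη hη0 (n := n + 2) (w := n) (m := n + 3)
      (m' := n - 1) (k := n + 1) (k' := n + 1) (by omega) (by ring_nf; decide)
      (by ring_nf; decide) (by ring_nf; decide) (by ring_nf; decide) (by ring) (by ring)
    rw [show n - 1 + 1 = n by ring, show n - 1 + 2 = n + 1 by ring, show n - 1 + 3 = n + 2 by ring,
      show n + 1 + 1 = n + 2 by ring]
    linear_combination f.stringCoeff s x η (n + 1) (n + 2) * f.stringCoeff s x η n (n + 1) * this
  y n := by
    have := stringCoeff_eq (f := f) (s := s) (x := x) hη hη0 (n := n) (w := n + 2) (m := n + 3)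
      (m' := n - 1) (k := n + 1) (k' := n + 1) (by omega) (by ring_nf; decide)
      (by ring_nf; decide) (by ring_nf; decide) (by ring_nf; decide) (by ring) (by ring)
    rw [show n - 1 + 1 = n by ring, show n - 1 + 2 = n + 1 by ring, show n - 1 + 3 = n + 2 by ring,
      show n + 1 + 1 = n + 2 by ring]
    linear_combination f.stringCoeff s x η (n + 1) n * f.stringCoeff s x η (n + 2) (n + 1) * this
  ky n := by
    rw [show n + 1 + 1 = n + 2 by ring, show n + 2 + 1 = n + 3 by ring]
    ring
  supp_p {n} hn := stringCoeff_ne_zero (right_ne_zero_of_mul hn) (by ring_nf; decide)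
  supp_e {n} hn := stringCoeff_ne_zero (right_ne_zero_of_mul hn) (by ring_nf; decide)
  supp_k {n} hn := by
    have h1 := stringCoeff_ne_zero (right_ne_zero_of_mul hn) (by ring_nf; decide)
    have h2 := stringCoeff_ne_zero (right_ne_zero_of_mul (left_ne_zero_of_mul
      (left_ne_zero_of_mul hn))) (by ring_nf; decide)
    exact ⟨h1.1, h1.2, h2.1, h2.2⟩
  supp_y {n} hn := by
    have h1 := stringCoeff_ne_zero (right_ne_zero_of_mul hn) (by ring_nf; decide)
    have h2 := stringCoeff_ne_zero (right_ne_zero_of_mul (left_ne_zero_of_mul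
      (left_ne_zero_of_mul hn))) (by ring_nf; decide)
    exact ⟨h1.1, h2.2, h2.1, h1.2⟩

/-- The two weights are consecutive on a string, hence half of the string is full. `const_eq`
equates the central terms for `η` and `3η`, which differ by a nonzero multiple of `z`. -/
lemma central_charge_eq_zero (hz : opC A = z • 1) {s : ZMod 2} {x y : F} (hx : f.v s x ≠ 0)
    (hy : f.v (s + 1) y ≠ 0) (hxy : Lat M α true (y - x)) (hne : y ≠ x) : z = 0 := by
  have hη0 := sub_ne_zero.2 hne
  have h := f.strand hz s x hxy hη0
  have key : -(1 / 3 * ((3 * (y - x)) ^ 2 - 1 / 4) * z) = -(1 / 3 * ((y - x) ^ 2 - 1 / 4) * z) := by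
    rcases h.half_of_pair hη0 (n := 0) (by simpa using hx) (by simpa using hy) with h' | h'
    · exact h.const_eq hη0 h'
    · exact h.reflect.const_eq (neg_ne_zero.2 hη0) fun n hn => h' _ (by omega)
  have : (8 / 3 * (y - x) ^ 2) * z = 0 := by linear_combination -key
  exact (mul_eq_zero.1 this).resolve_left (mul_ne_zero (by norm_num) (pow_ne_zero 2 hη0))

lemma strand_zero (hC : opC A = 0) (f : Frame A) (s : ZMod 2) (x : F) {η : F}
    (hη : Lat M α true η) (hη0 : η ≠ 0) :
    Strand (fun n => f.v (s + n) (x + n * η) ≠ 0)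
      (fun n => f.stringCoeff s x η (n + 1) n * f.stringCoeff s x η n (n + 1))
      (fun n => f.stringCoeff s x η (n + 3) n * f.stringCoeff s x η n (n + 3))
      (fun n => f.stringCoeff s x η (n + 3) n * f.stringCoeff s x η (n + 2) (n + 3) *
        f.stringCoeff s x η (n + 1) (n + 2) * f.stringCoeff s x η n (n + 1))
      (fun n => f.stringCoeff s x η (n + 1) n * f.stringCoeff s x η (n + 2) (n + 1) *
        f.stringCoeff s x η (n + 3) (n + 2) * f.stringCoeff s x η n (n + 3))
      x η 0 0 := by
  simpa using strand (z := 0) (by rw [hC, zero_smul]) f s x hη hη0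

/-- Along the string in direction `k` only the weight zero can be missing. -/
lemma supp_step (hC : opC A = 0) {s : ZMod 2} {x k : F} (hx : f.v s x ≠ 0) (hx0 : x ≠ 0)
    (hk : Lat M α true k) (hk0 : k ≠ 0) (hxk : x + k ≠ 0) : f.v (s + 1) (x + k) ≠ 0 := by
  have := (f.strand_zero hC s x hk hk0).full hk0 (n₀ := 0) (by simpa using hx) (by simpa using hx0)
    1
  simpa [hxk] using this

/-- If one non-zero weight occurs, all non-zero weights of the coset occur. -/
lemma supp_of_ne_zero (hM : M ≠ ⊥) (hC : opC A = 0) {s₀ s : ZMod 2} {x r : F}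
    (hx : f.v s₀ x ≠ 0) (hx0 : x ≠ 0) (h : On M α s₀ x s r) (hr : r ≠ 0) : f.v s r ≠ 0 := by
  classical
  have hsame : ∀ {r}, Lat M α false (r - x) → r ≠ 0 → f.v s₀ r ≠ 0 := by
    intro r hr hr0
    -- The three exclusions keep the first step, the second step and the intermediate weight
    -- nonzero.
    obtain ⟨η, hη, hηS⟩ := exists_lat_notMem (α := α) hM true {0, r - x, -x}
    simp only [Finset.mem_insert, Finset.mem_singleton, not_or] at hηS
    have hxη : x + η ≠ 0 := fun h => hηS.2.2 (by linear_combination h)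
    have h1 := supp_step hC hx hx0 hη hηS.1 hxη
    have h2 := supp_step hC h1 hxη (k := r - x - η) (hr.sub hη)
      (sub_ne_zero.2 (Ne.symm hηS.2.1)) (by ring_nf; exact hr0)
    rw [add_one_add_one] at h2
    convert h2 using 2
    ring
  rcases h with ⟨rfl, h⟩ | ⟨rfl, h⟩
  · exact hsame h hr
  -- The direct odd step `r - x` may be zero, so an even detour through `x + m` comes first.
  · obtain ⟨m, hm, hmS⟩ := exists_lat_notMem (α := α) hM false {-x, r - x}
    simp only [Finset.mem_insert, Finset.mem_singleton, not_or] at hmS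
    have hxm : x + m ≠ 0 := fun h => hmS.1 (by linear_combination h)
    have h1 := hsame (r := x + m) (by rwa [add_sub_cancel_left]) hxm
    have h2 := supp_step hC h1 hxm (k := r - x - m) (h.sub hm)
      (sub_ne_zero.2 (Ne.symm hmS.2)) (by ring_nf; exact hr)
    convert h2 using 2
    ring

/-- On a vector of weight `x`, `comK (-k) k` is `2 G_{-k} G_k - 2x`. The relation for `k = η` and `k
= 3η` is thus exactly `Strand.triple`, applicable because every string misses at most weight zero.
-/
lemma omega_of_supp (hA : IsIntermediateSeries A) (hM : M ≠ ⊥) (hC : opC A = 0) {s₀ : ZMod 2}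
    {x₀ : F} (hx : f.v s₀ x₀ ≠ 0) (hx0 : x₀ ≠ 0) {η : F} (hη : Lat M α true η) (hη0 : η ≠ 0) :
    comK (opG A) (-(3 * η)) (3 * η) = (3 : F) • comK (opG A) (-η) η := by
  refine linearMap_eq_of_wt hA fun s x y hy => ?_
  obtain ⟨c, rfl⟩ := f.span hy
  rw [map_smul, map_smul]
  congr 1
  by_cases hv : f.v s x = 0
  · rw [hv, map_zero, map_zero]
  have hon := on_of_wt_ne_zero hA (f.mem s₀ x₀) hx (f.mem s x) hv
  have hstr := f.strand_zero hC s x hη hη0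
  have honstep : ∀ n : ℤ, On M α s₀ x₀ (s + n) (x + n * η) := by
    intro n
    induction n with
    | zero => simpa using hon
    | succ n ih =>
      have := ih.step hη
      push_cast at this ⊢
      convert this using 1
      · ring
      · ring
    | pred n ih =>
      have := ih.step hη.neg
      have h2 : (1 : ZMod 2) = -1 := by decide
      push_cast at this ⊢
      rw [sub_eq_add_neg, ← h2]
      convert this using 1
      · ring
      · ring
  have ht := hstr.triple hη0 (by simpa using hv) fun n => by
    by_cases h : x + n * η = 0
    · exact Or.inr h
    · exact Or.inl (supp_of_ne_zero hM hC hx hx0 (honstep n) h)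
  have h1 := LinearMap.congr_fun (opG_mul_opG (A := A) hη.neg hη) (f.v s x)
  have h3 := LinearMap.congr_fun (opG_mul_opG (A := A) hη.three_mul.neg hη.three_mul) (f.v s x)
  simp only [neg_add_cancel, if_true, hC, smul_zero, sub_zero, LinearMap.add_apply,
    LinearMap.smul_apply, Module.End.mul_apply, (mem_wt.1 (f.mem s x)).2] at h1 h3
  have g1 := f.act_act (s := s) (x := x) (y := x + η) (w := x) (p := η) (q := -η) rfl (by ring)
  have g3 := f.act_act (s := s) (x := x) (y := x + 3 * η) (w := x) (p := 3 * η) (q := -(3 * η))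
    rfl (by ring)
  have h3' : ((3 : ℤ) : ZMod 2) = 1 := by decide
  simp only [stringCoeff, Int.cast_zero, Int.cast_one, zero_mul, zero_add, add_zero, one_mul,
    h3', Int.cast_ofNat] at ht
  rw [ht] at g3
  simp only [comK, LinearMap.sub_apply, LinearMap.smul_apply, Module.End.mul_apply]
  linear_combination (norm := module) (2 : F) • g3 - h3 - (6 : F) • g1 + (3 : F) • h1

end Frame
end Frames

/-! ### Surjections from the standard modules. -/

section Quotients

variable {F : Type*} [Field F] [CharZero F] {M : AddSubgroup F} {α : F}
  [hα : Fact (2 * α ∈ M)] {V : Type*} [AddCommGroup V] [Module F V]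
  {W : Type*} [AddCommGroup W] [Module F W]

/-- A linear map which commutes with the odd generators and the central element commutes with the
algebra. -/
lemma map_act_of_gens {A : SuperModule (algebra hα.out) V} {B : SuperModule (algebra hα.out) W}
    {φ : W →ₗ[F] V} (hG : ∀ k, Lat M α true k → ∀ w, φ (opG B k w) = opG A k (φ w))
    (hC : ∀ w, φ (opC B w) = opC A (φ w)) (x : Space M α) (w : W) :
    φ (B.act x w) = A.act x (φ w) := by
  induction x using Finsupp.induction_linear with
  | zero => simp
  | add x y hx hy => simp only [map_add, LinearMap.add_apply, hx, hy]
  | single g r =>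
    rw [act_single (A := A), act_single (A := B), map_smul]
    congr 1
    rcases g with ⟨l, hl⟩ | ⟨k, hk⟩ | _
    · have hb : Lat M α true α := Lat.base
      have hl' : Lat M α true (l - α) := Lat.sub (i := false) hl hb
      have e1 := congrArg φ (LinearMap.congr_fun (opG_mul_opG (A := B) hb hl') w)
      have e2 := LinearMap.congr_fun (opG_mul_opG (A := A) hb hl') (φ w)
      rw [add_sub_cancel] at e1 e2
      rw [← opL_of_mem (A := A) hl, ← opL_of_mem (A := B) hl]
      simp only [LinearMap.add_apply, LinearMap.sub_apply, LinearMap.smul_apply, map_add, map_sub,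
        map_smul, Module.End.mul_apply, hG _ hb, hG _ hl', hC] at e1 e2
      linear_combination (norm := module) (1 / 2 : F) • e2 - (1 / 2 : F) • e1
    · rw [← opG_of_mem (A := A) hk, ← opG_of_mem (A := B) hk]
      exact hG k hk w
    · exact hC w

/-- The whole module as a graded submodule. -/
def topSubmodule (B : SuperModule (algebra hα.out) W) : B.GradedSubmodule where
  carrier := ⊤
  act_mem _ _ _ := trivial
  graded _ _ _ _ _ := ⟨trivial, trivial⟩

lemma comp_add_one {A : SuperModule (algebra hα.out) V} {s : ZMod 2} {x y : V}
    (hx : x ∈ A.comp s) (hy : y ∈ A.comp (s + 1)) (h : x + y = 0) : x = 0 ∧ y = 0 := by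
  have hx0 : x = 0 := by
    refine Submodule.disjoint_def.1 (disjoint_comp (A := A) s) x hx ?_
    rw [add_eq_zero_iff_eq_neg.1 h]
    exact Submodule.neg_mem _ hy
  exact ⟨hx0, by rwa [hx0, zero_add] at h⟩

/-- The kernel of a homogeneous homomorphism, as a graded submodule. -/
noncomputable def kerSubmodule {A : SuperModule (algebra hα.out) V}
    {B : SuperModule (algebra hα.out) W} (φ : W →ₗ[F] V) (s : ZMod 2)
    (hφ : ∀ i, ∀ w ∈ B.comp i, φ w ∈ A.comp (i + s))
    (hact : ∀ x w, φ (B.act x w) = A.act x (φ w)) :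
    (B.sub (topSubmodule B)).GradedSubmodule where
  carrier := LinearMap.ker (φ ∘ₗ (topSubmodule B).carrier.subtype)
  act_mem x v hv := by
    rw [LinearMap.mem_ker] at hv ⊢
    change φ (B.act x v.1) = 0
    have hv' : φ v.1 = 0 := hv
    rw [hact, hv', map_zero]
  graded x hx y hy hxy := by
    have h0 : φ x.1 + φ y.1 = 0 := by
      rw [← map_add]
      exact hxy
    have h1 := hφ 0 x.1 hx
    have h2 := hφ 1 y.1 hy
    rw [show (1 : ZMod 2) + s = 0 + s + 1 by ring] at h2
    exact comp_add_one h1 h2 h0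

/-- A nonzero homomorphic image is a nonzero subquotient. -/
lemma isNonzeroSubquotient_of_surjective [Nontrivial V] {A : SuperModule (algebra hα.out) V}
    {B : SuperModule (algebra hα.out) W} (φ : W →ₗ[F] V) (s : ZMod 2)
    (hφ : ∀ i, ∀ w ∈ B.comp i, φ w ∈ A.comp (i + s))
    (hact : ∀ x w, φ (B.act x w) = A.act x (φ w)) (hsurj : Function.Surjective φ) :
    A.IsNonzeroSubquotient B := by
  have hs : Function.Surjective (φ ∘ₗ (topSubmodule B).carrier.subtype) := fun v => by
    obtain ⟨w, rfl⟩ := hsurj v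
    exact ⟨⟨w, trivial⟩, rfl⟩
  obtain ⟨E, hE⟩ : ∃ E : (_ ⧸ (kerSubmodule φ s hφ hact).carrier) ≃ₗ[F] V,
      ∀ w, E (Submodule.Quotient.mk w) = φ w.1 :=
    ⟨LinearMap.quotKerEquivOfSurjective _ hs, fun _ => rfl⟩
  refine ⟨topSubmodule B, kerSubmodule φ s hφ hact, fun htop => ?_, s, E.symm,
    fun i v hv => ?_, fun x v => ?_⟩
  · obtain ⟨v, hv⟩ := exists_ne (0 : V)
    obtain ⟨w, rfl⟩ := hs v
    have : w ∈ (kerSubmodule φ s hφ hact).carrier := by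
      rw [htop]
      trivial
    exact hv this
  · obtain ⟨w, rfl⟩ := hsurj v
    -- A preimage of a homogeneous vector need not be homogeneous; its component of the wrong parity
    -- maps to zero and is dropped.
    obtain ⟨w₀, h₀, w₁, h₁, rfl⟩ := exists_add_mem_comp (A := B) (i + s) w
    have e0 := hφ _ _ h₀
    have e1 := hφ _ _ h₁
    have h2 : s + s = 0 := CharTwo.add_self_eq_zero s
    rw [add_assoc, h2, add_zero] at e0
    rw [add_right_comm, add_assoc i, h2, add_zero] at e1
    have e2 : φ w₁ = 0 := by
      refine Submodule.disjoint_def.1 (disjoint_comp (A := A) i) _ ?_ e1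
      rw [map_add] at hv
      have := Submodule.sub_mem _ hv e0
      rwa [add_sub_cancel_left] at this
    have e3 : E.symm (φ (w₀ + w₁)) = Submodule.Quotient.mk ⟨w₀, trivial⟩ := by
      rw [LinearEquiv.symm_apply_eq, hE, map_add, e2, add_zero]
    rw [e3]
    exact ⟨⟨w₀, trivial⟩, h₀, rfl⟩
  · obtain ⟨w, rfl⟩ := hsurj v
    have e (w : W) : E.symm (φ w) = Submodule.Quotient.mk ⟨w, trivial⟩ := by
      rw [LinearEquiv.symm_apply_eq, hE]
    rw [← hact, e, e]
    rfl

/-- A module spanned by homogeneous vectors on which the odd generators act as on the basis of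
`ofBasis` is a nonzero subquotient of the latter. -/
lemma isNonzeroSubquotient_ofBasis [Nontrivial V] {A : SuperModule (algebra hα.out) V}
    {X : Type*} {p : X → ZMod 2} {f : Gen M α → X → (X →₀ F)}
    {hp : ∀ g x, f g x ∈ parityPart p (g.parity + p x)}
    {hf : ∀ g h x, extend f (genBracket hα.out g h) (Finsupp.single x 1) =
      extend f (Finsupp.single g 1) (f h x) - (-1 : F) ^ (g.parity.val * h.parity.val) •
        extend f (Finsupp.single h 1) (f g x)} (hfc : ∀ x, f .c x = 0) (hC : opC A = 0)
    (s : ZMod 2) (u : X → V) (hu : ∀ x, u x ∈ A.comp (p x + s))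
    (hspan : Submodule.span F (Set.range u) = ⊤)
    (hG : ∀ k (hk : Lat M α true k) x,
      opG A k (u x) = Finsupp.linearCombination F u (f (.G ⟨k, hk⟩) x)) :
    A.IsNonzeroSubquotient (ofBasis hα.out p f hp hf) := by
  refine isNonzeroSubquotient_of_surjective (Finsupp.linearCombination F u) s ?_
    (map_act_of_gens ?_ ?_) ?_
  · intro i w hw
    refine parityPart_induction (P := fun w => Finsupp.linearCombination F u w ∈ A.comp (i + s))
      (by simp) (fun a b ha hb => by rw [map_add]; exact Submodule.add_mem _ ha hb)
      (fun r a ha => by rw [map_smul]; exact Submodule.smul_mem _ r ha) (fun x hx => ?_) hw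
    rw [Finsupp.linearCombination_single, one_smul, ← hx]
    exact hu x
  · intro k hk w
    rw [opG_of_mem (A := ofBasis hα.out p f hp hf) hk]
    change Finsupp.linearCombination F u (extend f _ w) = _
    induction w using Finsupp.induction_linear with
    | zero => simp
    | add a b ha hb => simp only [map_add, ha, hb]
    | single x r =>
      rw [extend_single, one_mul, map_smul, Finsupp.linearCombination_single, map_smul, hG k hk x]
  · intro w
    rw [hC]
    change Finsupp.linearCombination F u (extend f _ w) = 0
    induction w using Finsupp.induction_linear with
    | zero => simp
    | add a b ha hb => simp only [map_add, ha, hb, add_zero]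
    | single x r => rw [extend_single, hfc, smul_zero, map_zero]
  · rw [← LinearMap.range_eq_top, Finsupp.range_linearCombination, hspan]

end Quotients

/-! ### From additive to linear: the slopes of the structure constants. -/

section Scalars

variable {F : Type*} [Field F] [CharZero F] {M : AddSubgroup F} {α : F}
  [hα : Fact (2 * α ∈ M)] {V : Type*} [AddCommGroup V] [Module F V]

/-- The situation in which the central element acts by zero and all non-zero weights of a coset
occur. -/
structure Frame.Full {A : SuperModule (algebra hα.out) V} (f : Frame A) (s₀ : ZMod 2) (r₀ : F) :
    Prop where
  ne_bot : M ≠ ⊥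
  series : IsIntermediateSeries A
  opC_eq : opC A = 0
  on : ∀ {s r}, f.v s r ≠ 0 → On M α s₀ r₀ s r
  supp : ∀ {s r}, On M α s₀ r₀ s r → r ≠ 0 → f.v s r ≠ 0
  base : f.v s₀ r₀ ≠ 0
  base_ne : r₀ ≠ 0
  omega : ∀ {η}, Lat M α true η → η ≠ 0 →
    comK (opG A) (-(3 * η)) (3 * η) = (3 : F) • comK (opG A) (-η) η

/-- Functions which are additive on `M`. -/
def AddOn (M : AddSubgroup F) (φ : F → F) : Prop :=
  ∀ {m n}, m ∈ M → n ∈ M → φ (m + n) = φ m + φ n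

lemma AddOn.zero {φ : F → F} (h : AddOn M φ) : φ 0 = 0 := by
  have := h M.zero_mem M.zero_mem
  rwa [add_zero, left_eq_add] at this

lemma AddOn.neg {φ : F → F} (h : AddOn M φ) {m : F} (hm : m ∈ M) : φ (-m) = -φ m := by
  have := h hm (M.neg_mem hm)
  rw [add_neg_cancel, h.zero] at this
  linear_combination -this

lemma AddOn.two {φ : F → F} (h : AddOn M φ) {m : F} (hm : m ∈ M) : φ (2 * m) = 2 * φ m := by
  rw [two_mul, h hm hm, two_mul]

/-- The structure constants between two weights `x` and `x'` of the same parity, when the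
difference lies in `2 (α + M)`. -/
lemma transition_dichotomy {x x' τ l l' : F} {δ δ' γ γ' : F → F} (hτM : τ ∈ M)
    (hx : x' = x + τ) (hδ : AddOn M δ) (hδ' : AddOn M δ') (hγ : AddOn M γ) (hγ' : AddOn M γ')
    (hd : δ' τ = δ τ)
    (h1 : ∀ m ∈ M, τ * γ m = l * (δ' m - δ m) + m * γ τ)
    (h2 : ∀ m ∈ M, τ * γ' m = l' * (δ' m - δ m) + m * γ' τ)
    (hmain : ∀ m ∈ M, (l + γ (2 * m) / 4) * (l' + γ' (2 * m) / 4) =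
      (x + δ τ / 4 + δ (2 * m) / 4) * (x' - δ τ / 4 + δ' (2 * m) / 4)) :
    δ τ = 0 ∨ δ τ = 4 * τ ∨ ∀ m ∈ M, τ * δ m = m * δ τ := by
  by_cases hd0 : δ τ = 0
  · exact Or.inl hd0
  by_cases hd4 : δ τ = 4 * τ
  · exact Or.inr (Or.inl hd4)
  refine Or.inr (Or.inr fun m hm => ?_)
  have e0 := hmain 0 M.zero_mem
  rw [mul_zero, hγ.zero, hγ'.zero, hδ.zero, hδ'.zero] at e0
  have hm2 := M.add_mem hm hm
  rw [← two_mul] at hm2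
  have aux : ∀ {φ : F → F}, AddOn M φ → φ (2 * (m + τ)) = 2 * φ m + 2 * φ τ ∧
      φ (2 * (m - τ)) = 2 * φ m - 2 * φ τ ∧ φ (2 * -m) = -(2 * φ m) ∧ φ (2 * m) = 2 * φ m ∧
      φ (2 * (-m + τ)) = -(2 * φ m) + 2 * φ τ ∧ φ (2 * τ) = 2 * φ τ ∧ φ (2 * -τ) = -(2 * φ τ)  := by
    intro φ h
    have hn := M.neg_mem hm
    have hnτ := M.neg_mem hτM
    refine ⟨?_, ?_, ?_, h.two hm, ?_, h.two hτM, ?_⟩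
    · rw [h.two (M.add_mem hm hτM), h hm hτM]; ring
    · rw [h.two (M.sub_mem hm hτM), sub_eq_add_neg, h hm hnτ, h.neg hτM]; ring
    · rw [h.two hn, h.neg hm]; ring
    · rw [h.two (M.add_mem hn hτM), h hn hτM, h.neg hm]; ring
    · rw [h.two hnτ, h.neg hτM]; ring
  obtain ⟨a1, a2, a3, a4, a5, a6, a7⟩ := aux hδ
  obtain ⟨b1, b2, b3, b4, b5, b6, b7⟩ := aux hδ'
  obtain ⟨c1, c2, c3, c4, c5, c6, c7⟩ := aux hγ
  obtain ⟨d1, d2, d3, d4, d5, d6, d7⟩ := aux hγ'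
  -- Both sides of `hmain` are quadratic in an additive argument. The values at `0`, `±m`, `±τ` and
  -- `±m + τ` separate its constant, linear and bilinear parts.
  have p1 := hmain m hm
  have p2 := hmain (-m) (M.neg_mem hm)
  have p3 := hmain (m + τ) (M.add_mem hm hτM)
  have p4 := hmain (-m + τ) (M.add_mem (M.neg_mem hm) hτM)
  have p5 := hmain τ hτM
  have p6 := hmain (-τ) (M.neg_mem hτM)
  rw [a4, b4, c4, d4] at p1
  rw [a3, b3, c3, d3] at p2
  rw [a1, b1, c1, d1, hd] at p3
  rw [a5, b5, c5, d5, hd] at p4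
  rw [a6, b6, c6, d6, hd] at p5
  rw [a7, b7, c7, d7, hd] at p6
  have q1 := h1 m hm
  have q2 := h2 m hm
  subst hx
  have gg : γ τ * γ' τ = δ τ ^ 2 := by linear_combination 2 * p5 + 2 * p6 - 4 * e0
  have lg : l * γ' τ + l' * γ τ = δ τ * (2 * x + τ) := by linear_combination p5 - p6
  have mm : γ m * γ' m = δ m * δ' m := by linear_combination 2 * p1 + 2 * p2 - 4 * e0
  have mg : γ m * γ' τ + γ' m * γ τ = δ τ * (δ m + δ' m) := by
    linear_combination 2 * p3 - 2 * p4 - 2 * p1 + 2 * p2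
  have k1 : δ τ * (2 * (x * (δ' m - δ m) + m * δ τ - τ * δ m)) = 0 := by
    linear_combination τ * mg - γ' τ * q1 - γ τ * q2 - (δ' m - δ m) * lg - 2 * m * gg
  have k2 := (mul_eq_zero.1 k1).resolve_left hd0
  have k3 : x * (δ' m - δ m) + m * δ τ - τ * δ m = 0 :=
    (mul_eq_zero.1 k2).resolve_left two_ne_zero
  -- Eliminating `γ`, `γ'`, `l` and `l'` leaves a multiple of a square; the two values of `δ τ`
  -- excluded above are the zeros of its coefficient.
  have k4 : (δ τ * (4 * τ - δ τ)) * (δ' m - δ m) ^ 2 = 0 := by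
    linear_combination 16 * (-(δ' m - δ m) ^ 2 * e0 + τ ^ 2 * mm - τ * γ' m * q1 -
      (l * (δ' m - δ m) + m * γ τ) * q2 - m * (δ' m - δ m) * lg - m ^ 2 * gg -
      (x * (δ' m - δ m) + m * δ τ + τ * δ m + τ * (δ' m - δ m)) * k3)
  have k5 : δ' m - δ m = 0 := by
    have := (mul_eq_zero.1 k4).resolve_left
      (mul_ne_zero hd0 (sub_ne_zero.2 (Ne.symm hd4)))
    exact pow_eq_zero_iff two_ne_zero |>.1 this
  rw [k5] at k3
  linear_combination -k3


namespace Frame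

variable {A : SuperModule (algebra hα.out) V} {f : Frame A} {s₀ s : ZMod 2} {r₀ x x' : F}

/-- The operators `Gam` of degree `x' - x` act on `v s x` by the scalars `γ`. -/
def IsGam (f : Frame A) (s : ZMod 2) (x x' : F) (γ : F → F) : Prop :=
  ∀ m ∈ M, Rep.Gam (opG A) α (x' - x) m (f.v s x) = γ m • f.v s x'

lemma Full.rep (h : f.Full s₀ r₀) : Rep M α (opG A) (opL A) := rep_of_opC_eq_zero h.opC_eq

lemma Full.exists_omega (h : f.Full s₀ r₀) : ∃ η, Lat M α true η ∧ η ≠ 0 ∧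
    comK (opG A) (-(3 * η)) (3 * η) = (3 : F) • comK (opG A) (-η) η := by
  obtain ⟨η, hη, h0⟩ := exists_lat_notMem (α := α) h.ne_bot true {0}
  rw [Finset.mem_singleton] at h0
  exact ⟨η, hη, h0, h.omega hη h0⟩

lemma opG_opG_mem_wt {v : V} (hv : v ∈ wt A s x) {p q : F} (h : x + p + q = x') :
    opG A q (opG A p v) ∈ wt A s x' := by
  have := opG_mem_wt (opG_mem_wt hv (k := p) rfl) (k := q) h
  rwa [add_one_add_one] at this

lemma exists_isGam (f : Frame A) (s : ZMod 2) (x x' : F) : ∃ γ, f.IsGam s x x' γ := by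
  have : ∀ m, ∃ c : F, Rep.Gam (opG A) α (x' - x) m (f.v s x) = c • f.v s x' := by
    intro m
    refine f.span ?_
    simp only [Rep.Gam, comK, LinearMap.sub_apply, Module.End.mul_apply]
    refine Submodule.sub_mem _ (Submodule.sub_mem _ ?_ ?_) (Submodule.sub_mem _ ?_ ?_) <;>
    exact opG_opG_mem_wt (f.mem s x) (by ring)
  choose γ hγ using this
  exact ⟨γ, fun m _ => hγ m⟩

lemma Full.addOn (h : f.Full s₀ r₀) {γ : F → F} (hγ : f.IsGam s x x' γ)
    (ht : Lat M α false (x' - x)) (hx' : f.v s x' ≠ 0) : AddOn M γ := by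
  intro m n hm hn
  obtain ⟨η, hη, h0, hΩ⟩ := h.exists_omega
  have := LinearMap.congr_fun (h.rep.Gam_add hη h0 ht hm hn hΩ) (f.v s x)
  rw [LinearMap.add_apply, hγ m hm, hγ n hn, hγ _ (M.add_mem hm hn), ← add_smul] at this
  exact smul_left_injective F hx' this

lemma exists_opL (f : Frame A) (s : ZMod 2) (x x' : F) :
    ∃ l : F, opL A (x' - x) (f.v s x) = l • f.v s x' :=
  f.span (opL_mem_wt (f.mem s x) (by ring))

lemma Full.e_mul_e (h : f.Full s₀ r₀) {γ : F → F} {l y : F} (hγ : f.IsGam s x x' γ)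
    (hl : opL A (x' - x) (f.v s x) = l • f.v s x') (hx' : f.v s x' ≠ 0)
    (ht : Lat M α false (x' - x)) (hy : Lat M α true (y - x)) :
    f.e (s + 1) y x' * f.e s x y = l + γ (2 * (y - x) - (x' - x)) / 4 := by
  obtain ⟨η, hη, h0, hΩ⟩ := h.exists_omega
  have hy' : Lat M α true (x' - y) := by
    have := ht.sub hy
    rwa [sub_sub_sub_cancel_right] at this
  have := LinearMap.congr_fun (h.rep.mul_eq_Gam hη h0 hy' hy (t := x' - x)
    (m := 2 * (y - x) - (x' - x)) (by ring) (by ring) hΩ) (f.v s x)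
  rw [Module.End.mul_apply, f.act_act (y := y) (w := x') (by ring) (by ring),
    LinearMap.add_apply, LinearMap.smul_apply, hl, hγ _ (hy.two_mul.sub ht)] at this
  apply smul_left_injective F hx'
  linear_combination (norm := module) this

lemma Full.e_mul_e_self (h : f.Full s₀ r₀) {δ : F → F} {y : F} (hδ : f.IsGam s x x δ)
    (hx : f.v s x ≠ 0) (hy : Lat M α true (y - x)) :
    f.e (s + 1) y x * f.e s x y = x + δ (2 * (y - x)) / 4 := by
  have := h.e_mul_e hδ (l := x) (by rw [sub_self, (mem_wt.1 (f.mem s x)).2]) hx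
    (by rw [sub_self]; exact M.zero_mem) hy
  rwa [sub_self, sub_zero] at this

lemma Full.gam_comm (h : f.Full s₀ r₀) {δ δ' γ : F → F} {l m : F} (hδ : f.IsGam s x x δ)
    (hδ' : f.IsGam s x' x' δ') (hγ : f.IsGam s x x' γ)
    (hl : opL A (x' - x) (f.v s x) = l • f.v s x') (hx' : f.v s x' ≠ 0)
    (ht : Lat M α false (x' - x)) (hm : m ∈ M) :
    (x' - x) * γ m = l * (δ' m - δ m) + m * γ (x' - x) := by
  obtain ⟨η, hη, h0, hΩ⟩ := h.exists_omega
  have := LinearMap.congr_fun (h.rep.lie_L_Gam hη h0 ht hm hΩ) (f.v s x)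
  have e1 := hδ m hm
  have e2 := hδ' m hm
  rw [sub_self] at e1 e2
  simp only [LinearMap.sub_apply, LinearMap.smul_apply, Module.End.mul_apply, hl, map_smul, e1, e2,
    hγ m hm, hγ _ ht] at this
  apply smul_left_injective F hx'
  linear_combination (norm := module) this

/-- At the midpoint `x + η` the anticommutator of `G_η` and `G_{-η}` is the sum of the return
products from `x` and from `x'`. If the midpoint vector is missing, its weight is zero and both
products vanish. -/
lemma Full.double_step (h : f.Full s₀ r₀) {δ δ' : F → F} {η : F} (hδ : f.IsGam s x x δ)
    (hδ' : f.IsGam s x' x' δ') (hη : Lat M α true η) (hxx : x' = x + 2 * η)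
    (hx : f.v s x ≠ 0) (hx' : f.v s x' ≠ 0) : δ' (2 * η) = δ (2 * η) := by
  have hδa : AddOn M δ' := h.addOn hδ' (by rw [sub_self]; exact M.zero_mem) hx'
  have e1 := h.e_mul_e_self (y := x + η) hδ hx (by rwa [add_sub_cancel_left])
  have e2 := h.e_mul_e_self (y := x + η) hδ' hx' (by
    rw [hxx]
    convert hη.neg using 1
    ring)
  rw [show 2 * (x + η - x') = -(2 * η) by rw [hxx]; ring, hδa.neg hη.two_mul] at e2
  rw [add_sub_cancel_left] at e1
  by_cases hy : f.v (s + 1) (x + η) = 0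
  · rw [f.e_tgt _ hy, mul_zero] at e1 e2
    have hy0 : x + η = 0 := by
      by_contra hy0
      exact h.supp ((h.on hx).step hη) hy0 hy
    linear_combination 4 * e1 + 4 * e2 + 8 * hy0 + 4 * hxx
  · have := anti_self (z := 0) (by rw [h.opC_eq, zero_smul]) hy (y := x) (y' := x')
      (by convert hη.neg using 1; ring) (by rw [hxx]; ring) (add_one_add_one s) (add_one_add_one s)
    linear_combination -4 * this + 4 * e1 + 4 * e2 + 4 * hxx

/-- The four edges between `x`, `x + 2η` and an intermediate weight `x + η + m` can be grouped into
two transitions or into two returns. Equality of the two groupings is the hypothesis `hmain` of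
`transition_dichotomy`. -/
lemma Full.delta_cases (h : f.Full s₀ r₀) {δ : F → F} {η : F} (hδ : f.IsGam s x x δ)
    (hη : Lat M α true η) (hx : f.v s x ≠ 0) (hx' : f.v s (x + 2 * η) ≠ 0) :
    δ (2 * η) = 0 ∨ δ (2 * η) = 4 * (2 * η) ∨ ∀ m ∈ M, 2 * η * δ m = m * δ (2 * η) := by
  have hτ := hη.two_mul
  obtain ⟨δ', hδ'⟩ := f.exists_isGam s (x + 2 * η) (x + 2 * η)
  obtain ⟨γ, hγ⟩ := f.exists_isGam s x (x + 2 * η)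
  obtain ⟨γ', hγ'⟩ := f.exists_isGam s (x + 2 * η) x
  obtain ⟨l, hl⟩ := f.exists_opL s x (x + 2 * η)
  obtain ⟨l', hl'⟩ := f.exists_opL s (x + 2 * η) x
  have t1 : x + 2 * η - x = 2 * η := by ring
  have t2 : x - (x + 2 * η) = -(2 * η) := by ring
  have h0 : Lat M α false (x - x) := by rw [sub_self]; exact M.zero_mem
  have h0' : Lat M α false (x + 2 * η - (x + 2 * η)) := by rw [sub_self]; exact M.zero_mem
  have ht1 : Lat M α false (x + 2 * η - x) := by rwa [t1]
  have ht2 : Lat M α false (x - (x + 2 * η)) := by rw [t2]; exact hτ.neg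
  have aδ : AddOn M δ := h.addOn hδ h0 hx
  have aδ' : AddOn M δ' := h.addOn hδ' h0' hx'
  have aγ : AddOn M γ := h.addOn hγ ht1 hx'
  have aγ' : AddOn M γ' := h.addOn hγ' ht2 hx
  have hd := h.double_step hδ hδ' hη rfl hx hx'
  refine transition_dichotomy (x := x) (x' := x + 2 * η) (l := l) (l' := l') (γ := γ) (γ' := γ')
    hτ rfl aδ aδ' aγ aγ' hd (fun m hm => ?_) (fun m hm => ?_) (fun m hm => ?_)
  · have := h.gam_comm hδ hδ' hγ hl hx' ht1 hm
    rwa [t1] at this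
  · have := h.gam_comm hδ' hδ hγ' hl' hx ht2 hm
    rw [t2, aγ'.neg hτ] at this
    linear_combination -this
  · have hq : Lat M α true (x + η + m - x) := by
      rw [show x + η + m - x = η + m by ring]
      exact hη.add (j := false) hm
    have hq' : Lat M α true (x + η + m - (x + 2 * η)) := by
      rw [show x + η + m - (x + 2 * η) = -η + m by ring]
      exact hη.neg.add (j := false) hm
    have hm2 := Lat.two_mul (i := false) (α := α) hm
    have e1 := h.e_mul_e hγ hl hx' ht1 hq
    have e2 := h.e_mul_e hγ' hl' hx ht2 hq'
    have e3 := h.e_mul_e_self hδ hx hq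
    have e4 := h.e_mul_e_self hδ' hx' hq'
    rw [show 2 * (x + η + m - x) - (x + 2 * η - x) = 2 * m by ring] at e1
    rw [show 2 * (x + η + m - (x + 2 * η)) - (x - (x + 2 * η)) = 2 * m by ring] at e2
    rw [show 2 * (x + η + m - x) = 2 * η + 2 * m by ring, aδ hτ hm2] at e3
    rw [show 2 * (x + η + m - (x + 2 * η)) = -(2 * η) + 2 * m by ring, aδ' (M.neg_mem hτ) hm2,
      aδ'.neg hτ, hd] at e4
    rw [← e1, ← e2, show x + δ (2 * η) / 4 + δ (2 * m) / 4 =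
      x + (δ (2 * η) + δ (2 * m)) / 4 by ring, show x + 2 * η - δ (2 * η) / 4 + δ' (2 * m) / 4 =
      x + 2 * η + (-δ (2 * η) + δ' (2 * m)) / 4 by ring, ← e3, ← e4]
    ring

/-- The scalars by which `Gam` acts in degree zero are linear. -/
lemma Full.delta_linear (h : f.Full s₀ r₀) {δ : F → F} (hδ : f.IsGam s x x δ)
    (hx : f.v s x ≠ 0) : ∃ c : F, ∀ m ∈ M, δ m = c * m := by
  have h0 : Lat M α false (x - x) := by rw [sub_self]; exact M.zero_mem
  have aδ : AddOn M δ := h.addOn hδ h0 hx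
  have hsupp : ∀ η, Lat M α true η → x + 2 * η ≠ 0 → f.v s (x + 2 * η) ≠ 0 := by
    intro η hη hne
    refine h.supp ?_ hne
    have := ((h.on hx).step hη).step hη
    rw [add_one_add_one] at this
    convert this using 1
    ring
  by_cases hex : ∃ η, Lat M α true η ∧ η ≠ 0 ∧ f.v s (x + 2 * η) ≠ 0 ∧ δ (2 * η) ≠ 0 ∧
      δ (2 * η) ≠ 4 * (2 * η)
  · obtain ⟨η, hη, hη0, hv, hd0, hd4⟩ := hex
    have h2η : 2 * η ≠ 0 := mul_ne_zero two_ne_zero hη0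
    refine ⟨δ (2 * η) / (2 * η), fun m hm => ?_⟩
    have := (((h.delta_cases hδ hη hx hv).resolve_left hd0).resolve_left hd4) m hm
    field_simp
    linear_combination this
  push Not at hex
  have hor : ∀ η, Lat M α true η → δ (2 * η) = 0 ∨ δ (2 * η) = 4 * (2 * η) := by
    intro η hη
    by_cases hη0 : η = 0
    · left
      rw [hη0, mul_zero, aδ.zero]
    by_cases hv : f.v s (x + 2 * η) = 0
    · have hx0 : x + 2 * η = 0 := by
        by_contra hne
        exact hsupp η hη hne hv
      -- Only weight zero can be missing, and then `3η` reaches a weight that occurs; `δ (6η) = 3 δ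
      -- (2η)` carries the alternative back to `η`.
      have h3 : f.v s (x + 2 * (3 * η)) ≠ 0 := hsupp _ hη.three_mul (by
        rw [show x + 2 * (3 * η) = x + 2 * η + 4 * η by ring, hx0, zero_add]
        exact mul_ne_zero (by norm_num) hη0)
      have hη2 := hη.two_mul
      have e3 : δ (2 * (3 * η)) = 3 * δ (2 * η) := by
        rw [show 2 * (3 * η) = 2 * η + (2 * η + 2 * η) by ring, aδ hη2 (M.add_mem hη2 hη2),
          aδ hη2 hη2]
        ring
      have := hex (3 * η) hη.three_mul (mul_ne_zero three_ne_zero hη0) h3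
      rw [e3] at this
      by_cases hd : δ (2 * η) = 0
      · exact Or.inl hd
      · right
        linear_combination (this (mul_ne_zero three_ne_zero hd)) / 3
    · by_cases hd : δ (2 * η) = 0
      · exact Or.inl hd
      · exact Or.inr (hex η hη hη0 hv hd)
  have hc : ∃ c : F, ∀ η, Lat M α true η → δ (2 * η) = c * (2 * η) := by
    by_cases hall : ∀ η, Lat M α true η → δ (2 * η) = 0
    · exact ⟨0, fun η hη => by rw [hall η hη, zero_mul]⟩
    push Not at hall
    obtain ⟨θ, hθ, hθ0⟩ := hall
    have hθ4 := (hor θ hθ).resolve_left hθ0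
    refine ⟨4, fun η hη => (hor η hη).elim (fun hη0 => ?_) id⟩
    -- The values `0` and `4 * (2 * η)` cannot be mixed: for `2η - θ` additivity gives `-8θ`, which
    -- fits neither option unless `η = 0`.
    have e : δ (2 * (2 * η - θ)) = -(4 * (2 * θ)) := by
      have h1 := aδ (M.add_mem hη.two_mul hη.two_mul) (M.neg_mem hθ.two_mul)
      rw [aδ hη.two_mul hη.two_mul, aδ.neg hθ.two_mul, hη0, hθ4] at h1
      rw [show 2 * (2 * η - θ) = 2 * η + 2 * η + -(2 * θ) by ring, h1]
      ring
    rcases hor (2 * η - θ) (hη.two_mul.sub hθ) with h1 | h1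
    · exact absurd (by linear_combination hθ4 + e - h1) hθ0
    · rw [hη0]
      linear_combination (1 / 2 : F) * h1 - (1 / 2 : F) * e
  obtain ⟨c, hc⟩ := hc
  refine ⟨c, fun m hm => ?_⟩
  -- Linearity is known on `2(α + M)`; every `2m` is the difference of `2(α + m)` and `2α`.
  have hb : Lat M α true α := Lat.base
  have e1 := hc α hb
  have e2 := hc (α + m) (hb.add (j := false) hm)
  rw [show 2 * (α + m) = 2 * α + 2 * m by ring, aδ hb.two_mul (Lat.two_mul (i := false) (α := α) hm),
    aδ.two hm] at e2
  linear_combination (1 / 2 : F) * e2 - (1 / 2 : F) * e1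


lemma Full.exists_supp (h : f.Full s₀ r₀) (s : ZMod 2) (S : Finset F) :
    ∃ r, f.v s r ≠ 0 ∧ r ∉ S := by
  classical
  obtain ⟨i, hi⟩ : ∃ i, ∀ r, Lat M α i r → On M α s₀ r₀ s (r₀ + r) := by
    rcases zmod_two_cases s₀ s with hs | hs
    · exact ⟨false, fun r hr => Or.inl ⟨hs, by rwa [add_sub_cancel_left]⟩⟩
    · exact ⟨true, fun r hr => Or.inr ⟨hs, by rwa [add_sub_cancel_left]⟩⟩
  obtain ⟨r, hr, hrS⟩ := exists_lat_notMem (α := α) h.ne_bot i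
    (insert (-r₀) (S.image fun y => y - r₀))
  rw [Finset.mem_insert, not_or] at hrS
  refine ⟨r₀ + r, h.supp (hi r hr) fun h0 => hrS.1 (by linear_combination h0), fun hS => ?_⟩
  exact hrS.2 (Finset.mem_image.2 ⟨_, hS, by ring⟩)

lemma _root_.SVir.On.sub_mem {s₀ s t : ZMod 2} {r₀ x y : F} (hx : On M α s₀ r₀ s x)
    (hy : On M α s₀ r₀ t y) :
    (s = t → Lat M α false (y - x)) ∧ (s + 1 = t → Lat M α true (y - x)) := by
  have e : y - x = y - r₀ - (x - r₀) := by ring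
  rw [e]
  have h1 : ∀ s : ZMod 2, s + 1 ≠ s := by decide
  rcases hx with ⟨rfl, hx⟩ | ⟨rfl, hx⟩ <;> rcases hy with ⟨rfl, hy⟩ | ⟨rfl, hy⟩
  · exact ⟨fun _ => hy.sub hx, fun h => absurd h (h1 _)⟩
  · exact ⟨fun h => absurd h.symm (h1 _), fun _ => hy.sub hx⟩
  · exact ⟨fun h => absurd h (h1 _), fun _ => hy.sub hx⟩
  · exact ⟨fun _ => hy.sub hx, fun h => absurd h (h1 _)⟩

lemma Full.exists_slope (h : f.Full s₀ r₀) (hx : f.v s x ≠ 0) :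
    ∃ c : F, ∀ y, Lat M α true (y - x) → f.e (s + 1) y x * f.e s x y = x + c * (y - x) := by
  obtain ⟨δ, hδ⟩ := f.exists_isGam s x x
  obtain ⟨c, hc⟩ := h.delta_linear hδ hx
  refine ⟨c / 2, fun y hy => ?_⟩
  rw [h.e_mul_e_self hδ hx hy, hc _ hy.two_mul]
  ring

/-- Going up and down by an odd generator is given by the weight plus a multiple of the degree of
the generator which depends only on the parity. -/
lemma Full.exists_parity_slope (h : f.Full s₀ r₀) : ∃ ε : ZMod 2 → F, (∀ s, ε s + ε (s + 1) = 1) ∧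
    ∀ {s x y}, f.v s x ≠ 0 → Lat M α true (y - x) →
      f.e (s + 1) y x * f.e s x y = x + ε s * (y - x) := by
  classical
  have hex : ∀ s x, ∃ c : F, f.v s x ≠ 0 → ∀ y, Lat M α true (y - x) →
      f.e (s + 1) y x * f.e s x y = x + c * (y - x) := by
    intro s x
    by_cases hx : f.v s x = 0
    · exact ⟨0, fun h => absurd hx h⟩
    · exact (h.exists_slope hx).imp fun c hc _ => hc
  choose c hc using hex
  have hstep : ∀ {s x y}, f.v s x ≠ 0 → f.v (s + 1) y ≠ 0 → x ≠ y → c s x + c (s + 1) y = 1 := by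
    intro s x y hx hy hxy
    have hl := ((h.on hx).sub_mem (h.on hy)).2 rfl
    have e1 := hc s x hx y hl
    have e2 := hc (s + 1) y hy x (by
      have := hl.neg
      rwa [neg_sub] at this)
    -- The same product of two edges read from `x` and from `y`: `x + c (y - x) = y + c' (x - y)`.
    rw [add_one_add_one, mul_comm, e1] at e2
    have : (y - x) * (c s x + c (s + 1) y - 1) = 0 := by linear_combination e2
    linear_combination (mul_eq_zero.1 this).resolve_left (sub_ne_zero.2 (Ne.symm hxy))
  have hconst : ∀ {s x x'}, f.v s x ≠ 0 → f.v s x' ≠ 0 → c s x = c s x' := by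
    intro s x x' hx hx'
    obtain ⟨y, hy, hyS⟩ := h.exists_supp (s + 1) {x, x'}
    simp only [Finset.mem_insert, Finset.mem_singleton, not_or] at hyS
    linear_combination hstep hx hy (Ne.symm hyS.1) - hstep hx' hy (Ne.symm hyS.2)
  choose b hb using fun s => h.exists_supp s ∅
  refine ⟨fun s => c s (b s), fun s => ?_, fun {s x y} hx hy => ?_⟩
  · obtain ⟨y, hy, hyS⟩ := h.exists_supp (s + 1) {b s}
    rw [Finset.mem_singleton] at hyS
    change c s (b s) + c (s + 1) (b (s + 1)) = 1
    rw [hconst (hb (s + 1)).1 hy]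
    exact hstep (hb s).1 hy (Ne.symm hyS)
  · rw [hc s x hx y hy, hconst hx (hb s).1]

/-- Two odd steps between different weights of the same parity depend affinely on the degree. -/
lemma Full.exists_affine (h : f.Full s₀ r₀) (hx : f.v s x ≠ 0) (hx' : f.v s x' ≠ 0)
    (hne : x' ≠ x) : ∃ a b : F, ∀ y, Lat M α true (y - x) →
      f.e (s + 1) y x' * f.e s x y = a + b * (y - x) := by
  obtain ⟨ε, -, hε⟩ := h.exists_parity_slope
  obtain ⟨γ, hγ⟩ := f.exists_isGam s x x'
  obtain ⟨δ, hδ⟩ := f.exists_isGam s x x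
  obtain ⟨δ', hδ'⟩ := f.exists_isGam s x' x'
  obtain ⟨l, hl⟩ := f.exists_opL s x x'
  have ht := ((h.on hx).sub_mem (h.on hx')).1 rfl
  -- Both ends have the same slope, so the term with `δ' - δ` in `gam_comm` drops out and `γ`
  -- becomes linear.
  have hslope : ∀ {x δ}, f.IsGam s x x δ → f.v s x ≠ 0 → ∀ m ∈ M, δ m = 2 * ε s * m := by
    intro x δ hδ hx
    obtain ⟨c, hc⟩ := h.delta_linear hδ hx
    obtain ⟨η, hη, hη0, -⟩ := h.exists_omega
    have hl : Lat M α true (x + η - x) := by rwa [add_sub_cancel_left]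
    have e1 := hε hx hl
    rw [h.e_mul_e_self hδ hx hl, hc _ hl.two_mul, add_sub_cancel_left] at e1
    have e2 : η * (c - 2 * ε s) = 0 := by linear_combination 2 * e1
    intro m hm
    rw [hc m hm, sub_eq_zero.1 ((mul_eq_zero.1 e2).resolve_left hη0)]
  have hτ := sub_ne_zero.2 hne
  refine ⟨l - γ (x' - x) / 4, γ (x' - x) / (2 * (x' - x)), fun y hy => ?_⟩
  have hm : 2 * (y - x) - (x' - x) ∈ M := hy.two_mul.sub ht
  have e1 := h.e_mul_e hγ hl hx' ht hy
  have e2 := h.gam_comm hδ hδ' hγ hl hx' ht hm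
  rw [hslope hδ hx _ hm, hslope hδ' hx' _ hm] at e2
  rw [e1]
  field_simp
  linear_combination 2 * e2

end Frame
end Scalars

/-! ### Recognising the standard modules. -/

section Identification

variable {F : Type*} [Field F] [CharZero F] {M : AddSubgroup F} {α : F}
  [hα : Fact (2 * α ∈ M)] {V : Type*} [AddCommGroup V] [Module F V]

lemma On.shift {s₀ s : ZMod 2} {r₀ a r : F} (h : On M α s₀ r₀ s a) (hr : Lat M α false (r - a)) :
    On M α s₀ r₀ s r := by
  refine Or.imp (And.imp_right fun h => ?_) (And.imp_right fun h => ?_) h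
  all_goals
    have := hr.add h
    rwa [sub_add_sub_cancel] at this

lemma On.shift_odd {s₀ s : ZMod 2} {r₀ a r : F} (h : On M α s₀ r₀ s a)
    (hr : Lat M α true (r - a)) : On M α s₀ r₀ (s + 1) r := by
  have := h.step hr
  rwa [add_sub_cancel] at this

namespace Frame

variable {A : SuperModule (algebra hα.out) V} {f : Frame A} {s₀ s : ZMod 2} {r₀ a : F}

lemma span_eq_top (hA : IsIntermediateSeries A) {R : Set V}
    (h : ∀ t x, f.v t x ≠ 0 → f.v t x ∈ Submodule.span F R) : Submodule.span F R = ⊤ := by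
  rw [eq_top_iff, ← iSup_wt_eq_top hA]
  refine iSup_le fun i x hx => ?_
  obtain ⟨c, rfl⟩ := f.span hx
  refine Submodule.smul_mem _ c ?_
  by_cases h0 : f.v i.1 i.2 = 0
  · rw [h0]
    exact Submodule.zero_mem _
  · exact h _ _ h0

lemma Full.on_cases (h : f.Full s₀ r₀) (ha : On M α s₀ r₀ s a) {t : ZMod 2} {x : F}
    (hx : f.v t x ≠ 0) :
    (t = s ∧ Lat M α false (x - a)) ∨ (t = s + 1 ∧ Lat M α true (x - a)) := by
  have := ha.sub_mem (h.on hx)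
  rcases zmod_two_cases s t with rfl | rfl
  · exact Or.inl ⟨rfl, this.1 rfl⟩
  · exact Or.inr ⟨rfl, this.2 rfl⟩

lemma Full.span_sum_eq_top (h : f.Full s₀ r₀) (ha : On M α s₀ r₀ s a) {R : Set V} {u u' : F → V}
    (hR : ∀ r, Lat M α false (r - a) → u r ∈ R) (hR' : ∀ y, Lat M α true (y - a) → u' y ∈ R)
    (hs : ∀ r, Lat M α false (r - a) → ∃ c : F, f.v s r = c • u r)
    (hs' : ∀ y, Lat M α true (y - a) → ∃ c : F, f.v (s + 1) y = c • u' y) :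
    Submodule.span F R = ⊤ := by
  refine span_eq_top (f := f) h.series fun t x hx => ?_
  rcases h.on_cases ha hx with ⟨rfl, hl⟩ | ⟨rfl, hl⟩
  · obtain ⟨c, hc⟩ := hs x hl
    rw [hc]
    exact Submodule.smul_mem _ c (Submodule.subset_span (hR x hl))
  · obtain ⟨c, hc⟩ := hs' x hl
    rw [hc]
    exact Submodule.smul_mem _ c (Submodule.subset_span (hR' x hl))

/-- The vectors `u r` and `u' y` may be zero: only spanning is required, because the standard module
is mapped onto `A`. -/
lemma Full.subquotient_SAab (h : f.Full s₀ r₀) (ha : On M α s₀ r₀ s a) {b : F} {u u' : F → V}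
    (hu : ∀ r, Lat M α false (r - a) → u r ∈ wt A s r)
    (hG : ∀ r k, Lat M α false (r - a) → Lat M α true k → opG A k (u r) = u' (r + k))
    (hG' : ∀ y k, Lat M α true (y - a) → Lat M α true k →
      opG A k (u' y) = (y + 2 * k * (b - 1 / 2)) • u (y + k))
    (hs : ∀ r, Lat M α false (r - a) → ∃ c : F, f.v s r = c • u r)
    (hs' : ∀ y, Lat M α true (y - a) → ∃ c : F, f.v (s + 1) y = c • u' y) :
    A.IsNonzeroSubquotient (SAab hα.out a b) := by
  have := h.series.indecomposable.1
  have h0 : Lat M α false (a - a) := by rw [sub_self]; exact M.zero_mem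
  refine isNonzeroSubquotient_ofBasis (fun x => by cases x <;> rfl) h.opC_eq s
    (Sum.elim (fun μ : M => u (a + μ)) fun ν : Coset M α => u' (a + ν)) ?_ ?_ ?_
  · rintro (μ | ν)
    · have := (hu (a + μ) (by rw [add_sub_cancel_left]; exact μ.2)).1
      simpa [basisParity] using this
    · have := hG a ν h0 ν.2
      have h1 := (opG_mem_wt (hu a h0) (k := (ν : F)) rfl).1
      rw [this] at h1
      simpa [basisParity, add_comm] using h1
  · refine h.span_sum_eq_top ha (u := u) (u' := u') (fun r hr => ?_) (fun r hr => ?_) hs hs'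
    · exact ⟨Sum.inl ⟨r - a, hr⟩, by simp⟩
    · exact ⟨Sum.inr ⟨r - a, hr⟩, by simp⟩
  · rintro k hk (μ | ν)
    · have := hG (a + μ) k (by rw [add_sub_cancel_left]; exact μ.2) hk
      simp only [Sum.elim_inl, actSAab, Finsupp.linearCombination_single, one_smul, Sum.elim_inr,
        addC_val, this, add_assoc]
    · have := hG' (a + ν) k (by rw [add_sub_cancel_left]; exact ν.2) hk
      simp only [Sum.elim_inl, actSAab, Finsupp.linearCombination_single, Sum.elim_inr,
        addCC_val, this]
      rw [show a + (k + (ν : F)) = a + ν + k by ring]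

lemma Full.subquotient_SAa (h : f.Full s₀ r₀) (h0 : On M α s₀ r₀ s 0) {a : F} {u u' : F → V}
    (hu : ∀ r, Lat M α false r → u r ∈ wt A s r)
    (hu' : ∀ r, Lat M α true r → u' r ∈ wt A (s + 1) r)
    (hG : ∀ r k, Lat M α false r → r ≠ 0 → Lat M α true k → opG A k (u r) = u' (r + k))
    (hG0 : ∀ k, Lat M α true k → opG A k (u 0) = (2 * k + a) • u' k)
    (hG' : ∀ y k, Lat M α true y → Lat M α true k → opG A k (u' y) = (y + k) • u (y + k))
    (hs : ∀ r, Lat M α false r → ∃ c : F, f.v s r = c • u r)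
    (hs' : ∀ y, Lat M α true y → ∃ c : F, f.v (s + 1) y = c • u' y) :
    A.IsNonzeroSubquotient (SAa hα.out a) := by
  have := h.series.indecomposable.1
  refine isNonzeroSubquotient_ofBasis (fun x => by cases x <;> rfl) h.opC_eq s
    (Sum.elim (fun μ : M => u μ) fun ν : Coset M α => u' ν) ?_ ?_ ?_
  · rintro (μ | ν)
    · simpa [basisParity] using (hu μ μ.2).1
    · simpa [basisParity, add_comm] using (hu' ν ν.2).1
  · refine h.span_sum_eq_top h0 (u := u) (u' := u') (fun r hr => ?_) (fun r hr => ?_)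
      (by simpa only [sub_zero] using hs) (by simpa only [sub_zero] using hs')
    · rw [sub_zero] at hr
      exact ⟨Sum.inl ⟨r, hr⟩, rfl⟩
    · rw [sub_zero] at hr
      exact ⟨Sum.inr ⟨r, hr⟩, rfl⟩
  · rintro k hk (μ | ν)
    · simp only [Sum.elim_inl, actSAa, Finsupp.linearCombination_single, Sum.elim_inr, addC_val]
      split_ifs with hμ
      · rw [hμ, hG0 k hk, zero_add]
      · rw [hG μ k μ.2 hμ hk, one_smul]
    · simp only [Sum.elim_inl, actSAa, Finsupp.linearCombination_single, Sum.elim_inr, addCC_val]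
      rw [hG' ν k ν.2 hk, add_comm k]

lemma Full.subquotient_SBa (h : f.Full s₀ r₀) (h0 : On M α s₀ r₀ s 0) {a : F} {u u' : F → V}
    (hu : ∀ r, Lat M α false r → u r ∈ wt A s r)
    (hu' : ∀ r, Lat M α true r → u' r ∈ wt A (s + 1) r)
    (hG : ∀ r k, Lat M α false r → Lat M α true k → opG A k (u r) = r • u' (r + k))
    (hG0 : ∀ k, Lat M α true k → opG A k (u' (-k)) = (2 * k + a) • u 0)
    (hG' : ∀ y k, Lat M α true y → Lat M α true k → y + k ≠ 0 → opG A k (u' y) = u (y + k))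
    (hs : ∀ r, Lat M α false r → ∃ c : F, f.v s r = c • u r)
    (hs' : ∀ y, Lat M α true y → ∃ c : F, f.v (s + 1) y = c • u' y) :
    A.IsNonzeroSubquotient (SBa hα.out a) := by
  have := h.series.indecomposable.1
  -- In `SB_a` the vectors indexed by `M` are odd, hence the parity shift is `s + 1`.
  refine isNonzeroSubquotient_ofBasis (fun x => by cases x <;> rfl) h.opC_eq (s + 1)
    (Sum.elim (fun ν : Coset M α => u' ν) fun μ : M => u μ) ?_ ?_ ?_
  · rintro (ν | μ)
    · simpa [basisParity] using (hu' ν ν.2).1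
    · have h2 : 1 + (s + 1) = s := by rw [add_comm, add_one_add_one]
      simpa [basisParity, h2] using (hu μ μ.2).1
  · refine h.span_sum_eq_top h0 (u := u) (u' := u') (fun r hr => ?_) (fun r hr => ?_)
      (by simpa only [sub_zero] using hs) (by simpa only [sub_zero] using hs')
    · rw [sub_zero] at hr
      exact ⟨Sum.inr ⟨r, hr⟩, rfl⟩
    · rw [sub_zero] at hr
      exact ⟨Sum.inl ⟨r, hr⟩, rfl⟩
  · rintro k hk (ν | μ)
    · simp only [Sum.elim_inl, actSBa, Finsupp.linearCombination_single, Sum.elim_inr, addCC_val]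
      split_ifs with hν
      · rw [hν, ← hG0 k hk, show (ν : F) = -k by linear_combination hν]
      · rw [add_comm k, hG' ν k ν.2 hk (by rwa [add_comm]), one_smul]
    · simp only [Sum.elim_inl, actSBa, Finsupp.linearCombination_single, Sum.elim_inr, addC_val]
      rw [hG μ k μ.2 hk]

/-- If the odd generators map normalised vectors of one parity to normalised vectors of the other,
the module is a subquotient of `SA_{a,b}`. -/
lemma Full.subquotient_SAab_of_normal (h : f.Full s₀ r₀) (ha : On M α s₀ r₀ s a)
    {ε : ZMod 2 → F}
    (hε : ∀ {s x y}, f.v s x ≠ 0 → Lat M α true (y - x) →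
      f.e (s + 1) y x * f.e s x y = x + ε s * (y - x)) {u u' : F → V}
    (hu : ∀ r, Lat M α false (r - a) → u r ∈ wt A s r)
    (hG : ∀ r k, Lat M α false (r - a) → Lat M α true k → opG A k (u r) = u' (r + k))
    (hs : ∀ r, Lat M α false (r - a) → ∃ c : F, f.v s r = c • u r)
    (hs' : ∀ y, Lat M α true (y - a) → ∃ c : F, f.v (s + 1) y = c • u' y) :
    A.IsNonzeroSubquotient (SAab hα.out a (1 - ε s / 2)) := by
  refine h.subquotient_SAab ha hu hG (fun y k hy hk => ?_) hs hs'
  have hl : Lat M α false (y + k - a) := by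
    have := hy.add hk
    rwa [← add_sub_right_comm] at this
  -- `u' y` is the image of `u (y + k)` under `G_{-k}`, so the step back is a return product at `y +
  -- k`, equal to `y + k - ε k`. This fixes `b = 1 - ε / 2`.
  have h1 := hG (y + k) (-k) hl hk.neg
  rw [add_neg_cancel_right] at h1
  rw [← h1]
  obtain ⟨c, hc⟩ := f.span (hu _ hl)
  by_cases hv : f.v s (y + k) = 0
  · rw [hc, hv]
    simp
  · rw [hc, map_smul, map_smul, f.act_act (y := y) (w := y + k) (by ring) rfl,
      hε hv (by rw [sub_add_cancel_left]; exact hk.neg), smul_smul, smul_smul]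
    congr 1
    ring


/-! ### The case of slopes different from zero and one. -/

/-- A polynomial of degree two which vanishes on a coset of `M` vanishes identically. -/
lemma coeff_eq_zero_of_coset (hM : M ≠ ⊥) {p₀ p₁ p₂ y₀ : F}
    (hp : ∀ y, y - y₀ ∈ M → p₀ + p₁ * y + p₂ * y ^ 2 = 0) : p₀ = 0 ∧ p₁ = 0 ∧ p₂ = 0 := by
  obtain ⟨m, hm, hm0⟩ := (Submodule.ne_bot_iff (AddSubgroup.toIntSubmodule M)).1 (by simpa using hM)
  have e0 := hp y₀ (by rw [sub_self]; exact M.zero_mem)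
  have e1 := hp (y₀ + m) (by rw [add_sub_cancel_left]; exact hm)
  have e2 := hp (y₀ - m) (by rw [sub_sub_cancel_left]; exact M.neg_mem hm)
  have k2 : (2 * m ^ 2) * p₂ = 0 := by linear_combination e1 + e2 - 2 * e0
  have h2 := (mul_eq_zero.1 k2).resolve_left (mul_ne_zero two_ne_zero (pow_ne_zero 2 hm0))
  rw [h2] at e0 e1 e2
  have k1 : m * p₁ = 0 := by linear_combination e1 - e0
  have h1 := (mul_eq_zero.1 k1).resolve_left hm0
  rw [h1] at e0
  exact ⟨by linear_combination e0, h1, h2⟩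

/-- Two factorisations into affine functions agree up to order and units. -/
lemma affine_factors {a b a' b' c c' ε : F} (hε : ε ≠ 0) (h0 : a * a' = c * c')
    (h1 : a * b' + a' * b = ε * (c + c')) (h2 : b * b' = ε ^ 2) :
    ∃ β : F, β ≠ 0 ∧ b = β * ε ∧ ((a = β * c' ∧ β * a' = c) ∨ (a = β * c ∧ β * a' = c')) ∧
      β * b' = ε := by
  have hb : b ≠ 0 := by
    rintro rfl
    rw [zero_mul] at h2
    exact pow_ne_zero 2 hε h2.symm
  obtain ⟨β, rfl⟩ : ∃ β, b = β * ε := ⟨b / ε, by field_simp⟩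
  have hβ : β ≠ 0 := left_ne_zero_of_mul hb
  have hb' : β * b' = ε := by
    apply mul_left_cancel₀ hε
    linear_combination h2
  have h3 : a + β ^ 2 * a' = β * (c + c') := by
    apply mul_left_cancel₀ hε
    linear_combination β * h1 - a * hb'
  have h4 : (a - β * c') * (a - β * c) = 0 := by
    linear_combination a * h3 - β ^ 2 * h0
  refine ⟨β, hβ, rfl, ?_, hb'⟩
  rcases mul_eq_zero.1 h4 with h | h
  · refine Or.inl ⟨sub_eq_zero.1 h, ?_⟩
    apply mul_left_cancel₀ hβ
    linear_combination h3 - h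
  · refine Or.inr ⟨sub_eq_zero.1 h, ?_⟩
    apply mul_left_cancel₀ hβ
    linear_combination h3 - h

/-- If two equivalence relations cover all pairs, one of them relates all pairs. -/
lemma total_of_cover {X : Type*} {E O : X → X → Prop} (hE : Equivalence E) (hO : Equivalence O)
    (h : ∀ x y, E x y ∨ O x y) : (∀ x y, E x y) ∨ ∀ x y, O x y := by
  by_cases hc : ∀ x y, E x y
  · exact Or.inl hc
  push Not at hc
  obtain ⟨a, b, hab⟩ := hc
  have hOab := (h a b).resolve_left hab
  have key : ∀ c, O a c := by
    intro c
    rcases h a c with hac | hac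
    · have hbc : O b c := (h b c).resolve_left fun hbc => hab (hE.trans hac (hE.symm hbc))
      exact hO.trans hOab hbc
    · exact hac
  exact Or.inr fun x y => hO.trans (hO.symm (key x)) (key y)

/-- A missing vector would have weight zero, and the return product to it from a weight `y ≠ 0` of
the other parity would be both `0` and `ε s * y`. -/
lemma Full.no_hole (h : f.Full s₀ r₀) {ε : ZMod 2 → F} (hsum : ∀ s, ε s + ε (s + 1) = 1)
    (hε : ∀ {s x y}, f.v s x ≠ 0 → Lat M α true (y - x) →
      f.e (s + 1) y x * f.e s x y = x + ε s * (y - x)) (hs : ε s ≠ 0) {x : F}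
    (hx : On M α s₀ r₀ s x) : f.v s x ≠ 0 := by
  intro hv
  have hx0 : x = 0 := by
    by_contra hne
    exact h.supp hx hne hv
  obtain ⟨y, hy, hyS⟩ := h.exists_supp (s + 1) {0}
  rw [Finset.mem_singleton] at hyS
  have hl := (hx.sub_mem (h.on hy)).2 rfl
  have e := hε hy (y := x) (by
    have := hl.neg
    rwa [neg_sub] at this)
  rw [add_one_add_one, f.e_src _ hv, zero_mul, hx0] at e
  refine mul_ne_zero hyS hs ?_
  linear_combination y * hsum s - e

lemma Full.exists_on (h : f.Full s₀ r₀) (s : ZMod 2) : ∃ r, f.v s r ≠ 0 ∧ r ≠ 0 := by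
  obtain ⟨r, hr, h0⟩ := h.exists_supp s {0}
  exact ⟨r, hr, by simpa using h0⟩

/-- The case of slopes different from `0` and `1`. -/
lemma Full.exists_SAab_of_generic (h : f.Full s₀ r₀) {ε : ZMod 2 → F}
    (hsum : ∀ s, ε s + ε (s + 1) = 1)
    (hε : ∀ {s x y}, f.v s x ≠ 0 → Lat M α true (y - x) →
      f.e (s + 1) y x * f.e s x y = x + ε s * (y - x)) (hne : ∀ s, ε s ≠ 0) :
    ∃ a b : F, A.IsNonzeroSubquotient (SAab hα.out a b) := by
  have hsupp : ∀ {s x}, On M α s₀ r₀ s x → f.v s x ≠ 0 := fun hx => h.no_hole hsum hε (hne _) hx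
  set s := s₀ with hs
  let X := {x : F // On M α s₀ r₀ s x}
  have hlat : ∀ (x : X) {y}, On M α s₀ r₀ (s + 1) y → Lat M α true (y - x) := fun x y hy =>
    (x.2.sub_mem hy).2 rfl
  have hlat' : ∀ (x : X) {y}, On M α s₀ r₀ (s + 1) y → Lat M α true (x - y) := fun x y hy => by
    have := (hlat x hy).neg
    rwa [neg_sub] at this
  -- `E` says that the outgoing constants of two weights are proportional, `O` the same for the
  -- incoming ones.
  let E : X → X → Prop := fun x x' => ∃ β : F, β ≠ 0 ∧
    ∀ y, On M α s₀ r₀ (s + 1) y → f.e s x y = β * f.e s x' y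
  let O : X → X → Prop := fun x x' => ∃ β : F, β ≠ 0 ∧
    ∀ y, On M α s₀ r₀ (s + 1) y → f.e (s + 1) y x = β * f.e (s + 1) y x'
  have hE : Equivalence E := by
    refine ⟨fun x => ⟨1, one_ne_zero, fun y _ => (one_mul _).symm⟩, ?_, ?_⟩
    · rintro x x' ⟨β, hβ, hx⟩
      exact ⟨β⁻¹, inv_ne_zero hβ, fun y hy => by rw [hx y hy, inv_mul_cancel_left₀ hβ]⟩
    · rintro x x' x'' ⟨β, hβ, hx⟩ ⟨γ, hγ, hx'⟩
      exact ⟨β * γ, mul_ne_zero hβ hγ, fun y hy => by rw [hx y hy, hx' y hy, mul_assoc]⟩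
  have hO : Equivalence O := by
    refine ⟨fun x => ⟨1, one_ne_zero, fun y _ => (one_mul _).symm⟩, ?_, ?_⟩
    · rintro x x' ⟨β, hβ, hx⟩
      exact ⟨β⁻¹, inv_ne_zero hβ, fun y hy => by rw [hx y hy, inv_mul_cancel_left₀ hβ]⟩
    · rintro x x' x'' ⟨β, hβ, hx⟩ ⟨γ, hγ, hx'⟩
      exact ⟨β * γ, mul_ne_zero hβ hγ, fun y hy => by rw [hx y hy, hx' y hy, mul_assoc]⟩
  have h1ε : 1 - ε s ≠ 0 := by
    rw [sub_ne_zero]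
    intro h1
    exact hne (s + 1) (by linear_combination hsum s + h1)
  obtain ⟨y₁, hy₁, -⟩ := h.exists_on (s + 1)
  have hy₁on := h.on hy₁
  have hnear : ∀ {y}, y - y₁ ∈ M → On M α s₀ r₀ (s + 1) y := fun hy => hy₁on.shift hy
  have hcover : ∀ x x', E x x' ∨ O x x' := by
    intro x x'
    by_cases hxx : x = x'
    · rw [hxx]
      exact Or.inl (hE.refl x')
    have hxx' : (x' : F) ≠ x := fun h => hxx (Subtype.ext h.symm)
    have hx := hsupp x.2
    have hx' := hsupp x'.2
    obtain ⟨a, b, hab⟩ := h.exists_affine hx hx' hxx'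
    obtain ⟨a', b', hab'⟩ := h.exists_affine hx' hx hxx'.symm
    -- The two transitions use the same four edges as the two returns. Both products are polynomials
    -- in `y`, and they agree on a coset, so their coefficients agree.
    have prod : ∀ y, y - y₁ ∈ M → ((a - b * x) * (a' - b' * x') -
        ((1 - ε s) * x) * ((1 - ε s) * x')) + ((a - b * x) * b' + (a' - b' * x') * b -
        ε s * ((1 - ε s) * x + (1 - ε s) * x')) * y + (b * b' - ε s ^ 2) * y ^ 2 = 0 := by
      intro y hy
      have hy' := hnear hy
      have e1 := hab y (hlat x hy')
      have e2 := hab' y (hlat x' hy')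
      have e3 := hε hx (hlat x hy')
      have e4 := hε hx' (hlat x' hy')
      have e5 : (a + b * (y - x)) * (a' + b' * (y - x')) =
          (x + ε s * (y - x)) * (x' + ε s * (y - x')) := by
        rw [← e1, ← e2, ← e3, ← e4]
        ring
      linear_combination e5
    obtain ⟨k0, k1, k2⟩ := coeff_eq_zero_of_coset h.ne_bot prod
    obtain ⟨β, hβ, hb, hcase, hb'⟩ := affine_factors (hne s) (sub_eq_zero.1 k0) (sub_eq_zero.1 k1)
      (sub_eq_zero.1 k2)
    -- The affine return functions of distinct weights have no common zero since `ε ≠ 1`. This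
    -- allows cancellation of edges at every `y`.
    have hsep : ∀ y : F, (x : F) + ε s * (y - x) = 0 → (x' : F) + ε s * (y - x') = 0 → False := by
      intro y e e'
      refine mul_ne_zero h1ε (sub_ne_zero.2 hxx') ?_
      linear_combination e' - e
    rcases hcase with ⟨ha, ha'⟩ | ⟨ha, ha'⟩
    · refine Or.inl ⟨β, hβ, fun y hy => ?_⟩
      have e1 := hab y (hlat x hy)
      have e2 := hab' y (hlat x' hy)
      have e3 := hε hx (hlat x hy)
      have e4 := hε hx' (hlat x' hy)
      have g1 : f.e (s + 1) y x' * (f.e s x y - β * f.e s x' y) = 0 := by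
        linear_combination e1 - β * e4 + ha + (y : F) * hb
      have g2 : f.e (s + 1) y x * (f.e s x y - β * f.e s x' y) = 0 := by
        linear_combination e3 - β * e2 - ha' - (y : F) * hb'
      rcases mul_eq_zero.1 g1 with g1 | g1
      · rcases mul_eq_zero.1 g2 with g2 | g2
        · rw [g2, zero_mul] at e3
          rw [g1, zero_mul] at e4
          exact (hsep y e3.symm e4.symm).elim
        · exact sub_eq_zero.1 g2
      · exact sub_eq_zero.1 g1
    · refine Or.inr (hO.symm ⟨β, hβ, fun y hy => ?_⟩)
      have e1 := hab y (hlat x hy)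
      have e2 := hab' y (hlat x' hy)
      have e3 := hε hx (hlat x hy)
      have e4 := hε hx' (hlat x' hy)
      have g1 : f.e s x y * (f.e (s + 1) y x' - β * f.e (s + 1) y x) = 0 := by
        linear_combination e1 - β * e3 + ha + (y : F) * hb
      have g2 : f.e s x' y * (f.e (s + 1) y x' - β * f.e (s + 1) y x) = 0 := by
        linear_combination e4 - β * e2 - ha' - (y : F) * hb'
      rcases mul_eq_zero.1 g1 with g1 | g1
      · rcases mul_eq_zero.1 g2 with g2 | g2
        · rw [g1, mul_zero] at e3
          rw [g2, mul_zero] at e4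
          exact (hsep y e3.symm e4.symm).elim
        · exact sub_eq_zero.1 g2
      · exact sub_eq_zero.1 g1
  obtain ⟨x₀, hx₀, hx₀0⟩ := h.exists_on s
  obtain ⟨x₁, hx₁, hx₁S⟩ := h.exists_supp s {x₀}
  rw [Finset.mem_singleton] at hx₁S
  have hx₀on := h.on hx₀
  have hx₁on := h.on hx₁
  have hsep : ∀ y : F, x₀ + ε s * (y - x₀) = 0 → x₁ + ε s * (y - x₁) = 0 → False := by
    intro y e e'
    refine mul_ne_zero h1ε (sub_ne_zero.2 hx₁S) ?_
    linear_combination e' - e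
  -- If outgoing constants are proportional, the parity `s` supplies the even basis; otherwise the
  -- roles of the parities are exchanged.
  rcases total_of_cover hE hO hcover with ht | ht
  · have hex : ∀ r, Lat M α false (r - x₀) → ∃ β : F, β ≠ 0 ∧
        ∀ y, On M α s₀ r₀ (s + 1) y → f.e s r y = β * f.e s x₀ y := fun r hr =>
      ht ⟨r, hx₀on.shift hr⟩ ⟨x₀, hx₀on⟩
    choose! β hβ0 hβ using hex
    have hc : ∀ y, On M α s₀ r₀ (s + 1) y → f.e s x₀ y ≠ 0 := by
      intro y hy hc
      obtain ⟨γ, -, hγ⟩ := ht ⟨x₁, hx₁on⟩ ⟨x₀, hx₀on⟩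
      have e3 := hε hx₀ (hlat ⟨x₀, hx₀on⟩ hy)
      have e4 := hε hx₁ (hlat ⟨x₁, hx₁on⟩ hy)
      rw [hc, mul_zero] at e3
      rw [hγ y hy, hc, mul_zero, mul_zero] at e4
      exact hsep y e3.symm e4.symm
    refine ⟨x₀, _, h.subquotient_SAab_of_normal hx₀on hε (u := fun r => (β r)⁻¹ • f.v s r)
      (u' := fun y => f.e s x₀ y • f.v (s + 1) y)
      (fun r _ => Submodule.smul_mem _ _ (f.mem s r)) (fun r k hr hk => ?_)
      (fun r hr => ⟨β r, (smul_inv_smul₀ (hβ0 r hr) _).symm⟩)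
      (fun y hy => ⟨(f.e s x₀ y)⁻¹, (inv_smul_smul₀ (hc y (hx₀on.shift_odd hy)) _).symm⟩)⟩
    rw [map_smul, f.act rfl, hβ r hr _ ((hx₀on.shift hr).step hk), smul_smul,
      inv_mul_cancel_left₀ (hβ0 r hr)]
  · have hex : ∀ r, On M α s₀ r₀ s r → ∃ β : F, β ≠ 0 ∧
        ∀ y, On M α s₀ r₀ (s + 1) y → f.e (s + 1) y r = β * f.e (s + 1) y x₀ := fun r hr =>
      ht ⟨r, hr⟩ ⟨x₀, hx₀on⟩
    choose! β hβ0 hβ using hex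
    have hc : ∀ y, On M α s₀ r₀ (s + 1) y → f.e (s + 1) y x₀ ≠ 0 := by
      intro y hy hc
      have e3 := hε hx₀ (hlat ⟨x₀, hx₀on⟩ hy)
      have e4 := hε hx₁ (hlat ⟨x₁, hx₁on⟩ hy)
      rw [hc, zero_mul] at e3
      rw [hβ x₁ hx₁on y hy, hc, mul_zero, zero_mul] at e4
      exact hsep y e3.symm e4.symm
    have hback : ∀ {x}, Lat M α true (x - y₁) → On M α s₀ r₀ s x := fun hx => by
      have := hy₁on.shift_odd hx
      rwa [add_one_add_one] at this
    refine ⟨y₁, _, h.subquotient_SAab_of_normal hy₁on hε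
      (u := fun y => (f.e (s + 1) y x₀)⁻¹ • f.v (s + 1) y) (u' := fun x => β x • f.v (s + 1 + 1) x)
      (fun r _ => Submodule.smul_mem _ _ (f.mem (s + 1) r)) (fun y k hy hk => ?_)
      (fun y hy => ⟨f.e (s + 1) y x₀, (smul_inv_smul₀ (hc y (hy₁on.shift hy)) _).symm⟩)
      (fun x hx => ⟨(β x)⁻¹, (inv_smul_smul₀ (hβ0 x (hback hx)) _).symm⟩)⟩
    have hyk : Lat M α true (y + k - y₁) := by
      have := hy.add hk
      rwa [← add_sub_right_comm] at this
    rw [map_smul, f.act rfl, hβ _ (hback hyk) _ (hy₁on.shift hy), smul_smul, mul_comm (β _),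
      inv_mul_cancel_left₀ (hc y (hy₁on.shift hy))]

end Frame
end Identification

/-! ### The case of slope zero, with the exceptional weight zero. -/

section SlopeZero

variable {F : Type*} [Field F] [CharZero F] {M : AddSubgroup F} {α : F}
  [hα : Fact (2 * α ∈ M)] {V : Type*} [AddCommGroup V] [Module F V]

namespace Frame

variable {A : SuperModule (algebra hα.out) V} {f : Frame A} {s₀ s : ZMod 2} {r₀ : F}

/-- A vector of weight zero is not annihilated by all odd generators while being outside of their
images. -/
lemma Full.not_isolated (h : f.Full s₀ r₀) (hx : f.v s 0 ≠ 0) :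
    ∃ y, Lat M α true y ∧ (f.e s 0 y ≠ 0 ∨ f.e (s + 1) y 0 ≠ 0) := by
  by_contra! hc
  rcases partition h.series {((s, 0) : ZMod 2 × F)} (by
    intro t x k hk hd w hw
    obtain ⟨c, rfl⟩ := f.span hw
    rw [map_smul, f.act rfl]
    suffices f.e t x (x + k) = 0 by rw [this, zero_smul, smul_zero]
    by_cases h1 : t = s ∧ x = 0
    · rw [h1.1, h1.2, zero_add]
      exact (hc k hk).1
    by_cases h2 : t + 1 = s ∧ x + k = 0
    · have hx : x = -k := by linear_combination h2.2
      rw [h2.2, ← add_one_add_one t, h2.1, hx]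
      exact (hc (-k) hk.neg).2
    · exact absurd (by simp [h1, h2]) hd) with hT | hT
  · exact hx ((Submodule.eq_bot_iff _).1 (hT (s, 0) rfl) _ (f.mem s 0))
  · refine h.base ((Submodule.eq_bot_iff _).1 (hT (s₀, r₀) fun hh => h.base_ne ?_) _ (f.mem s₀ r₀))
    exact congrArg Prod.snd hh

/-- With slope zero the two returns multiply to the nonzero constant `x * x₀`. The two affine
transition functions with this product are constants, so the outgoing constants are proportional. -/
lemma Full.exists_ratio (h : f.Full s₀ r₀) {ε : ZMod 2 → F}
    (hε : ∀ {s x y}, f.v s x ≠ 0 → Lat M α true (y - x) →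
      f.e (s + 1) y x * f.e s x y = x + ε s * (y - x)) (hs : ε s = 0) {x₀ x : F}
    (hx₀ : f.v s x₀ ≠ 0) (hx₀0 : x₀ ≠ 0) (hx : On M α s₀ r₀ s x) (hx0 : x ≠ 0) :
    ∃ β : F, β ≠ 0 ∧ ∀ y, On M α s₀ r₀ (s + 1) y → f.e s x y = β * f.e s x₀ y := by
  by_cases hxx : x = x₀
  · exact ⟨1, one_ne_zero, fun y _ => by rw [hxx, one_mul]⟩
  have hvx := h.supp hx hx0
  obtain ⟨a, b, hab⟩ := h.exists_affine hvx hx₀ (Ne.symm hxx)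
  obtain ⟨a', b', hab'⟩ := h.exists_affine hx₀ hvx hxx
  have prod : ∀ y, y - (x + α) ∈ M → ((a - b * x) * (a' - b' * x₀) - x * x₀) +
      ((a - b * x) * b' + (a' - b' * x₀) * b) * y + (b * b') * y ^ 2 = 0 := by
    intro y hy
    have hy' : On M α s₀ r₀ (s + 1) y := (hx.step Lat.base).shift hy
    have l1 := (hx.sub_mem hy').2 rfl
    have l2 := ((h.on hx₀).sub_mem hy').2 rfl
    have e1 := hab y l1
    have e2 := hab' y l2
    have e3 := hε hvx l1
    have e4 := hε hx₀ l2
    rw [hs] at e3 e4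
    have e5 : (a + b * (y - x)) * (a' + b' * (y - x₀)) =
        (x + 0 * (y - x)) * (x₀ + 0 * (y - x₀)) := by
      rw [← e1, ← e2, ← e3, ← e4]
      ring
    linear_combination e5
  obtain ⟨k0, k1, k2⟩ := coeff_eq_zero_of_coset h.ne_bot prod
  have hb : b = 0 := by
    by_contra hb
    have hb' := (mul_eq_zero.1 k2).resolve_left hb
    rw [hb', mul_zero, zero_add, zero_mul, sub_zero] at k1
    rw [(mul_eq_zero.1 k1).resolve_right hb, hb'] at k0
    refine mul_ne_zero hx0 hx₀0 ?_
    linear_combination -k0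
  rw [hb] at k0 hab
  have ha : a ≠ 0 := by
    rintro rfl
    refine mul_ne_zero hx0 hx₀0 ?_
    linear_combination -k0
  refine ⟨a / x₀, div_ne_zero ha hx₀0, fun y hy => ?_⟩
  have e1 := hab y ((hx.sub_mem hy).2 rfl)
  have e2 := hε hx₀ (((h.on hx₀).sub_mem hy).2 rfl)
  rw [hs] at e2
  field_simp
  linear_combination f.e s x₀ y * e1 - f.e s x y * e2

/-- Returns at weight zero vanish, so the affine transitions out of and into it have product zero
and one of them is identically zero. By `not_isolated` both cannot be zero when the weight occurs.
-/
lemma Full.exists_affine_zero (h : f.Full s₀ r₀) {ε : ZMod 2 → F}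
    (hε : ∀ {s x y}, f.v s x ≠ 0 → Lat M α true (y - x) →
      f.e (s + 1) y x * f.e s x y = x + ε s * (y - x)) (hs : ε s = 0) {x₀ : F}
    (hx₀ : f.v s x₀ ≠ 0) (hx₀0 : x₀ ≠ 0) (h0 : On M α s₀ r₀ s 0) :
    ∃ φ₀ φ₁ χ₀ χ₁ : F, ((φ₀ = 0 ∧ φ₁ = 0) ∨ (χ₀ = 0 ∧ χ₁ = 0)) ∧
      (f.v s 0 ≠ 0 → φ₀ ≠ 0 ∨ φ₁ ≠ 0 ∨ χ₀ ≠ 0 ∨ χ₁ ≠ 0) ∧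
      ∀ y, Lat M α true y → f.e s 0 y = (φ₀ + φ₁ * y) * f.e s x₀ y ∧
        f.e (s + 1) y 0 * f.e s x₀ y = χ₀ + χ₁ * y := by
  by_cases hv : f.v s 0 = 0
  · refine ⟨0, 0, 0, 0, Or.inl ⟨rfl, rfl⟩, fun h => absurd hv h, fun y _ => ?_⟩
    have : f.v (s + 1 + 1) 0 = 0 := by rwa [add_one_add_one]
    rw [f.e_src _ hv, f.e_tgt _ this]
    simp
  have hlat : ∀ {y}, Lat M α true y → Lat M α true (y - x₀) := fun {y} hy => by
    have := (h0.sub_mem (h.on hx₀)).1 rfl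
    rw [sub_zero] at this
    exact hy.sub this
  obtain ⟨a, b, hab⟩ := h.exists_affine hv hx₀ hx₀0
  obtain ⟨a', b', hab'⟩ := h.exists_affine hx₀ hv hx₀0.symm
  simp only [sub_zero] at hab
  have e2 : ∀ {y}, Lat M α true y → f.e (s + 1) y x₀ * f.e s x₀ y = x₀ := fun {y} hy => by
    have := hε hx₀ (hlat hy)
    rwa [hs, zero_mul, add_zero] at this
  have e3 : ∀ {y}, Lat M α true y → f.e (s + 1) y 0 * f.e s 0 y = 0 := fun {y} hy => by
    have := hε hv (y := y) (by rwa [sub_zero])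
    rwa [hs, zero_mul, add_zero] at this
  have key : ∀ y, Lat M α true y → f.e s 0 y = (a / x₀ + b / x₀ * y) * f.e s x₀ y ∧
      f.e (s + 1) y 0 * f.e s x₀ y = (a' - b' * x₀) + b' * y := by
    intro y hy
    refine ⟨?_, by rw [hab' y (hlat hy)]; ring⟩
    field_simp
    linear_combination f.e s x₀ y * hab y hy - f.e s 0 y * e2 hy
  have prod : ∀ y, y - α ∈ M → (a * (a' - b' * x₀)) + (a * b' + b * (a' - b' * x₀)) * y +
      (b * b') * y ^ 2 = 0 := by
    intro y hy
    have e1 := hab y hy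
    have e1' := hab' y (hlat hy)
    have : (a + b * y) * (a' + b' * (y - x₀)) = 0 := by
      rw [← e1, ← e1']
      linear_combination f.e (s + 1) y x₀ * f.e s x₀ y * e3 hy
    linear_combination this
  obtain ⟨k0, k1, k2⟩ := coeff_eq_zero_of_coset h.ne_bot prod
  refine ⟨a / x₀, b / x₀, a' - b' * x₀, b', ?_, fun _ => ?_, key⟩
  · simp only [div_eq_zero_iff, hx₀0, or_false]
    generalize a' - b' * x₀ = d at *
    by_cases ha : a = 0
    · by_cases hb : b = 0
      · exact Or.inl ⟨ha, hb⟩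
      · rw [ha, zero_mul, zero_add] at k1
        exact Or.inr ⟨(mul_eq_zero.1 k1).resolve_left hb, (mul_eq_zero.1 k2).resolve_left hb⟩
    · have hd := (mul_eq_zero.1 k0).resolve_left ha
      rw [hd, mul_zero, add_zero] at k1
      exact Or.inr ⟨hd, (mul_eq_zero.1 k1).resolve_left ha⟩
  · by_contra! hc
    obtain ⟨y, hy, hyy⟩ := h.not_isolated hv
    obtain ⟨k1, k2⟩ := key y hy
    rw [hc.1, hc.2.1] at k1
    rw [hc.2.2.1, hc.2.2.2] at k2
    have := e2 hy
    have hne : f.e s x₀ y ≠ 0 := fun h0 => hx₀0 (by rw [← this, h0, mul_zero])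
    refine hyy.elim (fun h => h (by linear_combination k1)) fun h => mul_ne_zero h hne ?_
    linear_combination k2

/-- Normalised vectors when the slope on the parity `s` is zero. -/
lemma Full.exists_normalForm (h : f.Full s₀ r₀) {ε : ZMod 2 → F}
    (hε : ∀ {s x y}, f.v s x ≠ 0 → Lat M α true (y - x) →
      f.e (s + 1) y x * f.e s x y = x + ε s * (y - x)) (hs : ε s = 0) :
    ∃ (a : F) (u u' : F → V), On M α s₀ r₀ s a ∧
      (∀ x, u x ∈ wt A s x) ∧ (∀ y, u' y ∈ wt A (s + 1) y) ∧
      (∀ x k, On M α s₀ r₀ s x → x ≠ 0 → Lat M α true k → opG A k (u x) = u' (x + k)) ∧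
      (∀ y k, On M α s₀ r₀ (s + 1) y → Lat M α true k → y + k ≠ 0 →
        opG A k (u' y) = (y + k) • u (y + k)) ∧
      (∀ x, On M α s₀ r₀ s x → ∃ c : F, f.v s x = c • u x) ∧
      (∀ y, On M α s₀ r₀ (s + 1) y → ∃ c : F, f.v (s + 1) y = c • u' y) ∧
      (On M α s₀ r₀ s 0 → ∃ φ₀ φ₁ χ₀ χ₁ : F, ((φ₀ = 0 ∧ φ₁ = 0) ∨ (χ₀ = 0 ∧ χ₁ = 0)) ∧
        (u 0 ≠ 0 → φ₀ ≠ 0 ∨ φ₁ ≠ 0 ∨ χ₀ ≠ 0 ∨ χ₁ ≠ 0) ∧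
        ∀ k, Lat M α true k → opG A k (u 0) = (φ₀ + φ₁ * k) • u' k ∧
          opG A (-k) (u' k) = (χ₀ + χ₁ * k) • u 0) := by
  classical
  obtain ⟨x₀, hx₀, hx₀0⟩ := h.exists_on s
  have hex : ∀ x, On M α s₀ r₀ s x ∧ x ≠ 0 → ∃ β : F, β ≠ 0 ∧
      ∀ y, On M α s₀ r₀ (s + 1) y → f.e s x y = β * f.e s x₀ y := fun x hx =>
    h.exists_ratio hε hs hx₀ hx₀0 hx.1 hx.2
  choose! β hβ0 hβ using hex
  have hc : ∀ {y}, On M α s₀ r₀ (s + 1) y → f.e s x₀ y ≠ 0 := by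
    intro y hy hc
    have e := hε hx₀ (((h.on hx₀).sub_mem hy).2 rfl)
    rw [hc, mul_zero, hs, zero_mul, add_zero] at e
    exact hx₀0 e.symm
  -- The factor `β` is meaningful only at nonzero weights; the vector of weight zero keeps its
  -- scale, to be fixed case by case.
  let u : F → V := fun x => if x = 0 then f.v s 0 else (β x)⁻¹ • f.v s x
  have hu0 : u 0 = f.v s 0 := if_pos rfl
  have hu1 : ∀ {x}, x ≠ 0 → u x = (β x)⁻¹ • f.v s x := fun hx => if_neg hx
  refine ⟨x₀, u, fun y => f.e s x₀ y • f.v (s + 1) y, h.on hx₀, fun x => ?_,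
    fun y => Submodule.smul_mem _ _ (f.mem _ _), fun x k hx hx0 hk => ?_, fun y k hy hk hyk => ?_,
    fun x hx => ?_, fun y hy => ⟨(f.e s x₀ y)⁻¹, (inv_smul_smul₀ (hc hy) _).symm⟩, fun h0 => ?_⟩
  · by_cases hx : x = 0
    · rw [hx, hu0]
      exact f.mem s 0
    · rw [hu1 hx]
      exact Submodule.smul_mem _ _ (f.mem s x)
  · rw [hu1 hx0, map_smul, f.act rfl, hβ x ⟨hx, hx0⟩ _ (hx.step hk), smul_smul,
      inv_mul_cancel_left₀ (hβ0 x ⟨hx, hx0⟩)]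
  · have hx : On M α s₀ r₀ s (y + k) := by
      have := hy.step hk
      rwa [add_one_add_one] at this
    have hβ1 := hβ0 _ ⟨hx, hyk⟩
    have e := hε (h.supp hx hyk) ((hx.sub_mem hy).2 rfl)
    rw [hs, zero_mul, add_zero, hβ _ ⟨hx, hyk⟩ y hy] at e
    rw [hu1 hyk, map_smul, f.act rfl, add_one_add_one, smul_smul, smul_smul]
    congr 1
    field_simp
    linear_combination e
  · by_cases hx0 : x = 0
    · exact ⟨1, by rw [hx0, hu0, one_smul]⟩
    · exact ⟨β x, by rw [hu1 hx0, smul_inv_smul₀ (hβ0 x ⟨hx, hx0⟩)]⟩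
  · obtain ⟨φ₀, φ₁, χ₀, χ₁, h1, h2, h3⟩ := h.exists_affine_zero hε hs hx₀ hx₀0 h0
    refine ⟨φ₀, φ₁, χ₀, χ₁, h1, by rwa [hu0], fun k hk => ?_⟩
    obtain ⟨h4, h5⟩ := h3 k hk
    rw [hu0, f.act (zero_add k), h4, map_smul, f.act (add_neg_cancel k), add_one_add_one,
      smul_smul, smul_smul, ← h5, mul_comm (f.e s x₀ k)]
    exact ⟨rfl, rfl⟩

/-- The case of slope zero. -/
lemma Full.exists_of_slope_zero (h : f.Full s₀ r₀) {ε : ZMod 2 → F}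
    (hε : ∀ {s x y}, f.v s x ≠ 0 → Lat M α true (y - x) →
      f.e (s + 1) y x * f.e s x y = x + ε s * (y - x)) (hs : ε s = 0) :
    (∃ a b : F, A.IsNonzeroSubquotient (SAab hα.out a b)) ∨
    (∃ a : F, A.IsNonzeroSubquotient (SAa hα.out a)) ∨
    (∃ a : F, A.IsNonzeroSubquotient (SBa hα.out a)) := by
  classical
  obtain ⟨a, u, u', ha, hu, hu', hG, hG', hsp, hsp', h0⟩ := h.exists_normalForm hε hs
  by_cases hon : On M α s₀ r₀ s 0
  swap
  · refine Or.inl ⟨a, _, h.subquotient_SAab_of_normal ha hε (u := u) (u' := u')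
      (fun r _ => hu r) (fun r k hr hk => hG r k (ha.shift hr) ?_ hk)
      (fun r hr => hsp r (ha.shift hr)) fun y hy => hsp' y (ha.shift_odd hy)⟩
    rintro rfl
    exact hon (ha.shift hr)
  obtain ⟨φ₀, φ₁, χ₀, χ₁, h1, h2, h3⟩ := h0 hon
  have hon0 : ∀ {r}, Lat M α false r → On M α s₀ r₀ s r := fun {r} hr =>
    hon.shift (by rwa [sub_zero])
  have hon1 : ∀ {r}, Lat M α true r → On M α s₀ r₀ (s + 1) r := fun {r} hr =>
    hon.shift_odd (by rwa [sub_zero])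
  have hne : ∀ {y k : F}, y + k = 0 → k = -y := fun h => by linear_combination h
  -- Here weight zero occurs and is not reached by odd steps; the steps out are `φ₀ + φ₁ k`. A
  -- constant function gives `SA_{0,b}`, a nonconstant one gives `SA_a`.
  by_cases hA : χ₀ = 0 ∧ χ₁ = 0 ∧ u 0 ≠ 0
  · obtain ⟨rfl, rfl, hu0⟩ := hA
    simp only [zero_mul, add_zero, zero_smul] at h3
    by_cases hφ : φ₁ = 0
    · subst hφ
      have hφ0 : φ₀ ≠ 0 := by simpa using h2 hu0
      let w : F → V := fun x => if x = 0 then φ₀⁻¹ • u 0 else u x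
      have hw0 : w 0 = φ₀⁻¹ • u 0 := if_pos rfl
      have hw1 : ∀ {x}, x ≠ 0 → w x = u x := fun hx => if_neg hx
      refine Or.inl ⟨0, _, h.subquotient_SAab_of_normal hon hε (u := w) (u' := u')
        (fun r _ => ?_) (fun r k hr hk => ?_) (fun r hr => ?_) fun y hy =>
          hsp' y (hon.shift_odd hy)⟩
      · by_cases hr : r = 0
        · rw [hr, hw0]
          exact Submodule.smul_mem _ _ (hu 0)
        · rw [hw1 hr]
          exact hu r
      · by_cases hr0 : r = 0
        · rw [hr0, hw0, map_smul, (h3 k hk).1, zero_mul, add_zero, inv_smul_smul₀ hφ0, zero_add]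
        · rw [hw1 hr0, hG r k (hon.shift hr) hr0 hk]
      · obtain ⟨c, hc⟩ := hsp r (hon.shift hr)
        by_cases hr0 : r = 0
        · refine ⟨c * φ₀, ?_⟩
          rw [hc, hr0, hw0, mul_smul, smul_inv_smul₀ hφ0]
        · exact ⟨c, by rw [hc, hw1 hr0]⟩
    -- The scale turns `φ₀ + φ₁ k` into `2k + a`.
    · let w : F → V := fun x => if x = 0 then (2 / φ₁) • u 0 else u x
      have hw0 : w 0 = (2 / φ₁) • u 0 := if_pos rfl
      have hw1 : ∀ {x}, x ≠ 0 → w x = u x := fun hx => if_neg hx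
      refine Or.inr (Or.inl ⟨2 * φ₀ / φ₁, h.subquotient_SAa hon (u := w) (u' := u')
        (fun r _ => ?_) (fun r _ => hu' r) (fun r k hr hr0 hk => ?_) (fun k hk => ?_)
        (fun y k hy hk => ?_) (fun r hr => ?_) fun y hy => hsp' y (hon1 hy)⟩)
      · by_cases hr : r = 0
        · rw [hr, hw0]
          exact Submodule.smul_mem _ _ (hu 0)
        · rw [hw1 hr]
          exact hu r
      · rw [hw1 hr0, hG r k (hon0 hr) hr0 hk]
      · rw [hw0, map_smul, (h3 k hk).1, smul_smul]
        congr 1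
        field_simp
        ring
      · by_cases hyk : y + k = 0
        · rw [hyk, zero_smul, hne hyk, (h3 y hy).2]
        · rw [hw1 hyk, hG' y k (hon1 hy) hk hyk]
      · obtain ⟨c, hc⟩ := hsp r (hon0 hr)
        by_cases hr0 : r = 0
        · refine ⟨c * φ₁ / 2, ?_⟩
          rw [hc, hr0, hw0, smul_smul]
          congr 1
          field_simp
        · exact ⟨c, by rw [hc, hw1 hr0]⟩
  -- From here on nothing leaves weight zero, and the case distinction is on the steps into it.
  have hφ : ∀ k, Lat M α true k → opG A k (u 0) = 0 := by
    intro k hk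
    by_cases hu0 : u 0 = 0
    · rw [hu0, map_zero]
    · rcases h1 with h1 | h1
      · rw [(h3 k hk).1, h1.1, h1.2]
        simp
      · exact absurd ⟨h1.1, h1.2, hu0⟩ hA
  by_cases hχ : χ₁ = 0 ∨ u 0 = 0
  -- The factor `x` from the steps `u' → u` is moved into the vectors, so that the other parity
  -- plays the even part of `SA_{a,b}`.
  · let w : F → V := fun x => if x = 0 then χ₀ • u 0 else x • u x
    have hw0 : w 0 = χ₀ • u 0 := if_pos rfl
    have hw1 : ∀ {x}, x ≠ 0 → w x = x • u x := fun hx => if_neg hx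
    have hon1' : On M α s₀ r₀ (s + 1) α := hon1 Lat.base
    have hback : ∀ {r}, Lat M α true (r - α) → On M α s₀ r₀ s r := fun hr => by
      have := hon1'.shift_odd hr
      rwa [add_one_add_one] at this
    refine Or.inl ⟨α, _, h.subquotient_SAab_of_normal hon1' hε (u := u') (u' := w)
      (fun r _ => hu' r) (fun y k hy hk => ?_) (fun y hy => hsp' y (hon1'.shift hy))
      fun r hr => ?_⟩
    · by_cases hyk : y + k = 0
      · have hy' : Lat M α true y := by
          have := hk.neg
          rwa [show -k = y by linear_combination -hyk] at this
        rw [hyk, hne hyk, (h3 y hy').2, hw0]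
        rcases hχ with hχ | hχ
        · rw [hχ, zero_mul, add_zero]
        · rw [hχ, smul_zero, smul_zero]
      · rw [hw1 hyk, hG' y k (hon1'.shift hy) hk hyk]
    · obtain ⟨c, hc⟩ := hsp r (hback hr)
      rw [add_one_add_one, hc]
      by_cases hr0 : r = 0
      · rw [hr0, hw0]
        by_cases hu0 : u 0 = 0
        · exact ⟨0, by rw [hu0]; simp⟩
        · have hχ1 := hχ.resolve_right hu0
          have hχ0 : χ₀ ≠ 0 := fun h => hA ⟨h, hχ1, hu0⟩
          refine ⟨c / χ₀, ?_⟩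
          rw [smul_smul, div_mul_cancel₀ _ hχ0]
      · refine ⟨c / r, ?_⟩
        rw [hw1 hr0, smul_smul, div_mul_cancel₀ _ hr0]
  · push Not at hχ
    -- The step by `k` into zero starts at `-k` and has coefficient `χ₀ - χ₁ k`; the negative scale
    -- turns it into `2k + a`.
    let w : F → V := fun x => if x = 0 then (-(χ₁ / 2)) • u 0 else x • u x
    have hw0 : w 0 = (-(χ₁ / 2)) • u 0 := if_pos rfl
    have hw1 : ∀ {x}, x ≠ 0 → w x = x • u x := fun hx => if_neg hx
    refine Or.inr (Or.inr ⟨-(2 * χ₀ / χ₁), h.subquotient_SBa hon (u := w) (u' := u')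
      (fun r _ => ?_) (fun r _ => hu' r) (fun r k hr hk => ?_) (fun k hk => ?_)
      (fun y k hy hk hyk => ?_) (fun r hr => ?_) fun y hy => hsp' y (hon1 hy)⟩)
    · by_cases hr : r = 0
      · rw [hr, hw0]
        exact Submodule.smul_mem _ _ (hu 0)
      · rw [hw1 hr]
        exact Submodule.smul_mem _ _ (hu r)
    · by_cases hr0 : r = 0
      · rw [hr0, hw0, zero_smul, map_smul, hφ k hk, smul_zero]
      · rw [hw1 hr0, map_smul, hG r k (hon0 hr) hr0 hk]
    · have := (h3 (-k) hk.neg).2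
      rw [neg_neg] at this
      rw [this, hw0, smul_smul]
      congr 1
      have := hχ.1
      field_simp
      ring
    · rw [hw1 hyk, hG' y k (hon1 hy) hk hyk]
    · obtain ⟨c, hc⟩ := hsp r (hon0 hr)
      have := hχ.1
      by_cases hr0 : r = 0
      · refine ⟨-(2 * c / χ₁), ?_⟩
        rw [hc, hr0, hw0, smul_smul]
        congr 1
        field_simp
      · refine ⟨c / r, ?_⟩
        rw [hc, hw1 hr0, smul_smul, div_mul_cancel₀ _ hr0]

end Frame
end SlopeZero

/-! ### Assembly of the cases. -/

section Classification

variable {F : Type*} [Field F] [CharZero F] {M : AddSubgroup F} {α : F}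
  [hα : Fact (2 * α ∈ M)] {V : Type*} [AddCommGroup V] [Module F V]

variable {A : SuperModule (algebra hα.out) V} {f : Frame A}

lemma opG_eq_zero_of_no_step (hA : IsIntermediateSeries A) (hM : M ≠ ⊥)
    (hd : ∀ {s x y}, f.v s x ≠ 0 → Lat M α true (y - x) → y ≠ x → f.v (s + 1) y = 0) {k : F}
    (hk : Lat M α true k) : opG A k = 0 := by
  have hne : ∀ {k}, Lat M α true k → k ≠ 0 → opG A k = 0 := by
    intro k hk hk0
    refine linearMap_eq_of_wt hA fun s r x hx => ?_
    obtain ⟨c, rfl⟩ := f.span hx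
    rw [map_smul, f.act rfl, LinearMap.zero_apply]
    by_cases hv : f.v s r = 0
    · rw [f.e_src _ hv, zero_smul, smul_zero]
    · rw [hd hv (by rwa [add_sub_cancel_left]) (by simpa using hk0), smul_zero, smul_zero]
  by_cases hk0 : k = 0
  · subst hk0
    obtain ⟨m, hm, hmS⟩ := exists_lat_notMem (α := α) hM false {0}
    -- If `0 ∈ α + M`, the operator `G_0` is not covered by `hne`; it is a nonzero multiple of the
    -- commutator of `L_m` with `G_{-m}`.
    rw [Finset.mem_singleton] at hmS
    have hkm : Lat M α true (0 - m) := hk.sub hm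
    have := opL_mul_opG (A := A) hm hkm
    rw [hne hkm (by simpa using hmS), mul_zero, zero_mul, sub_zero, sub_add_cancel] at this
    refine (smul_eq_zero.1 this.symm).resolve_left fun h => hmS ?_
    linear_combination -(2 / 3) * h
  · exact hne hk hk0

/-- A module without steps between different weights is a quotient of `SA_{0,1}`. -/
lemma subquotient_of_no_step (hA : IsIntermediateSeries A) (hM : M ≠ ⊥) {z : F}
    (hz : opC A = z • 1)
    (hd : ∀ {s x y}, f.v s x ≠ 0 → Lat M α true (y - x) → y ≠ x → f.v (s + 1) y = 0)
    {s₀ : ZMod 2} {r₀ : F} (hv : f.v s₀ r₀ ≠ 0) : A.IsNonzeroSubquotient (SAab hα.out 0 1) := by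
  classical
  have := hA.indecomposable.1
  obtain ⟨η, hη, hηS⟩ := exists_lat_notMem (α := α) hM true {0}
  rw [Finset.mem_singleton] at hηS
  have hself : ∀ {k}, Lat M α true k → k ≠ 0 → 2 * r₀ - 1 / 3 * (k ^ 2 - 1 / 4) * z = 0 := by
    intro k hk hk0
    have hk' : Lat M α true (r₀ + k - r₀) := by rwa [add_sub_cancel_left]
    have hk'' : Lat M α true (r₀ - k - r₀) := by
      rw [sub_sub_cancel_left]
      exact hk.neg
    have := Frame.anti_self hz hv (y := r₀ + k) (y' := r₀ - k) hk' (by ring) rfl rfl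
    rw [f.e_tgt _ (hd hv hk' (by simpa using hk0)), f.e_tgt _ (hd hv hk'' (by simpa using hk0)),
      mul_zero, mul_zero, add_zero, add_sub_cancel_left] at this
    exact this.symm
  -- The return sums vanish in degrees `η` and `3η`; two different central coefficients force `z =
  -- 0`, then `r₀ = 0`.
  have hz0 : z = 0 := by
    have e1 := hself hη hηS
    have e3 := hself hη.three_mul (mul_ne_zero three_ne_zero hηS)
    have : η ^ 2 * z = 0 := by linear_combination 3 / 8 * (e1 - e3)
    exact (mul_eq_zero.1 this).resolve_left (pow_ne_zero 2 hηS)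
  have hr0 : r₀ = 0 := by
    have e1 := hself hη hηS
    rw [hz0] at e1
    linear_combination e1 / 2
  have hG : ∀ {k}, Lat M α true k → opG A k = 0 := fun hk => opG_eq_zero_of_no_step hA hM hd hk
  have hpt : ∀ t x, f.v t x ≠ 0 → t = s₀ ∧ x = 0 := by
    intro t x hx
    rcases partition hA {((s₀, r₀) : ZMod 2 × F)} (fun s r k hk _ x _ => by
      rw [hG hk, LinearMap.zero_apply]) with hT | hT
    · exact absurd ((Submodule.eq_bot_iff _).1 (hT (s₀, r₀) rfl) _ (f.mem s₀ r₀)) hv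
    · by_contra hc
      refine hx ((Submodule.eq_bot_iff _).1 (hT (t, x) fun h => hc ?_) _ (f.mem t x))
      rw [hr0] at h
      exact ⟨congrArg Prod.fst h, congrArg Prod.snd h⟩
  subst hr0
  -- Killing every basis vector of `SA_{0,1}` except `v_0` is equivariant, because `G_k w_ν = (ν +
  -- k) v_{k+ν}` never reaches `v_0`.
  let w : F → V := fun x => if x = 0 then f.v s₀ 0 else 0
  have hw0 : w 0 = f.v s₀ 0 := if_pos rfl
  have hw1 : ∀ {x}, x ≠ 0 → w x = 0 := fun hx => if_neg hx
  refine isNonzeroSubquotient_ofBasis (fun x => by cases x <;> rfl) (by rw [hz, hz0, zero_smul]) s₀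
    (Sum.elim (fun μ : M => w μ) fun _ : Coset M α => 0) ?_ ?_ ?_
  · rintro (μ | ν)
    · by_cases hμ : (μ : F) = 0
      · simpa [basisParity, hμ, hw0] using (f.mem s₀ 0).1
      · simp [hw1 hμ]
    · simp
  · refine Frame.span_eq_top (f := f) hA fun t x hx => Submodule.subset_span ⟨Sum.inl 0, ?_⟩
    obtain ⟨rfl, rfl⟩ := hpt t x hx
    simp [hw0]
  · rintro k hk (μ | ν)
    · simp [hG hk, actSAab]
    · simp only [hG hk, LinearMap.zero_apply, Sum.elim_inl, actSAab,
        Finsupp.linearCombination_single, addCC_val]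
      by_cases h : k + (ν : F) = 0
      · rw [show (0 : F) + ν + 2 * k * (1 - 1 / 2) = 0 by linear_combination h, zero_smul]
      · rw [hw1 h, smul_zero]

/-- Modules of the intermediate series are subquotients of the standard ones. -/
lemma exists_isNonzeroSubquotient (hA : IsIntermediateSeries A) (hM : M ≠ ⊥) :
    (∃ a b : F, A.IsNonzeroSubquotient (SAab hα.out a b)) ∨
    (∃ a : F, A.IsNonzeroSubquotient (SAa hα.out a)) ∨
    (∃ a : F, A.IsNonzeroSubquotient (SBa hα.out a)) := by
  obtain ⟨f⟩ := exists_frame hA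
  obtain ⟨z, hz⟩ := exists_central_charge hA
  by_cases hd : ∀ s x y, f.v s x ≠ 0 → Lat M α true (y - x) → y ≠ x → f.v (s + 1) y = 0
  · obtain ⟨s₀, r₀, x₀, hx₀, hne⟩ := exists_wt_ne_zero hA
    obtain ⟨c, rfl⟩ := f.span hx₀
    exact Or.inl ⟨0, 1, subquotient_of_no_step hA hM hz (hd _ _ _) (right_ne_zero_of_smul hne)⟩
  push Not at hd
  obtain ⟨s, x, y, hx, hxy, hne, hy⟩ := hd
  have hC : opC A = 0 := by rw [hz, Frame.central_charge_eq_zero hz hx hy hxy hne, zero_smul]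
  -- Two distinct weights occur, so one of them is nonzero; it serves as the base point.
  obtain ⟨s₀, r₀, hv, hr₀⟩ : ∃ s₀ r₀, f.v s₀ r₀ ≠ 0 ∧ r₀ ≠ 0 := by
    by_cases hx0 : x = 0
    · exact ⟨s + 1, y, hy, hx0 ▸ hne⟩
    · exact ⟨s, x, hx, hx0⟩
  have h : f.Full s₀ r₀ := ⟨hM, hA, hC, fun hv' =>
    on_of_wt_ne_zero hA (f.mem s₀ r₀) hv (f.mem _ _) hv', Frame.supp_of_ne_zero hM hC hv hr₀, hv, hr₀,
    Frame.omega_of_supp hA hM hC hv hr₀⟩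
  obtain ⟨ε, hsum, hε⟩ := h.exists_parity_slope
  by_cases hgen : ∀ s, ε s ≠ 0
  · exact Or.inl (h.exists_SAab_of_generic hsum hε hgen)
  · push Not at hgen
    obtain ⟨s, hs⟩ := hgen
    exact h.exists_of_slope_zero hε hs

end Classification

end SVir

theorem theorem5p4 {F : Type*} [Field F] [CharZero F] (M : AddSubgroup F) (hM : M ≠ ⊥) (α : F)
    (hα : 2 * α ∈ M) {V : Type*} [AddCommGroup V] [Module F V]
    (A : SuperModule (SVir.algebra hα) V) (hA : SVir.IsIntermediateSeries A) :
    (∃ a b : F, A.Isomorphic (SVir.SAab hα a b) ∨ A.IsNonzeroSubquotient (SVir.SAab hα a b)) ∨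
    (∃ a : F, A.Isomorphic (SVir.SAa hα a) ∨ A.IsNonzeroSubquotient (SVir.SAa hα a)) ∨
    (∃ a : F, A.Isomorphic (SVir.SBa hα a) ∨ A.IsNonzeroSubquotient (SVir.SBa hα a)) := by
  have : Fact (2 * α ∈ M) := ⟨hα⟩
  -- The isomorphism alternative is never needed: a module isomorphic to a standard one is already a
  -- quotient of it.
  rcases SVir.exists_isNonzeroSubquotient hA hM with ⟨a, b, h⟩ | ⟨a, h⟩ | ⟨a, h⟩
  · exact Or.inl ⟨a, b, Or.inr h⟩
  · exact Or.inr (Or.inl ⟨a, Or.inr h⟩)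
  · exact Or.inr (Or.inr ⟨a, Or.inr h⟩)
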